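/- Let $\mathcal E$ be an elementary topos (finite limits, cartesian closed, with a subobject classifier $\Omega$). A \emph{space} means a localic space in $\mathcal E$: spaces and maps form the opposite of the category of internal frames in $\mathcal E$ and internal frame homomorphisms. An object $X$ of $\mathcal E$ is identified with the \emph{discrete} space whose frame is $\Omega^X$; $1$ is the discrete space on the terminal object, and $0$ is the empty space, whose frame has one element. For an internal Boolean algebra $A$, the \emph{Stone} space $\operatorname{Spec} A$ is the space of prime filters of $A$: maps $W\to\operatorname{Spec}A$ correspond, naturally in $W$, to lattice homomorphisms from $A$ to the frame of opens of $W$. An \emph{exponential} $Y^X$ is taken in the category of spaces: it is a space with an evaluation map $Y^X\times X\to Y$ through which every map $W\times X\to Y$ factors by a unique map $W\to Y^X$. A \emph{subspace} of $L$ is a map into $L$ whose inverse image frame homomorphism is an epimorphism in $\mathcal E$; subspaces are ordered by factorization. For an open $U$ of $L$, the open subspace of $U$ has the opens $\{a\mid a\wedge U=a\}$, with inverse image $a\mapsto a\wedge U$, and its closed complement has the opens $\{a\mid a\vee U=a\}$, with inverse image $a\mapsto a\vee U$. A truth value is a subobject $\varphi$ of $1$ in $\mathcal E$; as a discrete space,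 it is isomorphic to the open subspace of $1$ that it determines. \begin{enumerate} \item Let $X$ be discrete, and let $\varphi$ be the image of $X$ in $1$. Then the exponential $0^X$ exists, and it is the closed complement in $1$ of the open subspace given by $\varphi$. It is Stone: $0^X=\operatorname{Spec}B$, where $B$ is the Boolean algebra freely generated by $\emptyset$ subject to one relation $1\le 0$ for each $x\in X$. This $B$ is the quotient of $2=\{0,1\}$ by the congruence $\{(0,0),(1,1)\}\cup\varphi\times\{(0,1),(1,0)\}$; that is, $0$ and $1$ jointly cover $B$, and $0=1$ holds in $B$ at a stage $I$ if and only if $I\to 1$ factors through $\varphi$. \item If $X$ is discrete, then $0^{0^X}$ exists and is the discrete space on the image $\varphi$ of $X$ in $1$. \item If $X=\operatorname{Spec}A$ is Stone, then $0^X$ exists and is discrete, on the subobject $\{\emptyset\mid 0=1\text{ in }A\}$ of $1$. \item In particular, for every truth value $\varphi$, $0^{0^\varphi}\cong\varphi$: double negation holds for the spatial exponential. \item For every space $L$ and every open $U$ of $L$, the open subspace of $U$ and its closed complement have join $L$ and meet the empty subspace, in the order of subspaces of $L$. In particular $\varphi\vee 0^\varphi=1$ among the subspaces of $1$, for every truth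 value $\varphi$. \end{enumerate} -/

import Mathlib

open CategoryTheory Limits MonoidalCategory CartesianMonoidalCategory

universe v u


namespace PointFree

section Lattices

variable {E : Type u} [Category.{v} E]

/-- An internal bounded distributive lattice: an object with lattice operations on its generalized
elements, natural in the stage of definition. (By the Yoneda lemma this is the same as an object
`A` with morphisms `⊤, ⊥ : 1 ⟶ A` and `⊓, ⊔ : A × A ⟶ A` that satisfy the lattice equations.) -/
structure InternalLattice (E : Type u) [Category.{v} E] where
  obj : E
  top : ∀ I : E, I ⟶ obj
  bot : ∀ I : E, I ⟶ obj
  inf : ∀ {I : E}, (I ⟶ obj) → (I ⟶ obj) → (I ⟶ obj)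
  sup : ∀ {I : E}, (I ⟶ obj) → (I ⟶ obj) → (I ⟶ obj)
  comp_top : ∀ {I J : E} (u : J ⟶ I), u ≫ top I = top J
  comp_bot : ∀ {I J : E} (u : J ⟶ I), u ≫ bot I = bot J
  comp_inf : ∀ {I J : E} (u : J ⟶ I) (a b : I ⟶ obj), u ≫ inf a b = inf (u ≫ a) (u ≫ b)
  comp_sup : ∀ {I J : E} (u : J ⟶ I) (a b : I ⟶ obj), u ≫ sup a b = sup (u ≫ a) (u ≫ b)
  inf_comm : ∀ {I : E} (a b : I ⟶ obj), inf a b = inf b a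
  sup_comm : ∀ {I : E} (a b : I ⟶ obj), sup a b = sup b a
  inf_assoc : ∀ {I : E} (a b c : I ⟶ obj), inf (inf a b) c = inf a (inf b c)
  sup_assoc : ∀ {I : E} (a b c : I ⟶ obj), sup (sup a b) c = sup a (sup b c)
  inf_sup_self : ∀ {I : E} (a b : I ⟶ obj), inf a (sup a b) = a
  sup_inf_self : ∀ {I : E} (a b : I ⟶ obj), sup a (inf a b) = a
  inf_sup_left : ∀ {I : E} (a b c : I ⟶ obj), inf a (sup b c) = sup (inf a b) (inf a c)
  inf_top : ∀ {I : E} (a : I ⟶ obj), inf a (top I) = a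
  sup_bot : ∀ {I : E} (a : I ⟶ obj), sup a (bot I) = a

namespace InternalLattice

/-- The internal order, on generalized elements: `a ≤ b` iff `a ⊓ b = a`. -/
def le (A : InternalLattice E) {I : E} (a b : I ⟶ A.obj) : Prop := A.inf a b = a

/-- `s` is the internal join of the family `a : J ⟶ A` indexed by the fibres of `f : J ⟶ I`:
`s i = ⋁ {a j | f j = i}`, in the sense of generalized elements (at all stages `K` over `I`). -/
def IsJoin (A : InternalLattice E) {I J : E} (f : J ⟶ I) (a : J ⟶ A.obj) (s : I ⟶ A.obj) : Prop :=
  ∀ ⦃K : E⦄ (u : K ⟶ I) (b : K ⟶ A.obj), A.le (u ≫ s) b ↔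
    ∀ ⦃T : E⦄ (p : T ⟶ K) (q : T ⟶ J), p ≫ u = q ≫ f → A.le (q ≫ a) (p ≫ b)

/-- An internal lattice is an internal frame if all internal families have joins, and binary
meets distribute over them. -/
structure IsFrame (A : InternalLattice E) : Prop where
  exists_join : ∀ {I J : E} (f : J ⟶ I) (a : J ⟶ A.obj), ∃ s : I ⟶ A.obj, A.IsJoin f a s
  inf_join : ∀ {I J : E} (f : J ⟶ I) (a : J ⟶ A.obj) (s c : I ⟶ A.obj), A.IsJoin f a s →
    A.IsJoin f (A.inf (f ≫ c) a) (A.inf c s)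

/-- An internal Boolean algebra: every generalized element has a complement. -/
def IsBoolean (A : InternalLattice E) : Prop :=
  ∀ {I : E} (a : I ⟶ A.obj), ∃ b : I ⟶ A.obj, A.inf a b = A.bot I ∧ A.sup a b = A.top I

/-- Homomorphisms of internal bounded lattices. -/
@[ext]
structure Hom (A B : InternalLattice E) where
  map : A.obj ⟶ B.obj
  top_map : ∀ I : E, A.top I ≫ map = B.top I
  bot_map : ∀ I : E, A.bot I ≫ map = B.bot I
  inf_map : ∀ {I : E} (a b : I ⟶ A.obj), A.inf a b ≫ map = B.inf (a ≫ map) (b ≫ map)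
  sup_map : ∀ {I : E} (a b : I ⟶ A.obj), A.sup a b ≫ map = B.sup (a ≫ map) (b ≫ map)

/-- The generalized elements of an internal lattice at stage `I`, as an external lattice. -/
def El (A : InternalLattice E) (I : E) : Type v := I ⟶ A.obj

instance (A : InternalLattice E) (I : E) : DistribLattice (A.El I) :=
  letI _L : Lattice (A.El I) :=
    @Lattice.mk' (A.El I) ⟨fun a b => A.sup a b⟩ ⟨fun a b => A.inf a b⟩ A.sup_comm A.sup_assoc
      A.inf_comm A.inf_assoc A.sup_inf_self A.inf_sup_self
  DistribLattice.ofInfSupLe fun a b c => le_of_eq (A.inf_sup_left a b c)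

section Order

variable (A : InternalLattice E) {I J : E}

lemma le_iff (a b : I ⟶ A.obj) : A.le a b ↔ (show A.El I from a) ≤ (show A.El I from b) :=
  inf_eq_left (a := (show A.El I from a)) (b := (show A.El I from b))

lemma le_refl (a : I ⟶ A.obj) : A.le a a := (A.le_iff _ _).2 (_root_.le_refl _)

variable {A}

lemma le.trans {a b c : I ⟶ A.obj} (h : A.le a b) (k : A.le b c) : A.le a c :=
  (A.le_iff _ _).2 (((A.le_iff _ _).1 h).trans ((A.le_iff _ _).1 k))

lemma le.antisymm {a b : I ⟶ A.obj} (h : A.le a b) (k : A.le b a) : a = b :=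
  _root_.le_antisymm (α := A.El I) ((A.le_iff _ _).1 h) ((A.le_iff _ _).1 k)

lemma le.comp {a b : I ⟶ A.obj} (h : A.le a b) (u : J ⟶ I) : A.le (u ≫ a) (u ≫ b) := by
  unfold le at *; rw [← A.comp_inf, h]

lemma le_meet_iff {a b c : I ⟶ A.obj} : A.le c (A.inf a b) ↔ A.le c a ∧ A.le c b := by
  simp only [le_iff]
  exact _root_.le_inf_iff (α := A.El I)

lemma join_le_iff {a b c : I ⟶ A.obj} : A.le (A.sup a b) c ↔ A.le a c ∧ A.le b c := by
  simp only [le_iff]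
  exact _root_.sup_le_iff (α := A.El I)

lemma le_top (a : I ⟶ A.obj) : A.le a (A.top I) := A.inf_top a

lemma bot_le (a : I ⟶ A.obj) : A.le (A.bot I) a := by
  have h : A.le (A.bot I) (A.sup a (A.bot I)) := (join_le_iff.1 (A.le_refl _)).2
  rwa [A.sup_bot] at h

lemma sup_eq_iff_le {a b : I ⟶ A.obj} : A.sup a b = a ↔ A.le b a := by
  rw [le_iff]
  exact _root_.sup_eq_left (α := A.El I)

variable (A)

lemma sup_inf_distrib (a b c : I ⟶ A.obj) : A.sup (A.inf a b) c = A.inf (A.sup a c) (A.sup b c) :=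
  sup_inf_right (α := A.El I) a b c

lemma sup_sup_distrib (a b c : I ⟶ A.obj) : A.sup (A.sup a b) c = A.sup (A.sup a c) (A.sup b c) :=
  sup_sup_distrib_right (α := A.El I) a b c

lemma inf_inf_distrib (a b c : I ⟶ A.obj) : A.inf (A.inf a b) c = A.inf (A.inf a c) (A.inf b c) :=
  inf_inf_distrib_right (α := A.El I) a b c

lemma inf_sup_distrib (a b c : I ⟶ A.obj) : A.inf (A.sup a b) c = A.sup (A.inf a c) (A.inf b c) :=
  inf_sup_right (α := A.El I) a b c

/-- Binary meets distribute over internal joins if there is a (stable) Heyting implication. -/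
lemma inf_join_of_imp (himp : ∀ {K : E} (y z : K ⟶ A.obj), ∃ w : K ⟶ A.obj,
      ∀ {T : E} (p : T ⟶ K) (x : T ⟶ A.obj),
        A.le x (p ≫ w) ↔ A.le (A.inf x (p ≫ y)) (p ≫ z))
    {I J : E} (f : J ⟶ I) (a : J ⟶ A.obj) (s c : I ⟶ A.obj) (hs : A.IsJoin f a s) :
    A.IsJoin f (A.inf (f ≫ c) a) (A.inf c s) := by
  intro K u b
  obtain ⟨w, hw⟩ := himp (u ≫ c) b
  have h1 := hw (𝟙 K) (u ≫ s)
  simp only [Category.id_comp] at h1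
  rw [A.comp_inf, A.inf_comm, ← h1, hs]
  refine forall_congr' fun T => forall_congr' fun p => forall_congr' fun q =>
    forall_congr' fun hpq => ?_
  rw [hw, A.comp_inf, A.inf_comm (q ≫ a), ← Category.assoc p, ← Category.assoc q, hpq]

end Order

/-- Homomorphisms are monotone. -/
lemma Hom.mono {A B : InternalLattice E} (h : Hom A B) {I : E} {a b : I ⟶ A.obj}
    (k : A.le a b) : B.le (a ≫ h.map) (b ≫ h.map) := by
  unfold le at *; rw [← h.inf_map, k]

end InternalLattice

/-- A localic space in `E`, given by its internal frame of opens. -/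
structure LocalicSpace (E : Type u) [Category.{v} E] where
  opens : InternalLattice E
  isFrame : opens.IsFrame

/-- A map of localic spaces `X ⟶ Y` is an internal frame homomorphism `inv` from the opens of `Y`
to those of `X`. -/
@[ext]
structure LocalicSpace.Map (X Y : LocalicSpace E) where
  inv : InternalLattice.Hom Y.opens X.opens
  map_join : ∀ {I J : E} (f : J ⟶ I) (a : J ⟶ Y.opens.obj) (s : I ⟶ Y.opens.obj),
    Y.opens.IsJoin f a s → X.opens.IsJoin f (a ≫ inv.map) (s ≫ inv.map)

instance : Category (LocalicSpace E) where
  Hom X Y := LocalicSpace.Map X Y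
  id X :=
    { inv := ⟨𝟙 _, by simp, by simp, by simp, by simp⟩
      map_join := by intro I J f a s h; simpa using h }
  comp {X Y Z} f g :=
    { inv := ⟨g.inv.map ≫ f.inv.map,
        by intro I; rw [← Category.assoc, g.inv.top_map, f.inv.top_map],
        by intro I; rw [← Category.assoc, g.inv.bot_map, f.inv.bot_map],
        by intro I a b
           rw [← Category.assoc, g.inv.inf_map, f.inv.inf_map, Category.assoc, Category.assoc],
        by intro I a b
           rw [← Category.assoc, g.inv.sup_map, f.inv.sup_map, Category.assoc, Category.assoc]⟩
      map_join := by
        intro I J k a s h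
        simpa using f.map_join k _ _ (g.map_join k _ _ h) }
  id_comp f := by
    apply LocalicSpace.Map.ext; apply InternalLattice.Hom.ext; exact Category.comp_id _
  comp_id f := by
    apply LocalicSpace.Map.ext; apply InternalLattice.Hom.ext; exact Category.id_comp _
  assoc f g h := by
    apply LocalicSpace.Map.ext; apply InternalLattice.Hom.ext; exact (Category.assoc _ _ _).symm

/-- `S` is the spectrum of `A`, the space of prime filters of `A`: its points at each stage `W`
(the maps `W ⟶ S`) are the prime filters of `A` over `W`, that is, the lattice homomorphisms from
`A` to the opens of `W`, naturally in `W`. -/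
def IsSpec (A : InternalLattice E) (S : LocalicSpace E) : Prop :=
  ∃ η : InternalLattice.Hom A S.opens, ∀ (W : LocalicSpace E) (h : InternalLattice.Hom A W.opens),
    ∃! g : W ⟶ S, η.map ≫ g.inv.map = h.map

end Lattices

section Exponentials

variable {C : Type u} [Category.{v} C]

/-- A map `W × X ⟶ Y`, given by its action on generalized points. -/
@[ext]
structure TwoVarMap (W X Y : C) where
  app : ∀ ⦃T : C⦄, (T ⟶ W) → (T ⟶ X) → (T ⟶ Y)
  natural : ∀ ⦃T T' : C⦄ (t : T' ⟶ T) (w : T ⟶ W) (x : T ⟶ X),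
    app (t ≫ w) (t ≫ x) = t ≫ app w x

/-- For any product cone on `W` and `X`, the maps `W × X ⟶ Y` in the sense of `TwoVarMap` are the
morphisms from the vertex of the cone. -/
def TwoVarMap.equivOfIsLimit {W X : C} (c : BinaryFan W X) (hc : IsLimit c) (Y : C) :
    TwoVarMap W X Y ≃ (c.pt ⟶ Y) where
  toFun g := g.app c.fst c.snd
  invFun k :=
    { app := fun _ w x => hc.lift (BinaryFan.mk w x) ≫ k
      natural := by
        intro T T' t w x
        rw [← Category.assoc]
        congr 1
        apply BinaryFan.IsLimit.hom_ext hc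
        · rw [Category.assoc]; erw [hc.fac, hc.fac]; rfl
        · rw [Category.assoc]; erw [hc.fac, hc.fac]; rfl }
  left_inv g := by
    ext T w x
    change hc.lift (BinaryFan.mk w x) ≫ g.app c.fst c.snd = g.app w x
    refine (g.natural (hc.lift (BinaryFan.mk w x)) c.fst c.snd).symm.trans ?_
    congr 1
    · exact hc.fac _ ⟨WalkingPair.left⟩
    · exact hc.fac _ ⟨WalkingPair.right⟩
  right_inv k := by
    have : hc.lift (BinaryFan.mk c.fst c.snd) = 𝟙 _ := by
      apply BinaryFan.IsLimit.hom_ext hc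
      · erw [hc.fac, Category.id_comp]; rfl
      · erw [hc.fac, Category.id_comp]; rfl
    change hc.lift (BinaryFan.mk c.fst c.snd) ≫ k = k
    rw [this, Category.id_comp]

/-- `Z` is the exponential `Y ^ X`: there is an evaluation map `Z × X ⟶ Y` through which every
map `W × X ⟶ Y` factors, by a unique `W ⟶ Z`. -/
def IsExponential (X Y Z : C) : Prop :=
  ∃ ev : TwoVarMap Z X Y, ∀ (W : C) (g : TwoVarMap W X Y),
    ∃! h : W ⟶ Z, ∀ ⦃T : C⦄ (w : T ⟶ W) (x : T ⟶ X), g.app w x = ev.app (w ≫ h) x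

end Exponentials

section Spaces

variable {E : Type u} [Category.{v} E]

/-- A subspace of `L`: a map into `L` whose inverse image homomorphism is internally surjective. -/
structure Subspace (L : LocalicSpace E) where
  space : LocalicSpace E
  incl : space ⟶ L
  epi : Epi incl.inv.map

/-- Subspaces are ordered by factorization of their inclusions. -/
instance (L : LocalicSpace E) : Preorder (Subspace L) where
  le S T := ∃ k : S.space ⟶ T.space, k ≫ T.incl = S.incl
  le_refl S := ⟨𝟙 _, Category.id_comp _⟩
  le_trans S T U := by
    rintro ⟨k, hk⟩ ⟨l, hl⟩
    exact ⟨k ≫ l, by rw [Category.assoc, hl, hk]⟩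

/-- The whole space as a subspace. -/
def Subspace.whole (L : LocalicSpace E) : Subspace L := ⟨L, 𝟙 L, inferInstanceAs (Epi (𝟙 L.opens.obj))⟩

end Spaces


section Retracts

variable {E : Type u} [Category.{v} E]

namespace InternalLattice

/-- The lattice structure on a retract `Q` of `A` that is the fixed part of an idempotent
endomorphism `r ≫ ι` of `A` which preserves binary meets and joins. -/
def retract (A : InternalLattice E) {Q : E} (ι : Q ⟶ A.obj) (r : A.obj ⟶ Q) (hr : ι ≫ r = 𝟙 Q)
    (hinf : ∀ {I : E} (a b : I ⟶ A.obj),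
      A.inf a b ≫ r ≫ ι = A.inf (a ≫ r ≫ ι) (b ≫ r ≫ ι))
    (hsup : ∀ {I : E} (a b : I ⟶ A.obj),
      A.sup a b ≫ r ≫ ι = A.sup (a ≫ r ≫ ι) (b ≫ r ≫ ι)) : InternalLattice E :=
  have hid : ∀ {I : E} (q : I ⟶ Q), q ≫ ι ≫ r = q := fun q => by rw [hr, Category.comp_id]
  have hi : ∀ {I : E} (a b : I ⟶ Q), A.inf (a ≫ ι) (b ≫ ι) ≫ r ≫ ι = A.inf (a ≫ ι) (b ≫ ι) :=
    fun a b => by rw [hinf]; simp only [Category.assoc, reassoc_of% hr]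
  have hs : ∀ {I : E} (a b : I ⟶ Q), A.sup (a ≫ ι) (b ≫ ι) ≫ r ≫ ι = A.sup (a ≫ ι) (b ≫ ι) :=
    fun a b => by rw [hsup]; simp only [Category.assoc, reassoc_of% hr]
  { obj := Q
    top := fun I => A.top I ≫ r
    bot := fun I => A.bot I ≫ r
    inf := fun a b => A.inf (a ≫ ι) (b ≫ ι) ≫ r
    sup := fun a b => A.sup (a ≫ ι) (b ≫ ι) ≫ r
    comp_top := fun u => by rw [← Category.assoc, A.comp_top]
    comp_bot := fun u => by rw [← Category.assoc, A.comp_bot]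
    comp_inf := fun u a b => by rw [← Category.assoc, A.comp_inf, Category.assoc, Category.assoc]
    comp_sup := fun u a b => by rw [← Category.assoc, A.comp_sup, Category.assoc, Category.assoc]
    inf_comm := fun a b => by rw [A.inf_comm]
    sup_comm := fun a b => by rw [A.sup_comm]
    inf_assoc := fun a b c => by simp only [Category.assoc, hi, A.inf_assoc]
    sup_assoc := fun a b c => by simp only [Category.assoc, hs, A.sup_assoc]
    inf_sup_self := fun a b => by
      simp only [Category.assoc, hs, A.inf_sup_self, hid]
    sup_inf_self := fun a b => by
      simp only [Category.assoc, hi, A.sup_inf_self, hid]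
    inf_sup_left := fun a b c => by
      simp only [Category.assoc, hs, hi, A.inf_sup_left]
    inf_top := fun {I} a => by
      have h : A.inf (a ≫ ι) (A.top I ≫ r ≫ ι) = A.inf (a ≫ ι) (A.top I) ≫ r ≫ ι := by
        rw [hinf]; simp only [Category.assoc, reassoc_of% hr]
      simp only [Category.assoc]
      rw [h, A.inf_top]
      simp only [Category.assoc, hid]
    sup_bot := fun {I} a => by
      have h : A.sup (a ≫ ι) (A.bot I ≫ r ≫ ι) = A.sup (a ≫ ι) (A.bot I) ≫ r ≫ ι := by
        rw [hsup]; simp only [Category.assoc, reassoc_of% hr]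
      simp only [Category.assoc]
      rw [h, A.sup_bot]
      simp only [Category.assoc, hid] }

section

variable {A : InternalLattice E} {Q : E} {ι : Q ⟶ A.obj} {r : A.obj ⟶ Q} {hr : ι ≫ r = 𝟙 Q}
    {hinf : ∀ {I : E} (a b : I ⟶ A.obj),
      A.inf a b ≫ r ≫ ι = A.inf (a ≫ r ≫ ι) (b ≫ r ≫ ι)}
    {hsup : ∀ {I : E} (a b : I ⟶ A.obj),
      A.sup a b ≫ r ≫ ι = A.sup (a ≫ r ≫ ι) (b ≫ r ≫ ι)}

lemma retract_le_iff {I : E} (a b : I ⟶ Q) :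
    (A.retract ι r hr hinf hsup).le a b ↔ A.le (a ≫ ι) (b ≫ ι) := by
  have hi : A.inf (a ≫ ι) (b ≫ ι) ≫ r ≫ ι = A.inf (a ≫ ι) (b ≫ ι) := by
    rw [hinf]; simp only [Category.assoc, reassoc_of% hr]
  change A.inf (a ≫ ι) (b ≫ ι) ≫ r = a ↔ A.inf (a ≫ ι) (b ≫ ι) = a ≫ ι
  constructor
  · intro h
    rw [← hi, ← Category.assoc, h]
  · intro h
    rw [h, Category.assoc, hr, Category.comp_id]

/-- The retraction is a lattice homomorphism. -/
def retractHom (A : InternalLattice E) {Q : E} (ι : Q ⟶ A.obj) (r : A.obj ⟶ Q) (hr : ι ≫ r = 𝟙 Q)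
    (hinf : ∀ {I : E} (a b : I ⟶ A.obj),
      A.inf a b ≫ r ≫ ι = A.inf (a ≫ r ≫ ι) (b ≫ r ≫ ι))
    (hsup : ∀ {I : E} (a b : I ⟶ A.obj),
      A.sup a b ≫ r ≫ ι = A.sup (a ≫ r ≫ ι) (b ≫ r ≫ ι)) :
    Hom A (A.retract ι r hr hinf hsup) where
  map := r
  top_map _ := rfl
  bot_map _ := rfl
  inf_map a b := by
    change A.inf a b ≫ r = A.inf ((a ≫ r) ≫ ι) ((b ≫ r) ≫ ι) ≫ r
    rw [Category.assoc, Category.assoc, ← hinf]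
    simp only [Category.assoc, hr, Category.comp_id]
  sup_map a b := by
    change A.sup a b ≫ r = A.sup ((a ≫ r) ≫ ι) ((b ≫ r) ≫ ι) ≫ r
    rw [Category.assoc, Category.assoc, ← hsup]
    simp only [Category.assoc, hr, Category.comp_id]

lemma IsJoin.congr {I J : E} {f : J ⟶ I} {a a' : J ⟶ A.obj} {s s' : I ⟶ A.obj}
    (h : A.IsJoin f a s) (ha : a = a') (hs : s = s') : A.IsJoin f a' s' := by
  subst ha hs; exact h

lemma IsJoin.unique {I J : E} {f : J ⟶ I} {a : J ⟶ A.obj} {s t : I ⟶ A.obj}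
    (hs : A.IsJoin f a s) (ht : A.IsJoin f a t) : s = t := by
  have key : ∀ {s t : I ⟶ A.obj}, A.IsJoin f a s → A.IsJoin f a t → A.le s t := by
    intro s t hs ht
    have h := (hs (𝟙 I) t).2 fun T p q hpq => by
      have := (ht (𝟙 I) t).1 (by simpa using A.le_refl t) p q hpq
      exact this
    simpa using h
  exact (key hs ht).antisymm (key ht hs)

/-- The condition for the retraction `r` to preserve joins. -/
def PreservesJoins (A : InternalLattice E) {Q : E} (ι : Q ⟶ A.obj) (r : A.obj ⟶ Q) : Prop :=
  ∀ ⦃I J : E⦄ (f : J ⟶ I) (a : J ⟶ A.obj) (s : I ⟶ A.obj), A.IsJoin f a s →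
    ∀ ⦃K : E⦄ (u : K ⟶ I) (b : K ⟶ Q), A.le (u ≫ s ≫ r ≫ ι) (b ≫ ι) ↔
      ∀ ⦃T : E⦄ (p : T ⟶ K) (q : T ⟶ J), p ≫ u = q ≫ f → A.le (q ≫ a ≫ r ≫ ι) (p ≫ b ≫ ι)

lemma retract_isJoin (hj : A.PreservesJoins ι r) {I J : E} (f : J ⟶ I) (a : J ⟶ A.obj)
    (s : I ⟶ A.obj) (h : A.IsJoin f a s) :
    (A.retract ι r hr hinf hsup).IsJoin f (a ≫ r) (s ≫ r) := by
  intro K u b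
  refine (retract_le_iff (u ≫ s ≫ r) b).trans ?_
  have h1 := hj f a s h u b
  simp only [Category.assoc]
  rw [h1]
  refine forall_congr' fun T => forall_congr' fun p => forall_congr' fun q =>
    imp_congr_right fun _ => ?_
  have h2 := retract_le_iff (hr := hr) (hinf := hinf) (hsup := hsup) (q ≫ a ≫ r)
    (p ≫ (show K ⟶ Q from b))
  have e : (p ≫ (show K ⟶ Q from b)) ≫ ι = p ≫ b ≫ ι := Category.assoc _ _ _
  rw [e, Category.assoc, Category.assoc] at h2
  exact h2.symm

lemma retract_exists_join (hA : A.IsFrame) (hj : A.PreservesJoins ι r) {I J : E} (f : J ⟶ I)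
    (a : J ⟶ Q) : ∃ s : I ⟶ A.obj, A.IsJoin f (a ≫ ι) s ∧
      (A.retract ι r hr hinf hsup).IsJoin f a (s ≫ r) := by
  obtain ⟨s, hs⟩ := hA.exists_join f (a ≫ ι)
  refine ⟨s, hs, ?_⟩
  have h := retract_isJoin (hr := hr) (hinf := hinf) (hsup := hsup) hj f _ s hs
  have e : (a ≫ ι) ≫ r = a := by rw [Category.assoc, hr, Category.comp_id]
  exact h.congr e rfl

/-- A retract of a frame whose retraction preserves joins is a frame. -/
lemma retract_isFrame (hA : A.IsFrame) (hj : A.PreservesJoins ι r) :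
    (A.retract ι r hr hinf hsup).IsFrame where
  exists_join f a := by
    obtain ⟨s, -, hs⟩ := retract_exists_join (hr := hr) (hinf := hinf) (hsup := hsup) hA hj f a
    exact ⟨_, hs⟩
  inf_join {I J} f a s c h := by
    obtain ⟨s', h0, h1⟩ := retract_exists_join (hr := hr) (hinf := hinf) (hsup := hsup) hA hj f a
    have h2 : s = s' ≫ r := h.unique h1
    have key : ∀ (a : J ⟶ Q) (c : I ⟶ Q), A.IsJoin f (a ≫ ι) s' →
        (A.retract ι r hr hinf hsup).IsJoin f (A.inf ((f ≫ c) ≫ ι) (a ≫ ι) ≫ r)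
          (A.inf (c ≫ ι) ((s' ≫ r) ≫ ι) ≫ r) := by
      intro a c h0
      have h3 := retract_isJoin (hr := hr) (hinf := hinf) (hsup := hsup) hj f _ _
        (hA.inf_join f _ s' (c ≫ ι) h0)
      have h4 : A.inf (c ≫ ι) s' ≫ r = A.inf (c ≫ ι) ((s' ≫ r) ≫ ι) ≫ r := by
        have e : A.inf (c ≫ ι) s' ≫ r = (A.inf (c ≫ ι) s' ≫ r ≫ ι) ≫ r := by
          simp only [Category.assoc, hr, Category.comp_id]
        rw [e, hinf]
        simp only [Category.assoc, reassoc_of% hr]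
      exact h3.congr (by rw [Category.assoc]) h4
    rw [h2]
    exact key a c h0

end

end InternalLattice

/-- The localic space whose frame is a retract of the frame of `L`, as a subspace of `L`. -/
def Subspace.ofRetract (L : LocalicSpace E) {Q : E} (ι : Q ⟶ L.opens.obj) (r : L.opens.obj ⟶ Q)
    (hr : ι ≫ r = 𝟙 Q)
    (hinf : ∀ {I : E} (a b : I ⟶ L.opens.obj),
      L.opens.inf a b ≫ r ≫ ι = L.opens.inf (a ≫ r ≫ ι) (b ≫ r ≫ ι))
    (hsup : ∀ {I : E} (a b : I ⟶ L.opens.obj),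
      L.opens.sup a b ≫ r ≫ ι = L.opens.sup (a ≫ r ≫ ι) (b ≫ r ≫ ι))
    (hj : L.opens.PreservesJoins ι r) : Subspace L where
  space := ⟨L.opens.retract ι r hr hinf hsup, InternalLattice.retract_isFrame L.isFrame hj⟩
  incl := ⟨InternalLattice.retractHom L.opens ι r hr hinf hsup, fun f a s h =>
    InternalLattice.retract_isJoin (hr := hr) (hinf := hinf) (hsup := hsup) hj f a s h⟩
  epi := by
    have key : Epi r := ⟨fun {Z} g h hgh => by
      rw [← Category.id_comp g, ← Category.id_comp h, ← hr, Category.assoc, Category.assoc, hgh]⟩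
    exact key

end Retracts



section Topos

variable {E : Type u} [Category.{v} E] [CartesianMonoidalCategory E]

/-- The empty space: its frame of opens is the one-element frame. -/
def emptySpace (E : Type u) [Category.{v} E] [CartesianMonoidalCategory E] : LocalicSpace E where
  opens :=
    { obj := 𝟙_ E
      top := fun I => toUnit I
      bot := fun I => toUnit I
      inf := fun {I} _ _ => toUnit I
      sup := fun {I} _ _ => toUnit I
      comp_top := fun _ => toUnit_unique _ _
      comp_bot := fun _ => toUnit_unique _ _
      comp_inf := fun _ _ _ => toUnit_unique _ _
      comp_sup := fun _ _ _ => toUnit_unique _ _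
      inf_comm := fun _ _ => toUnit_unique _ _
      sup_comm := fun _ _ => toUnit_unique _ _
      inf_assoc := fun _ _ _ => toUnit_unique _ _
      sup_assoc := fun _ _ _ => toUnit_unique _ _
      inf_sup_self := fun _ _ => toUnit_unique _ _
      sup_inf_self := fun _ _ => toUnit_unique _ _
      inf_sup_left := fun _ _ _ => toUnit_unique _ _
      inf_top := fun _ => toUnit_unique _ _
      sup_bot := fun _ => toUnit_unique _ _ }
  isFrame :=
    { exists_join := fun {I _} _ _ => ⟨toUnit I, fun _ _ _ =>
        ⟨fun _ _ _ _ _ => toUnit_unique _ _, fun _ => toUnit_unique _ _⟩⟩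
      inf_join := fun _ _ _ _ _ _ _ _ =>
        ⟨fun _ _ _ _ _ => toUnit_unique _ _, fun _ => toUnit_unique _ _⟩ }

/-- The empty space is initial among the spaces. -/
def emptySpaceIsInitial : IsInitial (emptySpace E) :=
  IsInitial.ofUniqueHom
    (fun X =>
      { inv := ⟨toUnit _, fun _ => toUnit_unique _ _, fun _ => toUnit_unique _ _,
          fun _ _ => toUnit_unique _ _, fun _ _ => toUnit_unique _ _⟩
        map_join := fun _ _ _ _ _ _ _ =>
          ⟨fun _ _ _ _ _ => toUnit_unique _ _, fun _ => toUnit_unique _ _⟩ })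
    (fun X f => by
      apply LocalicSpace.Map.ext; apply InternalLattice.Hom.ext; exact toUnit_unique _ _)


/-- The empty subspace. -/
def Subspace.empty (L : LocalicSpace E) : Subspace L where
  space := emptySpace E
  incl := emptySpaceIsInitial.to L
  epi := by
    have key : ∀ m : L.opens.obj ⟶ 𝟙_ E, Epi m := fun m => ⟨fun {Z} g h hgh => by
      have e : L.opens.top (𝟙_ E) ≫ m = 𝟙 (𝟙_ E) := toUnit_unique _ _
      rw [← Category.id_comp g, ← Category.id_comp h, ← e, Category.assoc, Category.assoc, hgh]⟩
    exact key _

/-- A global element, as a constant generalized element at stage `I`. -/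
abbrev constAt {A : E} (U : 𝟙_ E ⟶ A) (I : E) : I ⟶ A := toUnit I ≫ U

lemma comp_constAt {A I J : E} (U : 𝟙_ E ⟶ A) (u : J ⟶ I) : u ≫ constAt U I = constAt U J := by
  simp [constAt]

section OpenClosed

variable (L : LocalicSpace E) (U : 𝟙_ E ⟶ L.opens.obj)

open InternalLattice

lemma comp_supU {I : E} (a : I ⟶ L.opens.obj) :
    a ≫ L.opens.sup (𝟙 _) (constAt U _) = L.opens.sup a (constAt U I) := by
  rw [L.opens.comp_sup, Category.comp_id, comp_constAt]

lemma comp_infU {I : E} (a : I ⟶ L.opens.obj) :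
    a ≫ L.opens.inf (𝟙 _) (constAt U _) = L.opens.inf a (constAt U I) := by
  rw [L.opens.comp_inf, Category.comp_id, comp_constAt]

variable [HasEqualizers E]

/-- The closed complement of the open `U` of `L`: its opens are the opens `a` of `L` with
`a ⊔ U = a`, and the inverse image along the inclusion is `a ↦ a ⊔ U`. -/
noncomputable def closedSubspace : Subspace L :=
  Subspace.ofRetract L
    (equalizer.ι (L.opens.sup (𝟙 _) (constAt U _)) (𝟙 _))
    (equalizer.lift (L.opens.sup (𝟙 _) (constAt U _)) (by
      rw [comp_supU, Category.comp_id]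
      exact sup_eq_iff_le.2 ((join_le_iff.1 (L.opens.le_refl _)).2)))
    (by
      refine equalizer.hom_ext ((Category.assoc _ _ _).trans ?_)
      rw [equalizer.lift_ι, Category.id_comp, equalizer.condition, Category.comp_id])
    (by
      intro I a b
      simp only [equalizer.lift_ι, comp_supU]
      exact L.opens.sup_inf_distrib _ _ _)
    (by
      intro I a b
      simp only [equalizer.lift_ι, comp_supU]
      exact L.opens.sup_sup_distrib _ _ _)
    (by
      intro I J f a s h K u b
      have hb : L.opens.le (constAt U K) (b ≫ equalizer.ι _ _) := by
        rw [← sup_eq_iff_le, ← comp_supU, Category.assoc, equalizer.condition, Category.comp_id]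
      have red : ∀ {T : E} (x : T ⟶ L.opens.obj) (p : T ⟶ K),
          L.opens.le (L.opens.sup x (constAt U T)) (p ≫ b ≫ equalizer.ι _ _) ↔
            L.opens.le x (p ≫ b ≫ equalizer.ι _ _) := by
        intro T x p
        have h1 := hb.comp p
        rw [comp_constAt] at h1
        rw [join_le_iff]
        exact ⟨fun h => h.1, fun h => ⟨h, h1⟩⟩
      have red1 := red (u ≫ s) (𝟙 K)
      simp only [Category.id_comp] at red1
      simp only [equalizer.lift_ι]
      rw [← Category.assoc u s, comp_supU, red1, h u]
      refine forall_congr' fun T => forall_congr' fun p => forall_congr' fun q =>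
        imp_congr_right fun _ => ?_
      rw [← Category.assoc q a, comp_supU, red])

/-- The open subspace of `L` given by `U`: its opens are the opens `a` of `L` with
`a ⊓ U = a`, and the inverse image along the inclusion is `a ↦ a ⊓ U`. -/
noncomputable def openSubspace : Subspace L :=
  Subspace.ofRetract L
    (equalizer.ι (L.opens.inf (𝟙 _) (constAt U _)) (𝟙 _))
    (equalizer.lift (L.opens.inf (𝟙 _) (constAt U _)) (by
      rw [comp_infU, Category.comp_id]
      exact show L.opens.le _ _ from (le_meet_iff.1 (L.opens.le_refl _)).2))
    (by
      refine equalizer.hom_ext ((Category.assoc _ _ _).trans ?_)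
      rw [equalizer.lift_ι, Category.id_comp, equalizer.condition, Category.comp_id])
    (by
      intro I a b
      simp only [equalizer.lift_ι, comp_infU]
      exact L.opens.inf_inf_distrib _ _ _)
    (by
      intro I a b
      simp only [equalizer.lift_ι, comp_infU]
      exact L.opens.inf_sup_distrib _ _ _)
    (by
      intro I J f a s h K u b
      have h' := L.isFrame.inf_join f a s (constAt U I) h
      simp only [equalizer.lift_ι]
      have e : u ≫ s ≫ L.opens.inf (𝟙 _) (constAt U _) = u ≫ L.opens.inf (constAt U I) s := by
        rw [comp_infU, L.opens.inf_comm]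
      rw [e, h' u]
      refine forall_congr' fun T => forall_congr' fun p => forall_congr' fun q =>
        imp_congr_right fun _ => ?_
      rw [comp_infU, L.opens.inf_comm, comp_constAt])

end OpenClosed


section TruthValues

open HasSubobjectClassifier MonoidalClosed

variable [HasSubobjectClassifier E]

/-- The constant truth value "true" at stage `I`. -/
noncomputable def tr (I : E) : I ⟶ Ω E := Subobject.Classifier.χ₀ _ I ≫ truth E

lemma comp_tr {I J : E} (u : J ⟶ I) : u ≫ tr I = tr J := by
  unfold tr
  rw [← Category.assoc]
  congr 1
  exact Subsingleton.elim _ _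

variable [HasFiniteLimits E]

/-- The truth value of `a = b`. -/
noncomputable def eqv {I X : E} (a b : I ⟶ X) : I ⟶ Ω E := χ (equalizer.ι a b)

lemma comp_χ_eq_tr {I J K : E} (m : J ⟶ I) [Mono m] (v : K ⟶ I) :
    v ≫ χ m = tr K ↔ ∃ w : K ⟶ J, w ≫ m = v := by
  constructor
  · intro h
    exact ⟨(isPullback_χ m).lift v (Subobject.Classifier.χ₀ _ K) h, (isPullback_χ m).lift_fst _ _ _⟩
  · rintro ⟨w, rfl⟩
    rw [Category.assoc, comm m, ← Category.assoc]
    unfold tr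
    congr 1
    exact Subsingleton.elim _ _

lemma comp_eqv {I X K : E} (a b : I ⟶ X) (v : K ⟶ I) :
    v ≫ eqv a b = tr K ↔ v ≫ a = v ≫ b := by
  unfold eqv
  rw [comp_χ_eq_tr]
  constructor
  · rintro ⟨w, rfl⟩
    rw [Category.assoc, Category.assoc, equalizer.condition]
  · intro h
    exact ⟨equalizer.lift v h, equalizer.lift_ι _ _⟩

lemma truth_ext {I : E} {s t : I ⟶ Ω E}
    (h : ∀ ⦃K : E⦄ (v : K ⟶ I), v ≫ s = tr K ↔ v ≫ t = tr K) : s = t := by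
  obtain ⟨Z, i, hi, rfl⟩ := Subobject.Classifier.surjective_χ _ s
  obtain ⟨Z', j, hj, rfl⟩ := Subobject.Classifier.surjective_χ _ t
  change χ i = χ j
  have h1 : ∃ w, w ≫ j = i := (comp_χ_eq_tr j i).1 ((h i).1 ((comp_χ_eq_tr i i).2 ⟨𝟙 _, by simp⟩))
  have h2 : ∃ w, w ≫ i = j := (comp_χ_eq_tr i j).1 ((h j).2 ((comp_χ_eq_tr j j).2 ⟨𝟙 _, by simp⟩))
  obtain ⟨w, hw⟩ := h1
  obtain ⟨w', hw'⟩ := h2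
  have e1 : w ≫ w' = 𝟙 _ := by rw [← cancel_mono i, Category.assoc, hw', hw, Category.id_comp]
  have e2 : w' ≫ w = 𝟙 _ := by rw [← cancel_mono j, Category.assoc, hw, hw', Category.id_comp]
  symm
  refine HasSubobjectClassifier.unique i (χ j) ?_
  refine (isPullback_χ j).of_iso ⟨w', w, e2, e1⟩ (Iso.refl _) (Iso.refl _) (Iso.refl _) ?_ ?_ ?_ ?_
  · simp [hw']
  · exact Subsingleton.elim _ _
  · simp
  · simp

/-- The logical connectives on truth values, in the standard encoding by equality. -/
noncomputable def tAnd {I : E} (s t : I ⟶ Ω E) : I ⟶ Ω E := eqv (lift s t) (lift (tr I) (tr I))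

noncomputable def tImp {I : E} (s t : I ⟶ Ω E) : I ⟶ Ω E := eqv (tAnd s t) s

/-- `tAll t` is the truth value of `∀ x : X, t (x, i)`. -/
noncomputable def tAll [MonoidalClosed E] {X I : E} (t : X ⊗ I ⟶ Ω E) : I ⟶ Ω E :=
  eqv (curry t) (curry (tr _))

lemma comp_tAnd {I K : E} (s t : I ⟶ Ω E) (v : K ⟶ I) :
    v ≫ tAnd s t = tr K ↔ v ≫ s = tr K ∧ v ≫ t = tr K := by
  unfold tAnd
  rw [comp_eqv, comp_lift, comp_lift, comp_tr]
  constructor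
  · intro h
    have h1 := congrArg (fun z => z ≫ fst _ _) h
    have h2 := congrArg (fun z => z ≫ snd _ _) h
    simp only [lift_fst] at h1
    simp only [lift_snd] at h2
    exact ⟨h1, h2⟩
  · rintro ⟨h1, h2⟩
    rw [h1, h2]

lemma comp_tImp {I K : E} (s t : I ⟶ Ω E) (v : K ⟶ I) :
    v ≫ tImp s t = tr K ↔
      ∀ ⦃T : E⦄ (w : T ⟶ K), w ≫ v ≫ s = tr T → w ≫ v ≫ t = tr T := by
  unfold tImp
  rw [comp_eqv]
  constructor
  · intro h T w hs
    have h1 : (w ≫ v) ≫ tAnd s t = tr T := by rw [Category.assoc, h, hs]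
    have h2 := ((comp_tAnd s t (w ≫ v)).1 h1).2
    rwa [Category.assoc] at h2
  · intro h
    apply truth_ext
    intro T w
    rw [← Category.assoc, comp_tAnd, Category.assoc, Category.assoc]
    exact ⟨fun k => k.1, fun k => ⟨k, h w k⟩⟩

/-- The order on truth values. -/
def tLe {I : E} (s t : I ⟶ Ω E) : Prop := ∀ ⦃K : E⦄ (v : K ⟶ I), v ≫ s = tr K → v ≫ t = tr K

lemma tAnd_le_iff {I : E} (s t c : I ⟶ Ω E) : tLe (tAnd s t) c ↔ tLe s (tImp t c) := by
  constructor
  · intro h K v hv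
    rw [comp_tImp]
    intro T w hw
    rw [← Category.assoc]
    apply h
    rw [comp_tAnd, Category.assoc, hv, comp_tr]
    exact ⟨rfl, by rw [Category.assoc, hw]⟩
  · intro h K v hv
    rw [comp_tAnd] at hv
    have := (comp_tImp _ _ _).1 (h v hv.1) (𝟙 K) (by rw [Category.id_comp]; exact hv.2)
    rwa [Category.id_comp] at this

lemma comp_tAnd' {I J : E} (u : J ⟶ I) (s t : I ⟶ Ω E) :
    u ≫ tAnd s t = tAnd (u ≫ s) (u ≫ t) := by
  apply truth_ext
  intro K v
  rw [← Category.assoc, comp_tAnd, comp_tAnd, Category.assoc, Category.assoc]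

lemma comp_tImp' {I J : E} (u : J ⟶ I) (s t : I ⟶ Ω E) :
    u ≫ tImp s t = tImp (u ≫ s) (u ≫ t) := by
  apply truth_ext
  intro K v
  rw [← Category.assoc, comp_tImp, comp_tImp]
  simp only [Category.assoc]

variable [MonoidalClosed E]

lemma comp_tAll {X I K : E} (t : X ⊗ I ⟶ Ω E) (v : K ⟶ I) :
    v ≫ tAll t = tr K ↔ ∀ ⦃T : E⦄ (w : T ⟶ K) (x : T ⟶ X), lift x (w ≫ v) ≫ t = tr T := by
  unfold tAll
  rw [comp_eqv, ← curry_natural_left, ← curry_natural_left, curry_injective.eq_iff, comp_tr]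
  constructor
  · intro h T w x
    have e : lift x (w ≫ v) = lift x w ≫ X ◁ v := by simp
    rw [e, Category.assoc, h, comp_tr]
  · intro h
    apply truth_ext
    intro T z
    have e : z ≫ X ◁ v = lift (z ≫ fst _ _) ((z ≫ snd _ _) ≫ v) := by
      ext <;> simp
    rw [← Category.assoc, e, h, comp_tr]

/-- `tBot` is the truth value of `∀ ω, ω`. -/
noncomputable def tBot (I : E) : I ⟶ Ω E := tAll (fst (Ω E) I)

/-- `tOr s t` is the truth value of `∀ ω, ((s ⇒ ω) ∧ (t ⇒ ω)) ⇒ ω`. -/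
noncomputable def tOr {I : E} (s t : I ⟶ Ω E) : I ⟶ Ω E :=
  tAll (tImp (tAnd (tImp (snd (Ω E) I ≫ s) (fst _ _)) (tImp (snd (Ω E) I ≫ t) (fst _ _))) (fst _ _))

/-- `tEx f t` is the truth value, at `i : I`, of `∃ j : J, f j = i ∧ t j`, encoded as
`∀ ω, (∀ j, (f j = i ∧ t j) ⇒ ω) ⇒ ω`. -/
noncomputable def tEx {I J : E} (f : J ⟶ I) (t : J ⟶ Ω E) : I ⟶ Ω E :=
  tAll (tImp
    (tAll (X := J) (I := Ω E ⊗ I)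
      (tImp (tAnd (eqv (fst _ _ ≫ f) (snd _ _ ≫ snd _ _)) (fst _ _ ≫ t)) (snd _ _ ≫ fst _ _)))
    (fst (Ω E) I))

lemma tBot_le {I : E} (t : I ⟶ Ω E) : tLe (tBot I) t := by
  intro K v h
  have := (comp_tAll _ v).1 h (𝟙 K) (v ≫ t)
  simpa using this

lemma tOr_le_iff {I : E} (s t c : I ⟶ Ω E) : tLe (tOr s t) c ↔ tLe s c ∧ tLe t c := by
  constructor
  · intro h
    refine ⟨fun K v hv => h v ?_, fun K v hv => h v ?_⟩
    all_goals
      refine (comp_tAll _ v).2 fun T w x => (comp_tImp _ _ _).2 fun S y hy => ?_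
      rw [← Category.assoc, comp_tAnd] at hy
    · have := (comp_tImp _ _ _).1 hy.1 (𝟙 _) (by
        simp only [Category.assoc, lift_snd_assoc, hv, comp_tr])
      simpa using this
    · have := (comp_tImp _ _ _).1 hy.2 (𝟙 _) (by
        simp only [Category.assoc, lift_snd_assoc, hv, comp_tr])
      simpa using this
  · rintro ⟨hs, ht⟩ K v h
    have h1 := (comp_tAll _ v).1 h (𝟙 K) (v ≫ c)
    rw [comp_tImp] at h1
    have h2 := h1 (𝟙 K) (by
      rw [Category.id_comp, comp_tAnd, comp_tImp, comp_tImp]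
      refine ⟨fun T w hw => ?_, fun T w hw => ?_⟩
      · have := hs (w ≫ v) (by simpa using hw)
        simpa using this
      · have := ht (w ≫ v) (by simpa using hw)
        simpa using this)
    simpa using h2

lemma comp_tEx_le_iff {I J K : E} (f : J ⟶ I) (t : J ⟶ Ω E) (u : K ⟶ I) (b : K ⟶ Ω E) :
    tLe (u ≫ tEx f t) b ↔
      ∀ ⦃T : E⦄ (p : T ⟶ K) (q : T ⟶ J), p ≫ u = q ≫ f → q ≫ t = tr T → p ≫ b = tr T := by
  constructor
  · intro h T p q hpq hq
    apply h
    rw [← Category.assoc]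
    refine (comp_tAll _ _).2 fun S w x => (comp_tImp _ _ _).2 fun R y hy => ?_
    have h1 := (comp_tAll _ _).1 (by rw [← Category.assoc] at hy; exact hy) (𝟙 R) (y ≫ w ≫ q)
    have h2 := (comp_tImp _ _ _).1 h1 (𝟙 R) (by
      rw [Category.id_comp, comp_tAnd, comp_eqv]
      constructor
      · simp [hpq]
      · simp [hq, comp_tr])
    simpa using h2
  · intro h S v hv
    rw [← Category.assoc] at hv
    have h1 := (comp_tAll _ _).1 hv (𝟙 S) (v ≫ b)
    have h2 := (comp_tImp _ _ _).1 h1 (𝟙 S) (by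
      rw [Category.id_comp, comp_tAll]
      intro T w x
      rw [comp_tImp]
      intro R y hy
      rw [← Category.assoc, comp_tAnd, comp_eqv] at hy
      have := h (y ≫ w ≫ v) (y ≫ x) (by simpa using hy.1.symm) (by simpa using hy.2)
      simpa using this)
    simpa using h2


lemma comp_tBot {I J : E} (u : J ⟶ I) : u ≫ tBot I = tBot J := by
  apply truth_ext
  intro K v
  unfold tBot
  rw [← Category.assoc, comp_tAll, comp_tAll]
  simp only [lift_fst]

lemma comp_tOr {I J : E} (u : J ⟶ I) (s t : I ⟶ Ω E) :
    u ≫ tOr s t = tOr (u ≫ s) (u ≫ t) := by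
  apply truth_ext
  intro K v
  unfold tOr
  rw [← Category.assoc, comp_tAll, comp_tAll]
  refine forall_congr' fun T => forall_congr' fun w => forall_congr' fun x => ?_
  rw [comp_tImp, comp_tImp]
  refine forall_congr' fun S => forall_congr' fun y => ?_
  rw [← Category.assoc y, ← Category.assoc y, ← Category.assoc y, ← Category.assoc y, comp_tAnd,
    comp_tAnd, comp_tImp, comp_tImp, comp_tImp, comp_tImp]
  simp only [Category.assoc, lift_snd_assoc, lift_fst]

end TruthValues


section DiscreteSpaces

open HasSubobjectClassifier MonoidalClosed

variable [HasFiniteLimits E] [HasSubobjectClassifier E] [MonoidalClosed E]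

/-- The truth values at stage `I`, as an external lattice. -/
def TruthValue (I : E) : Type v := I ⟶ Ω E

noncomputable instance (I : E) : DistribLattice (TruthValue I) :=
  letI _L : Lattice (TruthValue I) :=
    { le := fun s t => tLe (E := E) (I := I) s t
      le_refl := fun _ _ _ h => h
      le_trans := fun _ _ _ h k _ v hv => k v (h v hv)
      le_antisymm := fun _ _ h k => truth_ext fun _ v => ⟨h v, k v⟩
      sup := fun s t => tOr (E := E) (I := I) s t
      inf := fun s t => tAnd (E := E) (I := I) s t
      le_sup_left := fun s t => ((tOr_le_iff (E := E) (I := I) s t _).1 fun _ _ h => h).1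
      le_sup_right := fun s t => ((tOr_le_iff (E := E) (I := I) s t _).1 fun _ _ h => h).2
      sup_le := fun s t c hs ht => (tOr_le_iff (E := E) (I := I) s t c).2 ⟨hs, ht⟩
      inf_le_left := fun s t _ v h => ((comp_tAnd (E := E) (I := I) s t v).1 h).1
      inf_le_right := fun s t _ v h => ((comp_tAnd (E := E) (I := I) s t v).1 h).2
      le_inf := fun c s t hs ht _ v h =>
        (comp_tAnd (E := E) (I := I) s t v).2 ⟨hs v h, ht v h⟩ }
  DistribLattice.ofInfSupLe fun a b c => by
    have h1 : tLe (E := E) (I := I) (tOr b c)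
        (tImp a (tOr (tAnd a b) (tAnd a c))) := by
      have h0 := (tOr_le_iff (tAnd (E := E) (I := I) a b) (tAnd (E := E) (I := I) a c) _).1
        fun _ _ h => h
      refine (tOr_le_iff _ _ _).2 ⟨(tAnd_le_iff _ _ _).1 ?_, (tAnd_le_iff _ _ _).1 ?_⟩
      · intro K v h
        exact h0.1 v ((comp_tAnd _ _ v).2 ((comp_tAnd _ _ v).1 h).symm)
      · intro K v h
        exact h0.2 v ((comp_tAnd _ _ v).2 ((comp_tAnd _ _ v).1 h).symm)
    intro K v h
    exact (tAnd_le_iff _ _ _).2 h1 v ((comp_tAnd _ _ v).2 ((comp_tAnd _ _ v).1 h).symm)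

/-- The internal lattice of subsets of `X`: the power object `Ω ^ X`, whose generalized elements
`I ⟶ Ω ^ X` are the truth-valued maps `X ⊗ I ⟶ Ω`, with the pointwise connectives. -/
noncomputable def powerLattice (X : E) : InternalLattice E where
  obj := (ihom X).obj (Ω E)
  top I := curry (tr (X ⊗ I))
  bot I := curry (tBot (X ⊗ I))
  inf a b := curry (tAnd (uncurry a) (uncurry b))
  sup a b := curry (tOr (uncurry a) (uncurry b))
  comp_top u := by rw [← curry_natural_left, comp_tr]
  comp_bot u := by rw [← curry_natural_left, comp_tBot]
  comp_inf u a b := by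
    rw [← curry_natural_left, comp_tAnd', uncurry_natural_left, uncurry_natural_left]
  comp_sup u a b := by
    rw [← curry_natural_left, comp_tOr, uncurry_natural_left, uncurry_natural_left]
  inf_comm {I} a b := congrArg curry (_root_.inf_comm (α := TruthValue (X ⊗ I)) _ _)
  sup_comm {I} a b := congrArg curry (_root_.sup_comm (α := TruthValue (X ⊗ I)) _ _)
  inf_assoc {I} a b c := by
    simp only [uncurry_curry]
    exact congrArg curry (_root_.inf_assoc (α := TruthValue (X ⊗ I)) _ _ _)
  sup_assoc {I} a b c := by
    simp only [uncurry_curry]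
    exact congrArg curry (_root_.sup_assoc (α := TruthValue (X ⊗ I)) _ _ _)
  inf_sup_self {I} a b := by
    rw [uncurry_curry, curry_eq_iff]
    exact _root_.inf_sup_self (α := TruthValue (X ⊗ I))
  sup_inf_self {I} a b := by
    rw [uncurry_curry, curry_eq_iff]
    exact _root_.sup_inf_self (α := TruthValue (X ⊗ I))
  inf_sup_left {I} a b c := by
    simp only [uncurry_curry]
    exact congrArg curry (_root_.inf_sup_left (α := TruthValue (X ⊗ I)) _ _ _)
  inf_top {I} a := by
    rw [uncurry_curry, curry_eq_iff]
    refine _root_.inf_eq_left (α := TruthValue (X ⊗ I)).2 fun K v _ => comp_tr v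
  sup_bot {I} a := by
    rw [uncurry_curry, curry_eq_iff]
    exact _root_.sup_eq_left (α := TruthValue (X ⊗ I)).2 (tBot_le _)

lemma powerLattice_le_iff (X : E) {I : E} (a b : I ⟶ (ihom X).obj (Ω E)) :
    (powerLattice X).le a b ↔ tLe (uncurry a) (uncurry b) := by
  change curry (tAnd (uncurry a) (uncurry b)) = a ↔ _
  rw [curry_eq_iff]
  exact _root_.inf_eq_left (α := TruthValue (X ⊗ I))

lemma powerLattice_join_aux (X : E) {I J K : E} (f : J ⟶ I) (a : J ⟶ (ihom X).obj (Ω E))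
    (u : K ⟶ I) (b : K ⟶ (ihom X).obj (Ω E)) :
    tLe (uncurry (u ≫ curry (tEx (X ◁ f) (uncurry a)))) (uncurry b) ↔
      ∀ ⦃T : E⦄ (p : T ⟶ K) (q : T ⟶ J), p ≫ u = q ≫ f →
        tLe (uncurry (q ≫ a)) (uncurry (p ≫ b)) := by
  rw [uncurry_natural_left, uncurry_curry, comp_tEx_le_iff]
  constructor
  · intro h T p q hpq S v hv
    rw [uncurry_natural_left] at hv ⊢
    rw [← Category.assoc] at hv ⊢
    refine h _ _ ?_ hv
    simp only [Category.assoc, ← MonoidalCategory.whiskerLeft_comp, hpq]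
  · intro h T p q hpq hq
    have e1 : p ≫ fst _ _ = q ≫ fst _ _ := by
      have := congrArg (fun z => z ≫ fst _ _) hpq
      simpa using this
    have e2 : (p ≫ snd _ _) ≫ u = (q ≫ snd _ _) ≫ f := by
      have := congrArg (fun z => z ≫ snd _ _) hpq
      simpa using this
    have h1 := h _ _ e2 (lift (p ≫ fst _ _) (𝟙 T))
    rw [uncurry_natural_left, uncurry_natural_left, ← Category.assoc, ← Category.assoc] at h1
    have e3 : lift (p ≫ fst _ _) (𝟙 T) ≫ X ◁ (q ≫ snd _ _) = q := by
      ext <;> simp [e1]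
    have e4 : lift (p ≫ fst _ _) (𝟙 T) ≫ X ◁ (p ≫ snd _ _) = p := by
      ext <;> simp
    rw [e3, e4] at h1
    exact h1 hq

lemma powerLattice_isJoin (X : E) {I J : E} (f : J ⟶ I) (a : J ⟶ (ihom X).obj (Ω E)) :
    (powerLattice X).IsJoin f a (curry (tEx (X ◁ f) (uncurry a))) := by
  intro K u b
  refine (powerLattice_le_iff X _ _).trans ((powerLattice_join_aux X f a u b).trans ?_)
  exact forall_congr' fun T => forall_congr' fun p => forall_congr' fun q =>
    imp_congr_right fun _ => (powerLattice_le_iff X _ _).symm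

lemma powerLattice_imp_aux (X : E) {K T : E} (y z : K ⟶ (ihom X).obj (Ω E)) (p : T ⟶ K)
    (x : T ⟶ (ihom X).obj (Ω E)) :
    tLe (uncurry x) (uncurry (p ≫ curry (tImp (uncurry y) (uncurry z)))) ↔
      tLe (uncurry (curry (tAnd (uncurry x) (uncurry (p ≫ y))))) (uncurry (p ≫ z)) := by
  rw [uncurry_natural_left, uncurry_curry, uncurry_curry, tAnd_le_iff, comp_tImp',
    uncurry_natural_left, uncurry_natural_left]

lemma powerLattice_isFrame (X : E) : (powerLattice X).IsFrame where
  exists_join f a := ⟨_, powerLattice_isJoin X f a⟩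
  inf_join := (powerLattice X).inf_join_of_imp fun y z =>
    ⟨curry (tImp (uncurry y) (uncurry z)), fun p x =>
      (powerLattice_le_iff X _ _).trans
        ((powerLattice_imp_aux X y z p x).trans (powerLattice_le_iff X _ _).symm)⟩

/-- The discrete space on an object `X` of the base: its opens are the subsets of `X`. -/
noncomputable def discrete (X : E) : LocalicSpace E := ⟨powerLattice X, powerLattice_isFrame X⟩

/-- The open of the discrete space `X` given by a subobject `m : P ⟶ X`. -/
noncomputable def openOf {P X : E} (m : P ⟶ X) [Mono m] : 𝟙_ E ⟶ (discrete X).opens.obj :=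
  curry (fst X (𝟙_ E) ≫ χ m)

/-- Images exist in an elementary topos. -/
instance hasImages : HasImages E where
  has_image {J I} f := by
    have h0 := fun b => (comp_tEx_le_iff f (tr J) (𝟙 I) b)
    simp only [Category.id_comp, Category.comp_id] at h0
    have hfac : f ≫ tEx f (tr J) = tr J := by
      refine (h0 _).1 (fun _ _ h => h) f (𝟙 J) (by simp) ?_
      rw [comp_tr]
    let m : equalizer (tEx f (tr J)) (tr I) ⟶ I := equalizer.ι _ _
    let F : MonoFactorisation f :=
      { I := equalizer (tEx f (tr J)) (tr I)
        m := m
        m_mono := inferInstance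
        e := equalizer.lift f (by rw [hfac, comp_tr])
        fac := equalizer.lift_ι _ _ }
    have hlift : ∀ F' : MonoFactorisation f, ∃ w : F.I ⟶ F'.I, w ≫ F'.m = F.m := by
      intro F'
      have := F'.m_mono
      rw [← comp_χ_eq_tr]
      refine (h0 (χ F'.m)).2 (fun T p q hpq _ => ?_) _ ?_
      · rw [hpq, comp_χ_eq_tr]
        exact ⟨q ≫ F'.e, by rw [Category.assoc, F'.fac]⟩
      · change equalizer.ι _ _ ≫ _ = _
        rw [equalizer.condition, comp_tr]
    exact HasImage.mk ⟨F, ⟨fun F' => (hlift F').choose, fun F' => (hlift F').choose_spec⟩⟩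

end DiscreteSpaces


section Statement

open HasSubobjectClassifier MonoidalClosed

variable [HasFiniteLimits E] [HasSubobjectClassifier E] [MonoidalClosed E]

/-- The empty space is the discrete space on an initial object of the base. -/
theorem discrete_initial {Z : E} (hZ : IsInitial Z) : Nonempty (discrete Z ≅ emptySpace E) := by
  have hom_eq : ∀ {I : E} (s t : I ⟶ (discrete Z).opens.obj), s = t := by
    intro I s t
    refine (uncurry_injective (A := Z) (X := Ω E)) (truth_ext fun K v => ?_)
    have e : v = (v ≫ fst Z I) ≫ hZ.to _ := by
      rw [Category.assoc]
      have h : ∀ (x : K ⟶ Z) {Y : E} (y y' : K ⟶ Y), y = y' := by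
        intro x Y y y'
        have h1 : ∀ w w' : K ⊗ Z ⟶ Y, w = w' := by
          have hi : IsInitial (K ⊗ Z) := hZ.ofIso (zeroMul hZ).symm
          exact fun w w' => hi.hom_ext w w'
        have h2 := congrArg (fun w => lift (𝟙 K) x ≫ w) (h1 (fst _ _ ≫ y) (fst _ _ ≫ y'))
        simpa using h2
      exact h (v ≫ fst Z I) _ _
    rw [e, Category.assoc, Category.assoc, Category.assoc, Category.assoc]
    have e2 : ∀ w w' : Z ⟶ Ω E, w = w' := fun w w' => hZ.hom_ext w w'
    rw [e2 (hZ.to _ ≫ uncurry s) (hZ.to _ ≫ uncurry t)]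
  refine ⟨⟨⟨⟨(discrete Z).opens.top (𝟙_ E), fun _ => hom_eq _ _, fun _ => hom_eq _ _,
    fun _ _ => hom_eq _ _, fun _ _ => hom_eq _ _⟩, ?_⟩, emptySpaceIsInitial.to _, ?_, ?_⟩⟩
  · intro I J f a s _ K u b
    have h : ∀ {T : E} (x y : T ⟶ (discrete Z).opens.obj), (discrete Z).opens.le x y := by
      intro T x y
      rw [hom_eq x y]
      exact (discrete Z).opens.le_refl y
    exact ⟨fun _ _ _ _ _ => h _ _, fun _ => h _ _⟩
  · apply LocalicSpace.Map.ext
    apply InternalLattice.Hom.ext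
    exact hom_eq _ _
  · exact emptySpaceIsInitial.hom_ext _ _

/-- The one-point space `1`, the discrete space on the terminal object. -/
noncomputable abbrev point (E : Type u) [Category.{v} E] [CartesianMonoidalCategory E]
    [HasFiniteLimits E] [HasSubobjectClassifier E] [MonoidalClosed E] : LocalicSpace E :=
  discrete (𝟙_ E)

/-- The image of `X` in `1`, as a truth value (a subobject of `1`). -/
noncomputable abbrev support (X : E) : E := image (toUnit X)

instance (X : E) : Mono (toUnit (support X)) := by
  rw [toUnit_unique (toUnit (support X)) (image.ι (toUnit X))]
  infer_instance

/-- The open subspace of `1` given by a truth value `φ`. -/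
noncomputable def openOfTruth (φ : E) [Mono (toUnit φ)] : Subspace (point E) :=
  openSubspace (point E) (openOf (toUnit φ))

/-- The closed complement in `1` of the open subspace given by a truth value `φ`. -/
noncomputable def closedOfTruth (φ : E) [Mono (toUnit φ)] : Subspace (point E) :=
  closedSubspace (point E) (openOf (toUnit φ))

/-- `B` is the internal Boolean algebra freely generated by no generators, subject to one relation
`1 ≤ 0` for each `x : X` (imposed on the generic element of `X`). -/
structure IsFreeOnRelations (X : E) (B : InternalLattice E) : Prop where
  isBoolean : B.IsBoolean
  rel : B.le (B.top X) (B.bot X)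
  existsUnique_hom : ∀ C : InternalLattice E, C.IsBoolean → C.le (C.top X) (C.bot X) →
    ∃! _h : InternalLattice.Hom B C, True

/-- For a subobject `φ` of `1`: `B` is the quotient of the Boolean algebra `2 = {0, 1}` by the
congruence `{(0, 0), (1, 1)} ∪ φ × {(0, 1), (1, 0)}`. That is, the elements `0` and `1` of `B` are
jointly epimorphic, so that `2 = 1 + 1 ⟶ B` is epimorphic, and `0 = 1` holds in `B` at a stage
precisely if `φ` does. -/
structure IsQuotientOfTwo (φ : E) (B : InternalLattice E) : Prop where
  jointly_epi : ∀ {Z : E} (g h : B.obj ⟶ Z), B.bot (𝟙_ E) ≫ g = B.bot (𝟙_ E) ≫ h →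
    B.top (𝟙_ E) ≫ g = B.top (𝟙_ E) ≫ h → g = h
  bot_eq_top_iff : ∀ I : E, B.bot I = B.top I ↔ Nonempty (I ⟶ φ)

end Statement

end Topos

end PointFree

open PointFree


/-!
Maps into `0` are unique and exist exactly on trivial spaces, so `0 ^ X` exists and equals `Z` if
and only if `Z` is terminal among the spaces `W` such that every space over both `W` and `X` is
trivial.

A truth value `φ` has an image `φ_W` among the opens of every space `W`. Maps from `W` to the
discrete space on `φ`, or to the closed complement of `φ`, are unique; they exist if and only if
`φ_W = 1`, or `φ_W = 0`, respectively. If `X` is discrete with image `φ`, the space with the opens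
`O(W) ^ X` lies over both `W` and `X`, and it is trivial only if `0 = 1` in `O(W)` over `φ`, that
is, only if `φ_W = 0`; hence `0 ^ X` is the closed complement. Conversely the closed complement of
`φ_W` in `W` lies over both `W` and the closed complement of `φ`, and it is trivial only if
`φ_W = 1`.

For `Spec A` one needs, over an arbitrary `W`, a space that carries a prime filter of `A` and is
trivial only if `W` is covered by the truth value `φ` of `0 = 1` in `A`. Let `M` be the frame of
antitone functions from `A` to `O(W)` and `d` the principal ideal of `0`. The functions `x` with
`(x → d) → d = x` form the frame of such a space: sending `a` to the regularization of its principal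
ideal is a lattice homomorphism, and if `d = 1` in `M` then `d` takes the value `1` at `1`, that is,
`φ_W = 1`.
-/

namespace PointFree

section Lattices

variable {E : Type u} [Category.{v} E]

namespace InternalLattice

variable {A : InternalLattice E} {I J : E}

lemma eq_of_forall_ge_iff {a b : I ⟶ A.obj} (h : ∀ c : I ⟶ A.obj, A.le a c ↔ A.le b c) : a = b :=
  ((h b).2 (A.le_refl b)).antisymm ((h a).1 (A.le_refl a))

lemma eq_of_forall_le_iff {a b : I ⟶ A.obj} (h : ∀ c : I ⟶ A.obj, A.le c a ↔ A.le c b) : a = b :=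
  ((h a).1 (A.le_refl a)).antisymm ((h b).2 (A.le_refl b))

lemma meet_le_left (a b : I ⟶ A.obj) : A.le (A.inf a b) a := (le_meet_iff.1 (A.le_refl _)).1

lemma meet_le_right (a b : I ⟶ A.obj) : A.le (A.inf a b) b := (le_meet_iff.1 (A.le_refl _)).2

lemma le_join_left (a b : I ⟶ A.obj) : A.le a (A.sup a b) := (join_le_iff.1 (A.le_refl _)).1

lemma le_join_right (a b : I ⟶ A.obj) : A.le b (A.sup a b) := (join_le_iff.1 (A.le_refl _)).2

lemma top_le_iff_eq {a : I ⟶ A.obj} : A.le (A.top I) a ↔ a = A.top I :=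
  ⟨fun h => (le_top a).antisymm h, fun h => h ▸ A.le_refl _⟩

lemma le_bot_iff_eq {a : I ⟶ A.obj} : A.le a (A.bot I) ↔ a = A.bot I :=
  ⟨fun h => h.antisymm (bot_le a), fun h => h ▸ A.le_refl _⟩

lemma inf_self (a : I ⟶ A.obj) : A.inf a a = a := A.le_refl a

lemma sup_self (a : I ⟶ A.obj) : A.sup a a = a := sup_eq_iff_le.2 (A.le_refl a)

lemma top_inf (a : I ⟶ A.obj) : A.inf (A.top I) a = a := by rw [A.inf_comm, A.inf_top]

lemma inf_bot (a : I ⟶ A.obj) : A.inf a (A.bot I) = A.bot I :=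
  le_bot_iff_eq.1 (meet_le_right _ _)

lemma bot_inf (a : I ⟶ A.obj) : A.inf (A.bot I) a = A.bot I := by rw [A.inf_comm, inf_bot]

lemma bot_sup (a : I ⟶ A.obj) : A.sup (A.bot I) a = a := by rw [A.sup_comm, A.sup_bot]

lemma sup_top (a : I ⟶ A.obj) : A.sup a (A.top I) = A.top I :=
  top_le_iff_eq.1 (le_join_right _ _)

lemma top_sup (a : I ⟶ A.obj) : A.sup (A.top I) a = A.top I := by rw [A.sup_comm, sup_top]

lemma eq_of_inf_eq_of_sup_eq {a b c : I ⟶ A.obj} (hinf : A.inf a c = A.inf b c)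
    (hsup : A.sup a c = A.sup b c) : a = b :=
  _root_.eq_of_inf_eq_sup_eq (α := A.El I) hinf hsup

lemma le_of_bot_eq_top (h : A.bot I = A.top I) (a b : I ⟶ A.obj) : A.le a b :=
  (le_top a).trans (h ▸ bot_le b)

lemma eq_of_bot_eq_top (h : A.bot I = A.top I) (a b : I ⟶ A.obj) : a = b :=
  (le_of_bot_eq_top h a b).antisymm (le_of_bot_eq_top h b a)

lemma bot_eq_top_comp (h : A.bot I = A.top I) (u : J ⟶ I) : A.bot J = A.top J := by
  rw [← A.comp_bot u, h, A.comp_top]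

lemma IsJoin.le_iff {f : J ⟶ I} {a : J ⟶ A.obj} {s : I ⟶ A.obj} (h : A.IsJoin f a s)
    (b : I ⟶ A.obj) : A.le s b ↔ A.le a (f ≫ b) := by
  have hid := h (𝟙 I) b
  rw [Category.id_comp] at hid
  rw [hid]
  constructor
  · intro hb
    simpa using hb f (𝟙 J) (by simp)
  · intro hb T p q hpq
    rw [Category.comp_id] at hpq
    rw [hpq, Category.assoc]
    exact hb.comp q

end InternalLattice

open InternalLattice

namespace LocalicSpace

variable {X Y Z : LocalicSpace E}

lemma hom_ext {f g : X ⟶ Y} (h : f.inv.map = g.inv.map) : f = g :=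
  Map.ext (Hom.ext h)

lemma comp_inv (f : X ⟶ Y) (g : Y ⟶ Z) : (f ≫ g).inv.map = g.inv.map ≫ f.inv.map := rfl

/-- The map of spaces whose inverse image `m` preserves finite meets and has a right adjoint. The
right adjoint is given on generalized elements, stably under change of stage. -/
def Map.ofAdjoint (m : Y.opens.obj ⟶ X.opens.obj) (htop : ∀ I, Y.opens.top I ≫ m = X.opens.top I)
    (hinf : ∀ {I : E} (a b : I ⟶ Y.opens.obj),
      Y.opens.inf a b ≫ m = X.opens.inf (a ≫ m) (b ≫ m))
    (hadj : ∀ {I : E} (b : I ⟶ X.opens.obj), ∃ r : I ⟶ Y.opens.obj,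
      ∀ ⦃K : E⦄ (u : K ⟶ I) (a : K ⟶ Y.opens.obj),
        X.opens.le (a ≫ m) (u ≫ b) ↔ Y.opens.le a (u ≫ r)) : X ⟶ Y where
  inv :=
    { map := m
      top_map := htop
      bot_map := fun I => by
        obtain ⟨r, hr⟩ := hadj (X.opens.bot I)
        have hbot := (hr (𝟙 I) (Y.opens.bot I)).2 (bot_le _)
        rwa [Category.id_comp, le_bot_iff_eq] at hbot
      inf_map := hinf
      sup_map := fun {I} a b => eq_of_forall_ge_iff fun c => by
        obtain ⟨r, hr⟩ := hadj c
        have hr' := hr (𝟙 I)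
        rw [Category.id_comp, Category.id_comp] at hr'
        rw [join_le_iff, hr', hr', hr', join_le_iff] }
  map_join {I J} f a s h := by
    intro K u b
    obtain ⟨r, hr⟩ := hadj b
    have hr' := hr (𝟙 K) (u ≫ s)
    rw [Category.id_comp, Category.id_comp] at hr'
    rw [← Category.assoc, hr', h]
    refine forall_congr' fun T => forall_congr' fun p => forall_congr' fun q =>
      imp_congr_right fun _ => ?_
    rw [← Category.assoc, hr]

lemma exists_comp_eq_of_section (i : X ⟶ Y) (s : X.opens.obj ⟶ Y.opens.obj)
    (hs : s ≫ i.inv.map = 𝟙 _) (g : Z ⟶ Y) (hg : i.inv.map ≫ s ≫ g.inv.map = g.inv.map) :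
    ∃ k : Z ⟶ X, k ≫ i = g := by
  have hsec : ∀ {I : E} (a : I ⟶ X.opens.obj), (a ≫ s) ≫ i.inv.map = a := fun a => by
    rw [Category.assoc, hs, Category.comp_id]
  have hfac : ∀ {I : E} (b : I ⟶ Y.opens.obj), (b ≫ i.inv.map) ≫ s ≫ g.inv.map = b ≫ g.inv.map :=
    fun b => by rw [Category.assoc, hg]
  refine ⟨{ inv := ⟨s ≫ g.inv.map, fun I => ?_, fun I => ?_, fun a b => ?_, fun a b => ?_⟩
            map_join := fun f a t ht => ?_ }, hom_ext hg⟩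
  · rw [← i.inv.top_map, hfac, g.inv.top_map]
  · rw [← i.inv.bot_map, hfac, g.inv.bot_map]
  · rw [← hsec a, ← hsec b, ← i.inv.inf_map, hfac, hfac, hfac, g.inv.inf_map]
  · rw [← hsec a, ← hsec b, ← i.inv.sup_map, hfac, hfac, hfac, g.inv.sup_map]
  · obtain ⟨t', ht'⟩ := Y.isFrame.exists_join f (a ≫ s)
    have ht'' : t = t' ≫ i.inv.map := ht.unique ((i.map_join _ _ _ ht').congr (hsec a) rfl)
    rw [ht'', hfac]
    exact (g.map_join _ _ _ ht').congr (Category.assoc _ _ _) rfl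

/-- A space is trivial if `0 = 1` in its frame of opens, at every stage. -/
def IsTrivial (X : LocalicSpace E) : Prop := ∀ I : E, X.opens.bot I = X.opens.top I

end LocalicSpace

lemma Subspace.hom_ext {L W : LocalicSpace E} (S : Subspace L) {k l : W ⟶ S.space}
    (h : k ≫ S.incl = l ≫ S.incl) : k = l := by
  have := S.epi
  apply LocalicSpace.hom_ext
  rw [← cancel_epi S.incl.inv.map]
  exact congrArg (fun g => g.inv.map) h

end Lattices

section EmptySpace

open InternalLattice

variable {E : Type u} [Category.{v} E] [CartesianMonoidalCategory E]

instance (T : LocalicSpace E) : Subsingleton (T ⟶ emptySpace E) where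
  allEq f g := by
    apply LocalicSpace.hom_ext
    have h : ∀ f : T ⟶ emptySpace E, f.inv.map = T.opens.top (𝟙_ E) := fun f => by
      rw [← f.inv.top_map]
      exact (Category.id_comp _).symm.trans (congrArg (· ≫ f.inv.map) (toUnit_unique _ _))
    rw [h f, h g]

namespace LocalicSpace

lemma isTrivial_of_hom_emptySpace {T : LocalicSpace E} (f : T ⟶ emptySpace E) : T.IsTrivial :=
  fun I => by rw [← f.inv.top_map, ← f.inv.bot_map]; rfl

lemma isTrivial_of_bot_eq_top {T : LocalicSpace E}
    (h : T.opens.bot (𝟙_ E) = T.opens.top (𝟙_ E)) : T.IsTrivial :=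
  fun I => bot_eq_top_comp h (toUnit I)

lemma IsTrivial.nonempty_hom_emptySpace {T : LocalicSpace E} (h : T.IsTrivial) :
    Nonempty (T ⟶ emptySpace E) :=
  ⟨{ inv :=
      { map := T.opens.top (𝟙_ E)
        top_map := fun _ => T.opens.comp_top _
        bot_map := fun I => (T.opens.comp_top _).trans (h I).symm
        inf_map := fun _ _ => eq_of_bot_eq_top (h _) _ _
        sup_map := fun _ _ => eq_of_bot_eq_top (h _) _ _ }
     map_join := fun _ _ _ _ _ _ _ =>
      ⟨fun _ _ _ _ _ => le_of_bot_eq_top (h _) _ _, fun _ => le_of_bot_eq_top (h _) _ _⟩ }⟩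

end LocalicSpace

open LocalicSpace

lemma isExponential_emptySpace_iff (X Z : LocalicSpace E) :
    IsExponential X (emptySpace E) Z ↔
      (∀ T : LocalicSpace E, (T ⟶ Z) → (T ⟶ X) → T.IsTrivial) ∧
      ∀ W : LocalicSpace E,
        (∀ T : LocalicSpace E, (T ⟶ W) → (T ⟶ X) → T.IsTrivial) → ∃! _h : W ⟶ Z, True := by
  constructor
  · rintro ⟨ev, hev⟩
    refine ⟨fun T z x => isTrivial_of_hom_emptySpace (ev.app z x), fun W hW => ?_⟩
    obtain ⟨h, -, huniq⟩ := hev W ⟨fun T w x => (hW T w x).nonempty_hom_emptySpace.some,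
      fun _ _ _ _ _ => Subsingleton.elim _ _⟩
    exact ⟨h, trivial, fun k _ => huniq k fun _ _ _ => Subsingleton.elim _ _⟩
  · rintro ⟨htriv, hlift⟩
    refine ⟨⟨fun T z x => (htriv T z x).nonempty_hom_emptySpace.some,
      fun _ _ _ _ _ => Subsingleton.elim _ _⟩, fun W g => ?_⟩
    obtain ⟨h, -, huniq⟩ := hlift W fun T w x => isTrivial_of_hom_emptySpace (g.app w x)
    exact ⟨h, fun _ _ _ => Subsingleton.elim _ _, fun k _ => huniq k trivial⟩

lemma IsExponential.nonempty_iso {X Z Z' : LocalicSpace E}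
    (h : IsExponential X (emptySpace E) Z) (h' : IsExponential X (emptySpace E) Z') :
    Nonempty (Z ≅ Z') := by
  rw [isExponential_emptySpace_iff] at h h'
  obtain ⟨k, -, -⟩ := h'.2 Z h.1
  obtain ⟨l, -, -⟩ := h.2 Z' h'.1
  exact ⟨⟨k, l, (h.2 Z h.1).unique trivial trivial, (h'.2 Z' h'.1).unique trivial trivial⟩⟩

lemma IsExponential.congr {X Y Z : LocalicSpace E} (f : X ⟶ Y) (g : Y ⟶ X)
    (h : IsExponential X (emptySpace E) Z) : IsExponential Y (emptySpace E) Z := by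
  rw [isExponential_emptySpace_iff] at h ⊢
  exact ⟨fun T z y => h.1 T z (y ≫ g), fun W hW => h.2 W fun T w x => hW T w (x ≫ f)⟩

end EmptySpace

section OpenClosed

open InternalLattice LocalicSpace

variable {E : Type u} [Category.{v} E] [CartesianMonoidalCategory E]

lemma constAt_unit {A : E} (U : 𝟙_ E ⟶ A) : constAt U (𝟙_ E) = U := by
  rw [constAt, toUnit_unique (toUnit (𝟙_ E)) (𝟙 _), Category.id_comp]

variable [HasEqualizers E] (L : LocalicSpace E) (U : 𝟙_ E ⟶ L.opens.obj)

lemma exists_section_closedSubspace :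
    ∃ s : (closedSubspace L U).space.opens.obj ⟶ L.opens.obj,
      s ≫ (closedSubspace L U).incl.inv.map = 𝟙 _ ∧ ∀ {I : E} (a : I ⟶ L.opens.obj),
        a ≫ (closedSubspace L U).incl.inv.map ≫ s = L.opens.sup a (constAt U I) := by
  refine ⟨equalizer.ι (L.opens.sup (𝟙 _) (constAt U _)) (𝟙 _),
    equalizer.hom_ext ((Category.assoc _ _ _).trans ?_), fun a => ?_⟩
  · refine (congrArg (_ ≫ ·) (equalizer.lift_ι _ _)).trans ?_
    exact (equalizer.condition _ _).trans ((Category.comp_id _).trans (Category.id_comp _).symm)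
  · exact (congrArg (a ≫ ·) (equalizer.lift_ι _ _)).trans (comp_supU L U a)

lemma exists_section_openSubspace :
    ∃ s : (openSubspace L U).space.opens.obj ⟶ L.opens.obj,
      s ≫ (openSubspace L U).incl.inv.map = 𝟙 _ ∧ ∀ {I : E} (a : I ⟶ L.opens.obj),
        a ≫ (openSubspace L U).incl.inv.map ≫ s = L.opens.inf a (constAt U I) := by
  refine ⟨equalizer.ι (L.opens.inf (𝟙 _) (constAt U _)) (𝟙 _),
    equalizer.hom_ext ((Category.assoc _ _ _).trans ?_), fun a => ?_⟩
  · refine (congrArg (_ ≫ ·) (equalizer.lift_ι _ _)).trans ?_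
    exact (equalizer.condition _ _).trans ((Category.comp_id _).trans (Category.id_comp _).symm)
  · exact (congrArg (a ≫ ·) (equalizer.lift_ι _ _)).trans (comp_infU L U a)

lemma closedSubspace_incl_eq_iff {I : E} (a b : I ⟶ L.opens.obj) :
    a ≫ (closedSubspace L U).incl.inv.map = b ≫ (closedSubspace L U).incl.inv.map ↔
      L.opens.sup a (constAt U I) = L.opens.sup b (constAt U I) := by
  obtain ⟨s, hs, hsup⟩ := exists_section_closedSubspace L U
  have : Mono s := ⟨fun f g hfg => by
    rw [← Category.comp_id f, ← Category.comp_id g, ← hs, reassoc_of% hfg]⟩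
  rw [← hsup a, ← hsup b, ← Category.assoc a, ← Category.assoc b]
  exact (cancel_mono s).symm

lemma openSubspace_incl_eq_iff {I : E} (a b : I ⟶ L.opens.obj) :
    a ≫ (openSubspace L U).incl.inv.map = b ≫ (openSubspace L U).incl.inv.map ↔
      L.opens.inf a (constAt U I) = L.opens.inf b (constAt U I) := by
  obtain ⟨s, hs, hinf⟩ := exists_section_openSubspace L U
  have : Mono s := ⟨fun f g hfg => by
    rw [← Category.comp_id f, ← Category.comp_id g, ← hs, reassoc_of% hfg]⟩
  rw [← hinf a, ← hinf b, ← Category.assoc a, ← Category.assoc b]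
  exact (cancel_mono s).symm

variable {L}

lemma exists_comp_closedSubspace_incl_iff {W : LocalicSpace E} (g : W ⟶ L) :
    (∃ k : W ⟶ (closedSubspace L U).space, k ≫ (closedSubspace L U).incl = g) ↔
      U ≫ g.inv.map = W.opens.bot (𝟙_ E) := by
  constructor
  · rintro ⟨k, rfl⟩
    have hU : U ≫ (closedSubspace L U).incl.inv.map =
        L.opens.bot (𝟙_ E) ≫ (closedSubspace L U).incl.inv.map := by
      rw [closedSubspace_incl_eq_iff, constAt_unit, sup_self, bot_sup]
    rw [comp_inv, ← Category.assoc, hU, (closedSubspace L U).incl.inv.bot_map, k.inv.bot_map]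
  · intro hU
    obtain ⟨s, hs, hsup⟩ := exists_section_closedSubspace L U
    refine exists_comp_eq_of_section _ s hs g ?_
    have hid := hsup (𝟙 _)
    rw [Category.id_comp] at hid
    rw [← Category.assoc, hid, g.inv.sup_map, Category.id_comp, constAt, Category.assoc, hU,
      W.opens.comp_bot, W.opens.sup_bot]

lemma exists_comp_openSubspace_incl_iff {W : LocalicSpace E} (g : W ⟶ L) :
    (∃ k : W ⟶ (openSubspace L U).space, k ≫ (openSubspace L U).incl = g) ↔
      U ≫ g.inv.map = W.opens.top (𝟙_ E) := by
  constructor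
  · rintro ⟨k, rfl⟩
    have hU : U ≫ (openSubspace L U).incl.inv.map =
        L.opens.top (𝟙_ E) ≫ (openSubspace L U).incl.inv.map := by
      rw [openSubspace_incl_eq_iff, constAt_unit, inf_self, top_inf]
    rw [comp_inv, ← Category.assoc, hU, (openSubspace L U).incl.inv.top_map, k.inv.top_map]
  · intro hU
    obtain ⟨s, hs, hinf⟩ := exists_section_openSubspace L U
    refine exists_comp_eq_of_section _ s hs g ?_
    have hid := hinf (𝟙 _)
    rw [Category.id_comp] at hid
    rw [← Category.assoc, hid, g.inv.inf_map, Category.id_comp, constAt, Category.assoc, hU,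
      W.opens.comp_top, W.opens.inf_top]

variable (L)

lemma isTrivial_closedSubspace_iff :
    (closedSubspace L U).space.IsTrivial ↔ U = L.opens.top (𝟙_ E) := by
  have h : (closedSubspace L U).space.opens.bot (𝟙_ E) =
      (closedSubspace L U).space.opens.top (𝟙_ E) ↔ U = L.opens.top (𝟙_ E) := by
    rw [← (closedSubspace L U).incl.inv.bot_map, ← (closedSubspace L U).incl.inv.top_map,
      closedSubspace_incl_eq_iff, constAt_unit, bot_sup, top_sup]
  exact ⟨fun k => h.1 (k _), fun k => isTrivial_of_bot_eq_top (h.2 k)⟩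

-- An open is determined by its restrictions to `U` and to the closed complement, because
-- complements are unique in a distributive lattice.
lemma isLUB_openSubspace_closedSubspace [Balanced E] :
    IsLUB {openSubspace L U, closedSubspace L U} (Subspace.whole L) := by
  refine ⟨fun S _ => ⟨S.incl, Category.comp_id _⟩, fun S hS => ?_⟩
  obtain ⟨k, hk⟩ := hS (Set.mem_insert _ _)
  obtain ⟨l, hl⟩ := hS (Set.mem_insert_of_mem _ rfl)
  have := S.epi
  have : Mono S.incl.inv.map := ⟨fun {I} a b hab => by
    refine eq_of_inf_eq_of_sup_eq (c := constAt U I) ?_ ?_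
    · rw [← openSubspace_incl_eq_iff, ← hk, comp_inv, reassoc_of% hab]
    · rw [← closedSubspace_incl_eq_iff, ← hl, comp_inv, reassoc_of% hab]⟩
  have := isIso_of_mono_of_epi S.incl.inv.map
  exact exists_comp_eq_of_section S.incl (inv S.incl.inv.map) (IsIso.inv_hom_id _) (𝟙 L)
    (IsIso.hom_inv_id_assoc _ _)

lemma isGLB_openSubspace_closedSubspace :
    IsGLB {openSubspace L U, closedSubspace L U} (Subspace.empty L) := by
  refine ⟨fun S _ => ⟨emptySpaceIsInitial.to _, emptySpaceIsInitial.hom_ext _ _⟩, fun S hS => ?_⟩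
  have htop := (exists_comp_openSubspace_incl_iff U S.incl).1 (hS (Set.mem_insert _ _))
  have hbot := (exists_comp_closedSubspace_incl_iff U S.incl).1 (hS (Set.mem_insert_of_mem _ rfl))
  have htriv : S.space.IsTrivial := isTrivial_of_bot_eq_top (hbot.symm.trans htop)
  exact ⟨htriv.nonempty_hom_emptySpace.some, LocalicSpace.hom_ext (eq_of_bot_eq_top (htriv _) _ _)⟩

end OpenClosed

end PointFree

namespace PointFree

section ImageOpen

open InternalLattice

variable {E : Type u} [Category.{v} E]

lemma InternalLattice.IsJoin.of_isPullback {A : InternalLattice E} {I J I' J' : E} {f : J ⟶ I}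
    {f' : J' ⟶ I'} {w : J' ⟶ J} {v : I' ⟶ I} (hp : IsPullback w f' f v) {a : J ⟶ A.obj}
    {s : I ⟶ A.obj} (h : A.IsJoin f a s) : A.IsJoin f' (w ≫ a) (v ≫ s) := by
  intro K u b
  have huv := h (u ≫ v) b
  rw [Category.assoc] at huv
  rw [huv]
  constructor
  · intro hb T p q hpq
    rw [← Category.assoc q]
    exact hb p (q ≫ w) (by rw [← Category.assoc, hpq, Category.assoc, Category.assoc, hp.w])
  · intro hb T p q hpq
    have hlift := hb p (hp.lift q (p ≫ u) (by rw [← hpq, Category.assoc])) (by simp)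
    rwa [hp.lift_fst_assoc] at hlift

lemma InternalLattice.IsFrame.comp_inf_le_iff [HasPullbacks E] {A : InternalLattice E}
    (hA : A.IsFrame) {I J K : E} {f : J ⟶ I} {a : J ⟶ A.obj} {s : I ⟶ A.obj}
    (h : A.IsJoin f a s) (u : K ⟶ I) (c b : K ⟶ A.obj) :
    A.le (A.inf (u ≫ s) c) b ↔ ∀ ⦃T : E⦄ (p : T ⟶ K) (q : T ⟶ J), p ≫ u = q ≫ f →
      A.le (A.inf (q ≫ a) (p ≫ c)) (p ≫ b) := by
  have hp := IsPullback.of_hasPullback f u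
  rw [A.inf_comm, (hA.inf_join _ _ _ c (h.of_isPullback hp)).le_iff, A.inf_comm]
  constructor
  · intro hb T p q hpq
    simpa [A.comp_inf] using hb.comp (hp.lift q p hpq.symm)
  · exact fun hb => by simpa using hb (pullback.snd f u) (pullback.fst f u) pullback.condition.symm

variable (L : LocalicSpace E) {I J K : E} (f : J ⟶ I)

/-- The truth value of "`i` is in the image of `f : J ⟶ I`", as an open of `L` depending on `i : I`:
the join of `1` over the fibre of `f`. It serves to interpret statements about `E` in `L`. -/
noncomputable def imageOpen : I ⟶ L.opens.obj :=
  (L.isFrame.exists_join f (L.opens.top J)).choose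

lemma isJoin_imageOpen : L.opens.IsJoin f (L.opens.top J) (imageOpen L f) :=
  (L.isFrame.exists_join f (L.opens.top J)).choose_spec

variable {L} in
lemma imageOpen_map {W : LocalicSpace E} (g : W ⟶ L) :
    imageOpen L f ≫ g.inv.map = imageOpen W f :=
  ((g.map_join _ _ _ (isJoin_imageOpen L f)).congr (g.inv.top_map J) rfl).unique
    (isJoin_imageOpen W f)

variable {f}

lemma imageOpen_le_iff (u : K ⟶ I) (b : K ⟶ L.opens.obj) :
    L.opens.le (u ≫ imageOpen L f) b ↔
      ∀ ⦃T : E⦄ (p : T ⟶ K) (q : T ⟶ J), p ≫ u = q ≫ f → p ≫ b = L.opens.top T := by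
  rw [isJoin_imageOpen L f u b]
  simp only [L.opens.comp_top, top_le_iff_eq]

lemma imageOpen_inf_le_iff [HasPullbacks E] (u : K ⟶ I) (c b : K ⟶ L.opens.obj) :
    L.opens.le (L.opens.inf (u ≫ imageOpen L f) c) b ↔
      ∀ ⦃T : E⦄ (p : T ⟶ K) (q : T ⟶ J), p ≫ u = q ≫ f → L.opens.le (p ≫ c) (p ≫ b) := by
  rw [L.isFrame.comp_inf_le_iff (isJoin_imageOpen L f)]
  simp only [L.opens.comp_top, top_inf]

lemma imageOpen_eq_top {u : K ⟶ I} (q : K ⟶ J) (h : u = q ≫ f) :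
    u ≫ imageOpen L f = L.opens.top K := by
  simpa using (imageOpen_le_iff L u _).1 (L.opens.le_refl _) (𝟙 K) q (by simpa using h)

variable [CartesianMonoidalCategory E] (X : E)

lemma imageOpen_toUnit_le_iff (b : 𝟙_ E ⟶ L.opens.obj) :
    L.opens.le (imageOpen L (toUnit X)) b ↔ toUnit X ≫ b = L.opens.top X := by
  rw [(isJoin_imageOpen L (toUnit X)).le_iff, top_le_iff_eq]

lemma imageOpen_toUnit_eq_bot_iff :
    imageOpen L (toUnit X) = L.opens.bot (𝟙_ E) ↔ L.opens.bot X = L.opens.top X := by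
  rw [← le_bot_iff_eq, imageOpen_toUnit_le_iff, L.opens.comp_bot]

end ImageOpen

section Membership

open HasSubobjectClassifier MonoidalClosed InternalLattice

variable {E : Type u} [Category.{v} E] [CartesianMonoidalCategory E] [HasFiniteLimits E]
  [HasSubobjectClassifier E]

lemma exists_extent {I : E} (t : I ⟶ Ω E) :
    ∃ (S : E) (ι : S ⟶ I), Mono ι ∧
      ∀ ⦃T : E⦄ (u : T ⟶ I), u ≫ t = tr T ↔ ∃ w : T ⟶ S, w ≫ ι = u := by
  refine ⟨_, equalizer.ι t (tr I), inferInstance, fun T u => ⟨fun h => ?_, ?_⟩⟩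
  · exact ⟨equalizer.lift u (by rw [h, comp_tr]), equalizer.lift_ι _ _⟩
  · rintro ⟨w, rfl⟩
    rw [Category.assoc, equalizer.condition, comp_tr, comp_tr]

variable [MonoidalClosed E]

/-- The element `w` is the join of all `x` with this property; they form a subobject `D` of
`A.obj ⊗ I` over `I`. -/
lemma InternalLattice.IsFrame.exists_residual {A : InternalLattice E} (hA : A.IsFrame) {I J : E}
    (f : J ⟶ I) (y z : J ⟶ A.obj) :
    ∃ w : I ⟶ A.obj, ∀ ⦃K : E⦄ (u : K ⟶ I) (x : K ⟶ A.obj), A.le x (u ≫ w) ↔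
      ∀ ⦃T : E⦄ (p : T ⟶ K) (q : T ⟶ J), p ≫ u = q ≫ f →
        A.le (A.inf (p ≫ x) (q ≫ y)) (q ≫ z) := by
  let j := fst J (A.obj ⊗ I)
  let x₀ := snd J (A.obj ⊗ I) ≫ fst A.obj I
  let i := snd J (A.obj ⊗ I) ≫ snd A.obj I
  obtain ⟨D, δ, -, hD⟩ := exists_extent (tAll (X := J) (I := A.obj ⊗ I)
    (tImp (eqv (j ≫ f) i) (eqv (A.inf (A.inf x₀ (j ≫ y)) (j ≫ z)) (A.inf x₀ (j ≫ y)))))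
  have hδ : ∀ {K : E} (x : K ⟶ A.obj) (u : K ⟶ I), (∃ d : K ⟶ D, d ≫ δ = lift x u) ↔
      ∀ ⦃T : E⦄ (p : T ⟶ K) (q : T ⟶ J), p ≫ u = q ≫ f →
        A.le (A.inf (p ≫ x) (q ≫ y)) (q ≫ z) := by
    intro K x u
    rw [← hD, comp_tAll]
    simp only [comp_tImp, ← Category.assoc, comp_eqv, A.comp_inf]
    simp only [Category.assoc, j, x₀, i, lift_snd_assoc, lift_fst, lift_snd]
    constructor
    · intro h T p q hpq
      simpa [le] using h p q (𝟙 T) (by simp [hpq])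
    · intro h T p q S r hr
      simpa [le] using h (r ≫ p) (r ≫ q) (by simpa using hr.symm)
  obtain ⟨w, hw⟩ := hA.exists_join (δ ≫ snd _ _) (δ ≫ fst _ _)
  refine ⟨w, fun K u x => ⟨fun hx T p q hpq => ?_, fun hx => ?_⟩⟩
  · have hxw : A.le (A.inf (p ≫ x) (q ≫ y)) (A.inf ((q ≫ f) ≫ w) (q ≫ y)) := by
      rw [← hpq, Category.assoc]
      exact le_meet_iff.2 ⟨(meet_le_left _ _).trans (hx.comp p), meet_le_right _ _⟩
    refine hxw.trans ((hA.comp_inf_le_iff hw _ _ _).2 fun T' p' d hd => ?_)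
    simpa using (hδ (d ≫ δ ≫ fst _ _) (d ≫ δ ≫ snd _ _)).1 ⟨d, by ext <;> simp⟩ (𝟙 T') (p' ≫ q)
      (by simpa using hd.symm)
  · obtain ⟨d, hd⟩ := (hδ x u).2 hx
    have hdw := (hw u (u ≫ w)).1 (A.le_refl _) (𝟙 K) d (by
      rw [Category.id_comp, ← Category.assoc, hd, lift_snd])
    rwa [← Category.assoc, hd, lift_fst, Category.id_comp] at hdw

/-- The generalized element `x` of `X` belongs to the generalized subset `a` of `X`. -/
def Mem {X I : E} (x : I ⟶ X) (a : I ⟶ (discrete X).opens.obj) : Prop :=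
  lift x (𝟙 I) ≫ uncurry (show I ⟶ (ihom X).obj (Ω E) from a) = tr I

lemma mem_comp_iff {X I J : E} (x : J ⟶ X) (u : J ⟶ I) (a : I ⟶ (discrete X).opens.obj) :
    Mem x (u ≫ a) ↔ lift x u ≫ uncurry (show I ⟶ (ihom X).obj (Ω E) from a) = tr J := by
  have huncurry : uncurry (u ≫ show I ⟶ (ihom X).obj (Ω E) from a) = X ◁ u ≫ uncurry _ :=
    uncurry_natural_left _ _
  change lift x (𝟙 J) ≫ uncurry (u ≫ show I ⟶ (ihom X).obj (Ω E) from a) = tr J ↔ _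
  rw [huncurry, ← Category.assoc]
  simp

lemma Mem.comp {X I J : E} {x : I ⟶ X} {a : I ⟶ (discrete X).opens.obj} (h : Mem x a)
    (u : J ⟶ I) : Mem (u ≫ x) (u ≫ a) := by
  have hlift : lift (u ≫ x) u = u ≫ lift x (𝟙 I) := by simp
  rw [mem_comp_iff, hlift, Category.assoc]
  exact (congrArg _ h).trans (comp_tr u)

lemma exists_mem_iff {X Y I : E} (s t : X ⊗ I ⟶ Y) :
    ∃ a : I ⟶ (discrete X).opens.obj, ∀ ⦃T : E⦄ (u : T ⟶ I) (x : T ⟶ X),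
      Mem x (u ≫ a) ↔ lift x u ≫ s = lift x u ≫ t :=
  ⟨curry (eqv s t), fun T u x => (mem_comp_iff x u _).trans
    ((iff_of_eq (congrArg (fun e => lift x u ≫ e = tr T) (uncurry_curry (eqv s t)))).trans
      (comp_eqv s t _))⟩

lemma discrete_le_iff {X I : E} (a b : I ⟶ (discrete X).opens.obj) :
    (discrete X).opens.le a b ↔
      ∀ ⦃T : E⦄ (u : T ⟶ I) (x : T ⟶ X), Mem x (u ≫ a) → Mem x (u ≫ b) := by
  refine (powerLattice_le_iff X a b).trans ?_
  simp only [mem_comp_iff]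
  refine ⟨fun h T u x => h _, fun h T v hv => ?_⟩
  have hlift : lift (v ≫ fst X I) (v ≫ snd X I) = v := by ext <;> simp
  have hv' := h (v ≫ snd X I) (v ≫ fst X I)
  rw [hlift] at hv'
  exact hv' hv

lemma mem_top {X I : E} (x : I ⟶ X) : Mem x ((discrete X).opens.top I) := by
  have huncurry : uncurry (curry (tr (X ⊗ I))) = tr (X ⊗ I) := uncurry_curry _
  change lift x (𝟙 I) ≫ uncurry (curry (tr (X ⊗ I))) = tr I
  rw [huncurry, comp_tr]

lemma mem_inf {X I : E} (x : I ⟶ X) (a b : I ⟶ (discrete X).opens.obj) :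
    Mem x ((discrete X).opens.inf a b) ↔ Mem x a ∧ Mem x b := by
  change lift x (𝟙 I) ≫ uncurry (curry (tAnd (uncurry a) (uncurry b))) = tr I ↔ _
  rw [uncurry_curry, comp_tAnd]
  rfl

lemma mem_openOf {P X I : E} (m : P ⟶ X) [Mono m] (x : I ⟶ X) (u : I ⟶ 𝟙_ E) :
    Mem x (u ≫ openOf m) ↔ ∃ w : I ⟶ P, w ≫ m = x := by
  rw [mem_comp_iff]
  change lift x u ≫ uncurry (curry (fst X (𝟙_ E) ≫ χ m)) = tr I ↔ _
  rw [uncurry_curry, lift_fst_assoc, comp_χ_eq_tr]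

/-- The membership relation `{(x, a) | x ∈ a}` between `X` and the opens of the discrete space
on `X`. -/
noncomputable def membership (X : E) : E :=
  (exists_extent (uncurry (𝟙 ((ihom X).obj (Ω E))))).choose

/-- The inclusion of the membership relation. -/
noncomputable def membershipι (X : E) : membership X ⟶ X ⊗ (discrete X).opens.obj :=
  (exists_extent (uncurry (𝟙 ((ihom X).obj (Ω E))))).choose_spec.choose

lemma mem_iff_exists_membership {X I : E} (x : I ⟶ X) (a : I ⟶ (discrete X).opens.obj) :
    Mem x a ↔ ∃ w : I ⟶ membership X, w ≫ membershipι X = lift x a := by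
  have ha := mem_comp_iff x a (𝟙 (discrete X).opens.obj)
  rw [Category.comp_id] at ha
  exact ha.trans
    ((exists_extent (uncurry (𝟙 ((ihom X).obj (Ω E))))).choose_spec.choose_spec.2 (lift x a))

section MembershipOpen

variable (L : LocalicSpace E) (X : E)

/-- The truth value of "`x` belongs to `a`", as an open of `L` depending on `x` and `a`. -/
noncomputable def memOpen : X ⊗ (discrete X).opens.obj ⟶ L.opens.obj :=
  imageOpen L (membershipι X)

/-- The truth value of "the subset `a` of `X` is inhabited", as an open of `L` depending on the
open `a` of the discrete space on `X`. -/
noncomputable def inhabitedOpen : (discrete X).opens.obj ⟶ L.opens.obj :=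
  imageOpen L (membershipι X ≫ snd _ _)

variable {X} {I : E}

lemma memOpen_inf_le_iff (x : I ⟶ X) (a : I ⟶ (discrete X).opens.obj) (c b : I ⟶ L.opens.obj) :
    L.opens.le (L.opens.inf (lift x a ≫ memOpen L X) c) b ↔
      ∀ ⦃T : E⦄ (u : T ⟶ I), Mem (u ≫ x) (u ≫ a) → L.opens.le (u ≫ c) (u ≫ b) := by
  simp only [memOpen, imageOpen_inf_le_iff, mem_iff_exists_membership, ← comp_lift]
  exact ⟨fun h T u ⟨q, hq⟩ => h u q hq.symm, fun h T u q hq => h u ⟨q, hq.symm⟩⟩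

lemma memOpen_le_iff (x : I ⟶ X) (a : I ⟶ (discrete X).opens.obj) (b : I ⟶ L.opens.obj) :
    L.opens.le (lift x a ≫ memOpen L X) b ↔
      ∀ ⦃T : E⦄ (u : T ⟶ I), Mem (u ≫ x) (u ≫ a) → u ≫ b = L.opens.top T := by
  rw [← L.opens.inf_top (_ ≫ _), memOpen_inf_le_iff]
  simp only [L.opens.comp_top, top_le_iff_eq]

lemma memOpen_eq_top {x : I ⟶ X} {a : I ⟶ (discrete X).opens.obj} (h : Mem x a) :
    lift x a ≫ memOpen L X = L.opens.top I := by
  obtain ⟨q, hq⟩ := (mem_iff_exists_membership x a).1 h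
  exact imageOpen_eq_top L q hq.symm

lemma inhabitedOpen_inf_le_iff (a : I ⟶ (discrete X).opens.obj) (c b : I ⟶ L.opens.obj) :
    L.opens.le (L.opens.inf (a ≫ inhabitedOpen L X) c) b ↔
      ∀ ⦃T : E⦄ (u : T ⟶ I) (x : T ⟶ X), Mem x (u ≫ a) → L.opens.le (u ≫ c) (u ≫ b) := by
  rw [inhabitedOpen, imageOpen_inf_le_iff]
  refine forall_congr' fun T => forall_congr' fun u => ⟨fun h x hx => ?_, fun h q hq => ?_⟩
  · obtain ⟨q, hq⟩ := (mem_iff_exists_membership _ _).1 hx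
    exact h q (by rw [reassoc_of% hq, lift_snd])
  · exact h (q ≫ membershipι X ≫ fst _ _)
      ((mem_iff_exists_membership _ _).2 ⟨q, by ext <;> simp [hq]⟩)

lemma inhabitedOpen_le_iff (a : I ⟶ (discrete X).opens.obj) (b : I ⟶ L.opens.obj) :
    L.opens.le (a ≫ inhabitedOpen L X) b ↔
      ∀ ⦃T : E⦄ (u : T ⟶ I) (x : T ⟶ X), Mem x (u ≫ a) → u ≫ b = L.opens.top T := by
  rw [← L.opens.inf_top (a ≫ _), inhabitedOpen_inf_le_iff]
  simp only [L.opens.comp_top, top_le_iff_eq]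

lemma inhabitedOpen_eq_top {x : I ⟶ X} {a : I ⟶ (discrete X).opens.obj} (h : Mem x a) :
    a ≫ inhabitedOpen L X = L.opens.top I := by
  simpa using (inhabitedOpen_le_iff L a _).1 (L.opens.le_refl _) (𝟙 I) x (by simpa using h)

end MembershipOpen

end Membership

end PointFree

namespace PointFree

section Subterminal

lemma hom_eq_of_mono_toUnit {E : Type u} [Category.{v} E] [CartesianMonoidalCategory E] {φ : E}
    [Mono (toUnit φ)] {I : E} (x y : I ⟶ φ) : x = y := by
  rw [← cancel_mono (toUnit φ), toUnit_unique (x ≫ _)]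

open HasSubobjectClassifier MonoidalClosed InternalLattice LocalicSpace

variable {E : Type u} [Category.{v} E] [CartesianMonoidalCategory E] [HasFiniteLimits E]
  [HasSubobjectClassifier E] [MonoidalClosed E]

lemma imageOpen_discrete_toUnit (X : E) :
    imageOpen (discrete X) (toUnit X) = (discrete X).opens.top (𝟙_ E) := by
  rw [← top_le_iff_eq, discrete_le_iff]
  intro T u x _
  rw [imageOpen_eq_top _ x (toUnit_unique _ _)]
  exact mem_top x

variable {φ : E} [Mono (toUnit φ)] {W : LocalicSpace E}

lemma mem_iff_eq_top {I : E} (x : I ⟶ φ) (a : I ⟶ (discrete φ).opens.obj) :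
    Mem x a ↔ a = (discrete φ).opens.top I := by
  refine ⟨fun h => top_le_iff_eq.1 ((discrete_le_iff _ _).2 fun T u y _ => ?_), fun h => ?_⟩
  · exact hom_eq_of_mono_toUnit y (u ≫ x) ▸ h.comp u
  · exact h ▸ mem_top x

variable (φ) in
lemma inhabitedOpen_discrete : inhabitedOpen (discrete φ) φ = 𝟙 _ :=
  eq_of_forall_ge_iff fun c => by
    have hle := inhabitedOpen_le_iff (discrete φ) (𝟙 (discrete φ).opens.obj) c
    rw [Category.id_comp] at hle
    rw [hle, discrete_le_iff]
    exact forall_congr' fun T => forall_congr' fun u => forall_congr' fun x =>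
      imp_congr_right fun _ => (mem_iff_eq_top x _).symm

lemma inv_map_eq_inhabitedOpen (f : W ⟶ discrete φ) : f.inv.map = inhabitedOpen W φ := by
  rw [inhabitedOpen, ← imageOpen_map _ f, ← inhabitedOpen, inhabitedOpen_discrete, Category.id_comp]

instance : Subsingleton (W ⟶ discrete φ) :=
  ⟨fun f g => LocalicSpace.hom_ext (by rw [inv_map_eq_inhabitedOpen, inv_map_eq_inhabitedOpen])⟩

variable (φ W) in
lemma nonempty_hom_discrete_iff :
    Nonempty (W ⟶ discrete φ) ↔ imageOpen W (toUnit φ) = W.opens.top (𝟙_ E) := by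
  constructor
  · rintro ⟨f⟩
    rw [← imageOpen_map _ f, imageOpen_discrete_toUnit, f.inv.top_map]
  · intro h
    refine ⟨Map.ofAdjoint (inhabitedOpen W φ) (fun I => ?_) (fun a b => ?_) fun {I} b => ?_⟩
    · rw [← top_le_iff_eq, ← W.opens.comp_top (toUnit I), ← h, imageOpen_le_iff]
      intro T p q _
      rw [reassoc_of% (discrete φ).opens.comp_top p]
      exact inhabitedOpen_eq_top W (mem_top q)
    · refine le.antisymm (le_meet_iff.2 ⟨?_, ?_⟩) ?_
      · rw [inhabitedOpen_le_iff]
        intro T u x hx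
        rw [(discrete φ).opens.comp_inf, mem_inf] at hx
        rw [← Category.assoc, inhabitedOpen_eq_top W hx.1]
      · rw [inhabitedOpen_le_iff]
        intro T u x hx
        rw [(discrete φ).opens.comp_inf, mem_inf] at hx
        rw [← Category.assoc, inhabitedOpen_eq_top W hx.2]
      · rw [inhabitedOpen_inf_le_iff]
        intro T u x hx
        rw [mem_iff_eq_top] at hx
        rw [← Category.assoc, ← Category.assoc, (discrete φ).opens.comp_inf, hx, top_inf]
        exact W.opens.le_refl _
    · obtain ⟨r, hr⟩ := exists_mem_iff (snd φ I ≫ b) (snd φ I ≫ W.opens.top I)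
      refine ⟨r, fun K u a => ?_⟩
      rw [inhabitedOpen_le_iff, discrete_le_iff]
      simp only [← Category.assoc, hr]
      simp only [Category.assoc, lift_snd_assoc, W.opens.comp_top]

instance : Mono (toUnit (𝟙_ E)) := by
  rw [toUnit_unique (toUnit (𝟙_ E)) (𝟙 _)]
  infer_instance

instance (S : Subspace (point E)) : Subsingleton (W ⟶ S.space) :=
  ⟨fun _ _ => S.hom_ext (Subsingleton.elim _ _)⟩

variable (W) in
lemma nonempty_hom_point : Nonempty (W ⟶ point E) := by
  rw [nonempty_hom_discrete_iff, ← Category.id_comp (imageOpen _ _)]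
  exact imageOpen_eq_top W (𝟙 _) (toUnit_unique _ _)

variable (φ) in
lemma openOf_toUnit : openOf (toUnit φ) = imageOpen (point E) (toUnit φ) := by
  refine le.antisymm ((discrete_le_iff _ _).2 fun T u x hx => ?_) ?_
  · obtain ⟨w, -⟩ := (mem_openOf (toUnit φ) x u).1 hx
    rw [mem_iff_eq_top]
    exact imageOpen_eq_top _ w (toUnit_unique _ _)
  · rw [imageOpen_toUnit_le_iff, ← mem_iff_eq_top (toUnit φ), mem_openOf]
    exact ⟨𝟙 φ, Category.id_comp _⟩

variable (φ W)

lemma nonempty_hom_closedOfTruth_iff :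
    Nonempty (W ⟶ (closedOfTruth φ).space) ↔ imageOpen W (toUnit φ) = W.opens.bot (𝟙_ E) := by
  obtain ⟨g⟩ := nonempty_hom_point W
  rw [← imageOpen_map _ g, ← openOf_toUnit, ← exists_comp_closedSubspace_incl_iff]
  exact ⟨fun ⟨k⟩ => ⟨k, Subsingleton.elim _ _⟩, fun ⟨k, _⟩ => ⟨k⟩⟩

lemma nonempty_hom_openOfTruth_iff :
    Nonempty (W ⟶ (openOfTruth φ).space) ↔ imageOpen W (toUnit φ) = W.opens.top (𝟙_ E) := by
  obtain ⟨g⟩ := nonempty_hom_point W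
  rw [← imageOpen_map _ g, ← openOf_toUnit, ← exists_comp_openSubspace_incl_iff]
  exact ⟨fun ⟨k⟩ => ⟨k, Subsingleton.elim _ _⟩, fun ⟨k, _⟩ => ⟨k⟩⟩

lemma nonempty_discrete_iso_openOfTruth : Nonempty (discrete φ ≅ (openOfTruth φ).space) := by
  obtain ⟨f⟩ := (nonempty_hom_openOfTruth_iff φ _).2 (imageOpen_discrete_toUnit φ)
  obtain ⟨g⟩ := (nonempty_hom_discrete_iff φ _).2
    ((nonempty_hom_openOfTruth_iff φ (openOfTruth φ).space).1 ⟨𝟙 _⟩)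
  exact ⟨⟨f, g, Subsingleton.elim _ _, Subsingleton.elim _ _⟩⟩

end Subterminal

end PointFree

namespace PointFree

section Functions

open MonoidalClosed InternalLattice

variable {E : Type u} [Category.{v} E] [CartesianMonoidalCategory E]

lemma isPullback_whiskerLeft_snd (X : E) {I J : E} (f : J ⟶ I) :
    IsPullback (snd X J) (X ◁ f) f (snd X I) :=
  IsPullback.of_isLimit' ⟨(whiskerLeft_snd X f).symm⟩ <|
    PullbackCone.IsLimit.mk _ (fun c => lift (c.snd ≫ fst X I) c.fst) (fun c => lift_snd _ _)
      (fun c => by ext <;> simp [c.condition])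
      (fun c m h₁ h₂ => by ext <;> simp [← h₁, ← h₂])

variable [MonoidalClosed E]

/-- The internal lattice `A ^ X` of functions from `X` to `A`, with the pointwise operations. -/
noncomputable def functionLattice (X : E) (A : InternalLattice E) : InternalLattice E where
  obj := (ihom X).obj A.obj
  top I := curry (A.top (X ⊗ I))
  bot I := curry (A.bot (X ⊗ I))
  inf a b := curry (A.inf (uncurry a) (uncurry b))
  sup a b := curry (A.sup (uncurry a) (uncurry b))
  comp_top u := by rw [← curry_natural_left, A.comp_top]
  comp_bot u := by rw [← curry_natural_left, A.comp_bot]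
  comp_inf u a b := by
    rw [← curry_natural_left, A.comp_inf, uncurry_natural_left, uncurry_natural_left]
  comp_sup u a b := by
    rw [← curry_natural_left, A.comp_sup, uncurry_natural_left, uncurry_natural_left]
  inf_comm a b := congrArg curry (A.inf_comm _ _)
  sup_comm a b := congrArg curry (A.sup_comm _ _)
  inf_assoc a b c := by simp only [uncurry_curry, A.inf_assoc]
  sup_assoc a b c := by simp only [uncurry_curry, A.sup_assoc]
  inf_sup_self a b := by rw [uncurry_curry, A.inf_sup_self, curry_uncurry]
  sup_inf_self a b := by rw [uncurry_curry, A.sup_inf_self, curry_uncurry]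
  inf_sup_left a b c := by simp only [uncurry_curry, A.inf_sup_left]
  inf_top a := by rw [uncurry_curry, A.inf_top, curry_uncurry]
  sup_bot a := by rw [uncurry_curry, A.sup_bot, curry_uncurry]

namespace functionLattice

variable {X : E} {A : InternalLattice E} {I J : E}

/-- A generalized element of `A ^ X` as a morphism into `A`. -/
noncomputable def toFun (f : I ⟶ (functionLattice X A).obj) : X ⊗ I ⟶ A.obj :=
  uncurry (show I ⟶ (ihom X).obj A.obj from f)

/-- The generalized element of `A ^ X` given by a morphism into `A`. -/
noncomputable def ofFun (g : X ⊗ I ⟶ A.obj) : I ⟶ (functionLattice X A).obj :=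
  show I ⟶ (ihom X).obj A.obj from curry g

/-- The value of `f` at `x`, for generalized elements `f` of `A ^ X` and `x` of `X`. -/
noncomputable def apply (x : I ⟶ X) (f : I ⟶ (functionLattice X A).obj) : I ⟶ A.obj :=
  lift x (𝟙 I) ≫ toFun f

lemma toFun_ofFun (g : X ⊗ I ⟶ A.obj) : toFun (ofFun g) = g := uncurry_curry g

lemma apply_comp (x : J ⟶ X) (u : J ⟶ I) (f : I ⟶ (functionLattice X A).obj) :
    apply x (u ≫ f) = lift x u ≫ toFun f := by
  have h : toFun (u ≫ f) = X ◁ u ≫ toFun f := uncurry_natural_left _ _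
  rw [apply, h, ← Category.assoc]
  simp

lemma comp_apply (u : J ⟶ I) (x : I ⟶ X) (f : I ⟶ (functionLattice X A).obj) :
    u ≫ apply x f = apply (u ≫ x) (u ≫ f) := by
  rw [apply_comp, apply, comp_lift_assoc, Category.comp_id]

lemma toFun_eq_apply (f : I ⟶ (functionLattice X A).obj) :
    toFun f = apply (fst X I) (snd X I ≫ f) := by
  rw [apply_comp, lift_fst_snd, Category.id_comp]

lemma hom_ext {f g : I ⟶ (functionLattice X A).obj}
    (h : ∀ ⦃J : E⦄ (u : J ⟶ I) (x : J ⟶ X), apply x (u ≫ f) = apply x (u ≫ g)) : f = g := by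
  have hfun : toFun f = toFun g := by rw [toFun_eq_apply, toFun_eq_apply, h]
  exact uncurry_injective hfun

lemma apply_comp_ofFun (x : J ⟶ X) (u : J ⟶ I) (g : X ⊗ I ⟶ A.obj) :
    apply x (u ≫ ofFun g) = lift x u ≫ g := by
  rw [apply_comp, toFun_ofFun]

lemma apply_top (x : I ⟶ X) : apply x ((functionLattice X A).top I) = A.top I :=
  (congrArg _ (toFun_ofFun _)).trans (A.comp_top _)

lemma apply_bot (x : I ⟶ X) : apply x ((functionLattice X A).bot I) = A.bot I :=
  (congrArg _ (toFun_ofFun _)).trans (A.comp_bot _)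

lemma apply_inf (x : I ⟶ X) (f g : I ⟶ (functionLattice X A).obj) :
    apply x ((functionLattice X A).inf f g) = A.inf (apply x f) (apply x g) :=
  (congrArg _ (toFun_ofFun _)).trans (A.comp_inf _ _ _)

lemma apply_sup (x : I ⟶ X) (f g : I ⟶ (functionLattice X A).obj) :
    apply x ((functionLattice X A).sup f g) = A.sup (apply x f) (apply x g) :=
  (congrArg _ (toFun_ofFun _)).trans (A.comp_sup _ _ _)

lemma le_iff_apply {f g : I ⟶ (functionLattice X A).obj} :
    (functionLattice X A).le f g ↔
      ∀ ⦃J : E⦄ (u : J ⟶ I) (x : J ⟶ X), A.le (apply x (u ≫ f)) (apply x (u ≫ g)) := by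
  refine ⟨fun h J u x => ?_, fun h => hom_ext fun J u x => ?_⟩
  · unfold le at h ⊢
    rw [← apply_inf, ← (functionLattice X A).comp_inf, h]
  · rw [(functionLattice X A).comp_inf, apply_inf, h]

lemma isJoin_ofFun {f : J ⟶ I} {a : J ⟶ (functionLattice X A).obj} {s : X ⊗ I ⟶ A.obj}
    (h : A.IsJoin (X ◁ f) (toFun a) s) : (functionLattice X A).IsJoin f a (ofFun s) := by
  intro K u b
  simp only [le_iff_apply]
  constructor
  · intro hb T p q hpq S v x
    have hv := hb (v ≫ p) x
    rw [Category.assoc, ← Category.assoc p, ← Category.assoc, apply_comp_ofFun, h] at hv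
    have hvq := hv (𝟙 S) (lift x (v ≫ q)) (by simp [hpq])
    rwa [← apply_comp, Category.id_comp, Category.assoc, Category.assoc] at hvq
  · intro hb T v x
    rw [← Category.assoc, apply_comp_ofFun, h]
    intro S p q hpq
    have hq := hb (p ≫ v) (q ≫ snd X J) (by simpa using congrArg (· ≫ snd X I) hpq) (𝟙 S) (p ≫ x)
    have hx : p ≫ x = q ≫ fst X J := by simpa using congrArg (· ≫ fst X I) hpq
    rw [comp_apply, toFun_eq_apply, comp_apply]
    simpa [hx] using hq

lemma apply_comp_comp_ofFun_snd (x : J ⟶ X) (u : J ⟶ I) (a : I ⟶ A.obj) :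
    apply x (u ≫ a ≫ ofFun (snd X A.obj)) = u ≫ a := by
  rw [← Category.assoc, apply_comp_ofFun, lift_snd]

variable (X A) in
/-- The homomorphism `A ⟶ A ^ X` that gives the constant functions. -/
noncomputable def constHom : Hom A (functionLattice X A) where
  map := ofFun (snd X A.obj)
  top_map I := hom_ext fun J u x => by
    rw [apply_comp_comp_ofFun_snd, comp_top, comp_top, apply_top]
  bot_map I := hom_ext fun J u x => by
    rw [apply_comp_comp_ofFun_snd, comp_bot, comp_bot, apply_bot]
  inf_map a b := hom_ext fun J u x => by
    rw [comp_inf, apply_inf, apply_comp_comp_ofFun_snd, apply_comp_comp_ofFun_snd,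
      apply_comp_comp_ofFun_snd, comp_inf]
  sup_map a b := hom_ext fun J u x => by
    rw [comp_sup, apply_sup, apply_comp_comp_ofFun_snd, apply_comp_comp_ofFun_snd,
      apply_comp_comp_ofFun_snd, comp_sup]

lemma apply_const (x : I ⟶ X) (a : I ⟶ A.obj) : apply x (a ≫ (constHom X A).map) = a :=
  (apply_comp_ofFun _ _ _).trans (lift_snd _ _)

lemma isJoin_const {f : J ⟶ I} {a : J ⟶ A.obj} {s : I ⟶ A.obj} (h : A.IsJoin f a s) :
    (functionLattice X A).IsJoin f (a ≫ (constHom X A).map) (s ≫ (constHom X A).map) := by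
  have hfun : ∀ {K : E} (b : K ⟶ A.obj), toFun (b ≫ (constHom X A).map) = snd X K ≫ b :=
    fun b => by rw [toFun_eq_apply, ← Category.assoc, apply_const]
  have hs : s ≫ (constHom X A).map = ofFun (snd X I ≫ s) :=
    uncurry_injective ((hfun s).trans (toFun_ofFun _).symm)
  rw [hs]
  exact isJoin_ofFun ((h.of_isPullback (isPullback_whiskerLeft_snd X f)).congr (hfun a).symm rfl)

end functionLattice

open functionLattice

lemma functionLattice_isFrame (X : E) {A : InternalLattice E} (hA : A.IsFrame) :
    (functionLattice X A).IsFrame where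
  exists_join f a := by
    obtain ⟨s, hs⟩ := hA.exists_join (X ◁ f) (toFun a)
    exact ⟨_, isJoin_ofFun hs⟩
  inf_join {I J} f a s c h := by
    obtain ⟨t, ht⟩ := hA.exists_join (X ◁ f) (toFun a)
    have hfun : toFun ((functionLattice X A).inf (f ≫ c) a) =
        A.inf (X ◁ f ≫ toFun c) (toFun a) := by
      have hsnd : X ◁ f = lift (fst X J) (snd X J ≫ f) := by ext1 <;> simp
      rw [toFun_eq_apply, (functionLattice X A).comp_inf, apply_inf, ← Category.assoc, apply_comp,
        ← hsnd, ← toFun_eq_apply]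
    have hst : (functionLattice X A).inf c s = ofFun (A.inf (toFun c) t) := by
      rw [h.unique (isJoin_ofFun ht)]
      exact congrArg (fun g => ofFun (A.inf (toFun c) g)) (toFun_ofFun t)
    rw [hst]
    exact isJoin_ofFun ((hA.inf_join _ _ _ (toFun c) ht).congr hfun.symm rfl)

lemma functionLattice.apply_comp_le_iff_of_isJoin {X : E} {A : InternalLattice E} (hA : A.IsFrame)
    {I J K : E} {f : J ⟶ I} {a : J ⟶ (functionLattice X A).obj} {s : I ⟶ (functionLattice X A).obj}
    (h : (functionLattice X A).IsJoin f a s) (x : K ⟶ X) (u : K ⟶ I) (b : K ⟶ A.obj) :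
    A.le (apply x (u ≫ s)) b ↔ ∀ ⦃T : E⦄ (p : T ⟶ K) (q : T ⟶ J), p ≫ u = q ≫ f →
      A.le (apply (p ≫ x) (q ≫ a)) (p ≫ b) := by
  obtain ⟨t, ht⟩ := hA.exists_join (X ◁ f) (toFun a)
  rw [h.unique (isJoin_ofFun ht), apply_comp_ofFun, ht]
  refine ⟨fun hb T p q hpq => ?_, fun hb T p q hpq => ?_⟩
  · rw [apply_comp]
    exact hb p (lift (p ≫ x) q) (by simp [comp_lift, hpq])
  · have hx : p ≫ x = q ≫ fst X J := by simpa using congrArg (· ≫ fst X I) hpq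
    have hu : p ≫ u = (q ≫ snd X J) ≫ f := by simpa using congrArg (· ≫ snd X I) hpq
    have hb' := hb p _ hu
    rwa [apply_comp, hx, ← comp_lift, lift_fst_snd, Category.comp_id] at hb'

end Functions

section ProductWithDiscrete

open InternalLattice functionLattice

variable {E : Type u} [Category.{v} E] [CartesianMonoidalCategory E] [MonoidalClosed E]

/-- The product of a space `W` with the discrete space on `X`: its opens are the families of opens
of `W` indexed by `X`. -/
noncomputable def prodDiscrete (W : LocalicSpace E) (X : E) : LocalicSpace E :=
  ⟨functionLattice X W.opens, functionLattice_isFrame X W.isFrame⟩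

lemma bot_eq_top_of_isTrivial_prodDiscrete {W : LocalicSpace E} {X : E}
    (h : (prodDiscrete W X).IsTrivial) : W.opens.bot X = W.opens.top X := by
  rw [← apply_bot (𝟙 X), ← apply_top (𝟙 X)]
  exact congrArg _ (h X)

variable (W : LocalicSpace E) (X : E)

/-- The projection of `W × X` to `W`; its inverse image gives the constant families. -/
noncomputable def prodDiscreteFst : prodDiscrete W X ⟶ W where
  inv := constHom X W.opens
  map_join _ _ _ h := isJoin_const h

variable [HasFiniteLimits E] [HasSubobjectClassifier E]

variable {X} in
lemma apply_comp_comp_ofFun_memOpen {I J : E} (x : J ⟶ X) (u : J ⟶ I)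
    (a : I ⟶ (discrete X).opens.obj) :
    apply x (u ≫ a ≫ ofFun (memOpen W X)) = lift x (u ≫ a) ≫ memOpen W X := by
  rw [← Category.assoc, apply_comp_ofFun]

lemma top_comp_ofFun_memOpen (I : E) :
    (discrete X).opens.top I ≫ ofFun (memOpen W X) = (functionLattice X W.opens).top I :=
  hom_ext fun J u x => by
    rw [apply_comp_comp_ofFun_memOpen, comp_top, comp_top, apply_top, memOpen_eq_top W (mem_top x)]

variable {X} in
lemma inf_comp_ofFun_memOpen {I : E} (a b : I ⟶ (discrete X).opens.obj) :
    (discrete X).opens.inf a b ≫ ofFun (memOpen W X) =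
      (functionLattice X W.opens).inf (a ≫ ofFun (memOpen W X)) (b ≫ ofFun (memOpen W X)) :=
  hom_ext fun J u x => by
    rw [comp_inf, apply_inf, apply_comp_comp_ofFun_memOpen, apply_comp_comp_ofFun_memOpen,
      apply_comp_comp_ofFun_memOpen, comp_inf]
    refine eq_of_forall_ge_iff fun c => ?_
    simp only [memOpen_le_iff, memOpen_inf_le_iff, comp_inf, mem_inf, comp_lift_assoc]
    refine ⟨fun h T v hva S w hwb => ?_, fun h T v hv => ?_⟩
    · simpa using h (w ≫ v) ⟨by simpa using hva.comp w, by simpa using hwb⟩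
    · simpa using h v hv.1 (𝟙 T) (by simpa using hv.2)

variable {X} in
lemma exists_comp_ofFun_memOpen_le_iff {I : E} (b : I ⟶ (functionLattice X W.opens).obj) :
    ∃ r : I ⟶ (discrete X).opens.obj, ∀ ⦃K : E⦄ (u : K ⟶ I) (a : K ⟶ (discrete X).opens.obj),
      (functionLattice X W.opens).le (a ≫ ofFun (memOpen W X)) (u ≫ b) ↔
        (discrete X).opens.le a (u ≫ r) := by
  obtain ⟨r, hr⟩ := exists_mem_iff (toFun b) (W.opens.top (X ⊗ I))
  refine ⟨r, fun K u a => ?_⟩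
  have hr' : ∀ ⦃T : E⦄ (v : T ⟶ K) (x : T ⟶ X),
      Mem x (v ≫ u ≫ r) ↔ apply x (v ≫ u ≫ b) = W.opens.top T := fun T v x => by
    rw [← Category.assoc, hr, comp_top, ← apply_comp, Category.assoc]
  simp only [le_iff_apply, discrete_le_iff, apply_comp_comp_ofFun_memOpen, memOpen_le_iff, hr']
  refine ⟨fun h T v x hx => ?_, fun h S v x T w hx => ?_⟩
  · simpa using h v x (𝟙 T) (by simpa using hx)
  · rw [functionLattice.comp_apply, ← Category.assoc, h (w ≫ v) (w ≫ x) (by simpa using hx)]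

/-- The projection of `W × X` to the discrete space on `X`; its inverse image takes a subset `a` to
the family of the truth values of `x ∈ a`. -/
noncomputable def prodDiscreteSnd : prodDiscrete W X ⟶ discrete X :=
  LocalicSpace.Map.ofAdjoint (ofFun (memOpen W X)) (top_comp_ofFun_memOpen W X)
    (inf_comp_ofFun_memOpen W) (exists_comp_ofFun_memOpen_le_iff W)

end ProductWithDiscrete

end PointFree

namespace PointFree

section Support

open InternalLattice LocalicSpace

variable {E : Type u} [Category.{v} E] [CartesianMonoidalCategory E]

/-- The subobject `φ` of `1` is the image of `X` in `1`: the least one that receives a morphism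
from `X`. -/
structure IsSupport (X φ : E) [Mono (toUnit φ)] : Prop where
  nonempty_hom : Nonempty (X ⟶ φ)
  nonempty_hom_of_hom : ∀ (ψ : E) [Mono (toUnit ψ)], (X ⟶ ψ) → Nonempty (φ ⟶ ψ)

lemma isSupport_self (φ : E) [Mono (toUnit φ)] : IsSupport φ φ := ⟨⟨𝟙 φ⟩, fun _ _ f => ⟨f⟩⟩

section Equalizer

variable [HasEqualizers E]

lemma bot_eq_top_iff_nonempty (A : InternalLattice E) (I : E) :
    A.bot I = A.top I ↔ Nonempty (I ⟶ equalizer (A.bot (𝟙_ E)) (A.top (𝟙_ E))) := by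
  constructor
  · intro h
    exact ⟨equalizer.lift (toUnit I) (by rw [A.comp_bot, A.comp_top, h])⟩
  · rintro ⟨w⟩
    rw [← A.comp_bot (w ≫ equalizer.ι _ _), Category.assoc, equalizer.condition,
      ← Category.assoc, A.comp_top]

instance {A : E} (f g : 𝟙_ E ⟶ A) : Mono (toUnit (equalizer f g)) := by
  rw [toUnit_unique (toUnit _) (equalizer.ι f g)]
  infer_instance

lemma IsSupport.bot_eq_top_iff {X φ : E} [Mono (toUnit φ)] (h : IsSupport X φ)
    (A : InternalLattice E) : A.bot X = A.top X ↔ A.bot φ = A.top φ := by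
  rw [bot_eq_top_iff_nonempty, bot_eq_top_iff_nonempty]
  exact ⟨fun ⟨f⟩ => h.nonempty_hom_of_hom _ f, fun ⟨f⟩ => h.nonempty_hom.map (· ≫ f)⟩

end Equalizer

variable [HasFiniteLimits E] [HasSubobjectClassifier E] [MonoidalClosed E]

lemma isSupport_support (X : E) : IsSupport X (support X) where
  nonempty_hom := ⟨factorThruImage (toUnit X)⟩
  nonempty_hom_of_hom ψ _ f :=
    ⟨image.lift { I := ψ, m := toUnit ψ, e := f, fac := toUnit_unique _ _ }⟩

variable {X φ : E} [Mono (toUnit φ)]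

theorem isExponential_discrete (h : IsSupport X φ) :
    IsExponential (discrete X) (emptySpace E) (closedOfTruth φ).space := by
  rw [isExponential_emptySpace_iff]
  refine ⟨fun T k l => isTrivial_of_bot_eq_top ?_, fun W hW => ?_⟩
  · have hbot := (nonempty_hom_closedOfTruth_iff φ T).1 ⟨k⟩
    rw [imageOpen_toUnit_eq_bot_iff, ← h.bot_eq_top_iff, ← imageOpen_toUnit_eq_bot_iff] at hbot
    rw [← hbot, ← imageOpen_map _ l, imageOpen_discrete_toUnit, l.inv.top_map]
  · have hW' := bot_eq_top_of_isTrivial_prodDiscrete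
      (hW _ (prodDiscreteFst W X) (prodDiscreteSnd W X))
    rw [h.bot_eq_top_iff, ← imageOpen_toUnit_eq_bot_iff, ← nonempty_hom_closedOfTruth_iff] at hW'
    obtain ⟨k⟩ := hW'
    exact ⟨k, trivial, fun _ _ => Subsingleton.elim _ _⟩

variable (φ) in
theorem isExponential_closedOfTruth :
    IsExponential (closedOfTruth φ).space (emptySpace E) (discrete φ) := by
  rw [isExponential_emptySpace_iff]
  refine ⟨fun T k l => isTrivial_of_bot_eq_top ?_, fun W hW => ?_⟩
  · rw [← (nonempty_hom_closedOfTruth_iff φ T).1 ⟨l⟩, (nonempty_hom_discrete_iff φ T).1 ⟨k⟩]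
  · let C := closedSubspace W (imageOpen W (toUnit φ))
    have hC : imageOpen C.space (toUnit φ) = C.space.opens.bot (𝟙_ E) := by
      rw [← imageOpen_map _ C.incl]
      exact (exists_comp_closedSubspace_incl_iff _ C.incl).1 ⟨𝟙 _, Category.id_comp _⟩
    obtain ⟨l⟩ := (nonempty_hom_closedOfTruth_iff φ C.space).2 hC
    obtain ⟨k⟩ := (nonempty_hom_discrete_iff φ W).2
      ((isTrivial_closedSubspace_iff W _).1 (hW C.space C.incl l))
    exact ⟨k, trivial, fun _ _ => Subsingleton.elim _ _⟩

theorem nonempty_iso_discrete_of_isExponential {N M : LocalicSpace E}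
    (hN : IsExponential (discrete φ) (emptySpace E) N)
    (hM : IsExponential N (emptySpace E) M) : Nonempty (M ≅ discrete φ) := by
  obtain ⟨i⟩ := hN.nonempty_iso (isExponential_discrete (isSupport_self φ))
  exact (hM.congr i.hom i.inv).nonempty_iso (isExponential_closedOfTruth φ)

end Support

end PointFree

namespace PointFree

section Sublattices

variable {E : Type u} [Category.{v} E]

/-- A subobject `ι` of an internal lattice is closed under the lattice operations. -/
structure IsSublattice (A : InternalLattice E) {S : E} (ι : S ⟶ A.obj) : Prop where
  top : ∀ I, ∃ w : I ⟶ S, w ≫ ι = A.top I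
  bot : ∀ I, ∃ w : I ⟶ S, w ≫ ι = A.bot I
  inf : ∀ {I} (a b : I ⟶ S), ∃ w : I ⟶ S, w ≫ ι = A.inf (a ≫ ι) (b ≫ ι)
  sup : ∀ {I} (a b : I ⟶ S), ∃ w : I ⟶ S, w ≫ ι = A.sup (a ≫ ι) (b ≫ ι)

/-- The internal lattice on a subobject that is closed under the lattice operations. -/
noncomputable abbrev sublattice (A : InternalLattice E) {S : E} (ι : S ⟶ A.obj) [Mono ι]
    (h : IsSublattice A ι) : InternalLattice E :=
  have et := fun I => (h.top I).choose_spec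
  have eb := fun I => (h.bot I).choose_spec
  have ei := fun {I} (a b : I ⟶ S) => (h.inf a b).choose_spec
  have es := fun {I} (a b : I ⟶ S) => (h.sup a b).choose_spec
  { obj := S
    top := fun I => (h.top I).choose
    bot := fun I => (h.bot I).choose
    inf := fun a b => (h.inf a b).choose
    sup := fun a b => (h.sup a b).choose
    comp_top := fun u => by rw [← cancel_mono ι, Category.assoc, et, et, A.comp_top]
    comp_bot := fun u => by rw [← cancel_mono ι, Category.assoc, eb, eb, A.comp_bot]
    comp_inf := fun u a b => by
      rw [← cancel_mono ι, Category.assoc, ei, ei, A.comp_inf, Category.assoc, Category.assoc]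
    comp_sup := fun u a b => by
      rw [← cancel_mono ι, Category.assoc, es, es, A.comp_sup, Category.assoc, Category.assoc]
    inf_comm := fun a b => by rw [← cancel_mono ι, ei, ei, A.inf_comm]
    sup_comm := fun a b => by rw [← cancel_mono ι, es, es, A.sup_comm]
    inf_assoc := fun a b c => by rw [← cancel_mono ι, ei, ei, ei, ei, A.inf_assoc]
    sup_assoc := fun a b c => by rw [← cancel_mono ι, es, es, es, es, A.sup_assoc]
    inf_sup_self := fun a b => by rw [← cancel_mono ι, ei, es, A.inf_sup_self]
    sup_inf_self := fun a b => by rw [← cancel_mono ι, es, ei, A.sup_inf_self]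
    inf_sup_left := fun a b c => by rw [← cancel_mono ι, ei, es, es, ei, ei, A.inf_sup_left]
    inf_top := fun a => by rw [← cancel_mono ι, ei, et, A.inf_top]
    sup_bot := fun a => by rw [← cancel_mono ι, es, eb, A.sup_bot] }

/-- The inclusion of a sublattice, as a homomorphism. -/
noncomputable def sublatticeHom (A : InternalLattice E) {S : E} (ι : S ⟶ A.obj) [Mono ι]
    (h : IsSublattice A ι) : InternalLattice.Hom (sublattice A ι h) A where
  map := ι
  top_map I := (h.top I).choose_spec
  bot_map I := (h.bot I).choose_spec
  inf_map a b := (h.inf a b).choose_spec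
  sup_map a b := (h.sup a b).choose_spec

variable {A : InternalLattice E} {S : E} {ι : S ⟶ A.obj} [Mono ι] {h : IsSublattice A ι}

lemma sublattice_inf_ι {I : E} (a b : I ⟶ (sublattice A ι h).obj) :
    (sublattice A ι h).inf a b ≫ ι = A.inf (a ≫ ι) (b ≫ ι) :=
  (h.inf a b).choose_spec

lemma sublattice_le_iff {I : E} (a b : I ⟶ (sublattice A ι h).obj) :
    (sublattice A ι h).le a b ↔ A.le (a ≫ ι) (b ≫ ι) := by
  unfold InternalLattice.le
  rw [← cancel_mono ι, sublattice_inf_ι]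

lemma sublattice_isJoin {I J : E} {f : J ⟶ I} {a : J ⟶ (sublattice A ι h).obj}
    {s : I ⟶ (sublattice A ι h).obj} (hs : A.IsJoin f (a ≫ ι) (s ≫ ι)) :
    (sublattice A ι h).IsJoin f a s := by
  intro K u b
  rw [sublattice_le_iff, Category.assoc, hs]
  simp only [sublattice_le_iff, Category.assoc]

lemma sublattice_isFrame (hA : A.IsFrame)
    (hjoin : ∀ {I J : E} (f : J ⟶ I) (a : J ⟶ S) (s : I ⟶ A.obj), A.IsJoin f (a ≫ ι) s →
      ∃ w : I ⟶ S, w ≫ ι = s) : (sublattice A ι h).IsFrame := by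
  have hlift : ∀ {I J : E} (f : J ⟶ I) (a : J ⟶ S), ∃ w : I ⟶ S, A.IsJoin f (a ≫ ι) (w ≫ ι) :=
    fun f a => by
      obtain ⟨s, hs⟩ := hA.exists_join f (a ≫ ι)
      obtain ⟨w, rfl⟩ := hjoin f a s hs
      exact ⟨w, hs⟩
  refine ⟨fun f a => ?_, fun f a s c hs => ?_⟩
  · obtain ⟨w, hw⟩ := hlift f a
    exact ⟨w, sublattice_isJoin hw⟩
  · obtain ⟨w, hw⟩ := hlift f a
    rw [hs.unique (sublattice_isJoin hw)]
    refine sublattice_isJoin ?_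
    rw [sublattice_inf_ι, sublattice_inf_ι, Category.assoc]
    exact hA.inf_join f _ _ _ hw

end Sublattices

section Cases

open HasSubobjectClassifier

variable {E : Type u} [Category.{v} E] [CartesianMonoidalCategory E] [HasFiniteLimits E]
  [HasSubobjectClassifier E]

lemma eqv_eq_tr_iff {X I : E} (x y : I ⟶ X) : eqv x y = tr I ↔ x = y := by
  simpa only [Category.id_comp] using comp_eqv x y (𝟙 I)

lemma comp_eqv_eq_eqv_comp {X I J : E} (u : J ⟶ I) (x y : I ⟶ X) :
    u ≫ eqv x y = eqv (u ≫ x) (u ≫ y) :=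
  truth_ext fun K v => by
    rw [← Category.assoc, comp_eqv, comp_eqv, Category.assoc, Category.assoc]

variable [MonoidalClosed E]

/-- The generalized element `z` is covered by the two cases `z = x` and `z = y`: the disjunction
`z = x ∨ z = y` holds in the internal logic. -/
def IsOneOf {X I : E} (x y z : I ⟶ X) : Prop := tOr (eqv z x) (eqv z y) = tr I

variable {X I J : E} {x y z : I ⟶ X}

lemma isOneOf_comp_iff (u : J ⟶ I) :
    IsOneOf (u ≫ x) (u ≫ y) (u ≫ z) ↔ u ≫ tOr (eqv z x) (eqv z y) = tr J := by
  rw [comp_tOr, comp_eqv_eq_eqv_comp, comp_eqv_eq_eqv_comp, IsOneOf]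

lemma IsOneOf.comp (h : IsOneOf x y z) (u : J ⟶ I) : IsOneOf (u ≫ x) (u ≫ y) (u ≫ z) := by
  rw [isOneOf_comp_iff, h, comp_tr]

variable (x y) in
lemma isOneOf_left : IsOneOf x y x := by
  have h := ((tOr_le_iff (eqv x x) (eqv x y) _).1 fun _ _ h => h).1 (𝟙 I)
  rw [Category.id_comp, Category.id_comp] at h
  exact h ((eqv_eq_tr_iff _ _).2 rfl)

variable (x y) in
lemma isOneOf_right : IsOneOf x y y := by
  have h := ((tOr_le_iff (eqv y x) (eqv y y) _).1 fun _ _ h => h).2 (𝟙 I)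
  rw [Category.id_comp, Category.id_comp] at h
  exact h ((eqv_eq_tr_iff _ _).2 rfl)

lemma IsOneOf.eq_tr (h : IsOneOf x y z) {t : I ⟶ Ω E}
    (hx : ∀ ⦃T : E⦄ (u : T ⟶ I), u ≫ z = u ≫ x → u ≫ t = tr T)
    (hy : ∀ ⦃T : E⦄ (u : T ⟶ I), u ≫ z = u ≫ y → u ≫ t = tr T) : t = tr I := by
  have hle := (tOr_le_iff (eqv z x) (eqv z y) t).2
    ⟨fun T u hu => hx u ((comp_eqv _ _ _).1 hu), fun T u hu => hy u ((comp_eqv _ _ _).1 hu)⟩ (𝟙 I)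
  rw [Category.id_comp, Category.id_comp] at hle
  exact hle h

lemma IsOneOf.hom_ext (h : IsOneOf x y z) {Y : E} {f g : I ⟶ Y}
    (hx : ∀ ⦃T : E⦄ (u : T ⟶ I), u ≫ z = u ≫ x → u ≫ f = u ≫ g)
    (hy : ∀ ⦃T : E⦄ (u : T ⟶ I), u ≫ z = u ≫ y → u ≫ f = u ≫ g) : f = g :=
  (eqv_eq_tr_iff _ _).1 <| h.eq_tr (fun _ u hu => (comp_eqv _ _ _).2 (hx u hu))
    fun _ u hu => (comp_eqv _ _ _).2 (hy u hu)

lemma IsOneOf.of_cases (h : IsOneOf x y z) {Y : E} {x' y' z' : I ⟶ Y}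
    (hx : ∀ ⦃T : E⦄ (u : T ⟶ I), u ≫ z = u ≫ x → IsOneOf (u ≫ x') (u ≫ y') (u ≫ z'))
    (hy : ∀ ⦃T : E⦄ (u : T ⟶ I), u ≫ z = u ≫ y → IsOneOf (u ≫ x') (u ≫ y') (u ≫ z')) :
    IsOneOf x' y' z' :=
  h.eq_tr (fun _ u hu => (isOneOf_comp_iff u).1 (hx u hu))
    fun _ u hu => (isOneOf_comp_iff u).1 (hy u hu)

lemma IsOneOf.comp_eq_comp {z' : I ⟶ X} (hz : IsOneOf x y z) (hz' : IsOneOf x y z') {Y Z : E}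
    {f : X ⟶ Y} {g : X ⟶ Z} (hxy : ∀ ⦃T : E⦄ (u : T ⟶ I),
      (u ≫ x) ≫ f = (u ≫ y) ≫ f → (u ≫ x) ≫ g = (u ≫ y) ≫ g) (h : z ≫ f = z' ≫ f) :
    z ≫ g = z' ≫ g := by
  have hcomp : ∀ ⦃T : E⦄ (u : T ⟶ I), (u ≫ z) ≫ f = (u ≫ z') ≫ f := fun T u => by
    rw [Category.assoc, h, Category.assoc]
  refine hz.hom_ext (fun T u hu => ?_) fun T u hu => ?_ <;>
    refine (hz'.comp u).hom_ext (fun S v hv => ?_) fun S v hv => ?_ <;>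
    have huv := congrArg (v ≫ ·) hu <;>
    have hf := hcomp (v ≫ u) <;>
    simp only [← Category.assoc] at huv hv hf ⊢ <;>
    rw [huv, hv] at hf ⊢
  · exact hxy (v ≫ u) hf
  · exact (hxy (v ≫ u) hf.symm).symm

lemma exists_mono_isOneOf_iff (x y : 𝟙_ E ⟶ X) : ∃ (S : E) (ι : S ⟶ X), Mono ι ∧
    ∀ ⦃I : E⦄ (z : I ⟶ X), IsOneOf (constAt x I) (constAt y I) z ↔ ∃ w : I ⟶ S, w ≫ ι = z := by
  obtain ⟨S, ι, hι, hS⟩ : ∃ (S : E) (ι : S ⟶ X), Mono ι ∧ ∀ ⦃I : E⦄ (z : I ⟶ X),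
      z ≫ tOr (eqv (𝟙 X) (constAt x X)) (eqv (𝟙 X) (constAt y X)) = tr I ↔
        ∃ w : I ⟶ S, w ≫ ι = z := exists_extent _
  refine ⟨S, ι, hι, fun I z => ?_⟩
  rw [← hS, ← isOneOf_comp_iff, comp_constAt, comp_constAt, Category.comp_id]

end Cases

section QuotientOfTwo

open InternalLattice

variable {E : Type u} [Category.{v} E] [CartesianMonoidalCategory E]

section

variable (A : InternalLattice E) (I : E)

lemma constAt_bot : constAt (A.bot (𝟙_ E)) I = A.bot I := A.comp_bot _

lemma constAt_top : constAt (A.top (𝟙_ E)) I = A.top I := A.comp_top _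

end

lemma IsQuotientOfTwo.isIso_of_mono [Balanced E] {φ : E} {B : InternalLattice E}
    (hB : IsQuotientOfTwo φ B) {P : E} (m : P ⟶ B.obj) [Mono m]
    (h0 : ∃ w, w ≫ m = B.bot (𝟙_ E)) (h1 : ∃ w, w ≫ m = B.top (𝟙_ E)) : IsIso m := by
  obtain ⟨w0, h0⟩ := h0
  obtain ⟨w1, h1⟩ := h1
  have : Epi m := ⟨fun g k hgk => hB.jointly_epi g k
    (by rw [← h0, Category.assoc, hgk, Category.assoc])
    (by rw [← h1, Category.assoc, hgk, Category.assoc])⟩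
  exact isIso_of_mono_of_epi m

variable [HasFiniteLimits E] [HasSubobjectClassifier E] [MonoidalClosed E]

section Bits

variable {A : InternalLattice E} {I : E} {a b : I ⟶ A.obj}

lemma isOneOf_bot_top_inf (ha : IsOneOf (A.bot I) (A.top I) a)
    (hb : IsOneOf (A.bot I) (A.top I) b) : IsOneOf (A.bot I) (A.top I) (A.inf a b) := by
  refine ha.of_cases (fun T u hu => ?_) fun T u hu => ?_
  · rw [A.comp_inf, hu, A.comp_bot, bot_inf]
    exact isOneOf_left _ _
  · rw [A.comp_inf, hu, A.comp_top, top_inf, ← A.comp_top u]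
    exact hb.comp u

lemma isOneOf_bot_top_sup (ha : IsOneOf (A.bot I) (A.top I) a)
    (hb : IsOneOf (A.bot I) (A.top I) b) : IsOneOf (A.bot I) (A.top I) (A.sup a b) := by
  refine ha.of_cases (fun T u hu => ?_) fun T u hu => ?_
  · rw [A.comp_sup, hu, A.comp_bot, bot_sup, ← A.comp_bot u]
    exact hb.comp u
  · rw [A.comp_sup, hu, A.comp_top, top_sup]
    exact isOneOf_right _ _

end Bits

lemma isQuotientOfTwo_of_mono {φ : E} {A B : InternalLattice E} (i : Hom B A) [Mono i.map]
    (hbit : ∀ ⦃I : E⦄ (b : I ⟶ B.obj), IsOneOf (A.bot I) (A.top I) (b ≫ i.map))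
    (hA : ∀ I : E, A.bot I = A.top I ↔ Nonempty (I ⟶ φ)) : IsQuotientOfTwo φ B where
  jointly_epi {Z} g k h0 h1 := by
    refine (hbit (𝟙 B.obj)).hom_ext (fun T u hu => ?_) fun T u hu => ?_ <;>
      rw [Category.id_comp] at hu
    · have hbot : u = constAt (B.bot (𝟙_ E)) T := by
        rw [← cancel_mono i.map, hu, constAt_bot, i.bot_map, A.comp_bot]
      rw [hbot, Category.assoc, Category.assoc, h0]
    · have htop : u = constAt (B.top (𝟙_ E)) T := by
        rw [← cancel_mono i.map, hu, constAt_top, i.top_map, A.comp_top]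
      rw [htop, Category.assoc, Category.assoc, h1]
  bot_eq_top_iff I := by rw [← hA, ← i.bot_map, ← i.top_map, cancel_mono]

lemma exists_isQuotientOfTwo {φ : E} {A : InternalLattice E}
    (hA : ∀ I : E, A.bot I = A.top I ↔ Nonempty (I ⟶ φ)) :
    ∃ B : InternalLattice E, IsQuotientOfTwo φ B ∧ Nonempty (Hom B A) := by
  obtain ⟨S, ι, hι, hS⟩ := exists_mono_isOneOf_iff (A.bot (𝟙_ E)) (A.top (𝟙_ E))
  simp only [constAt_bot, constAt_top] at hS
  have hbit : ∀ ⦃I : E⦄ (w : I ⟶ S), IsOneOf (A.bot I) (A.top I) (w ≫ ι) :=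
    fun _ w => (hS _).2 ⟨w, rfl⟩
  let i := sublatticeHom A ι ⟨fun I => (hS _).1 (isOneOf_right _ _),
    fun I => (hS _).1 (isOneOf_left _ _),
    fun a b => (hS _).1 (isOneOf_bot_top_inf (hbit a) (hbit b)),
    fun a b => (hS _).1 (isOneOf_bot_top_sup (hbit a) (hbit b))⟩
  have : Mono i.map := hι
  exact ⟨_, isQuotientOfTwo_of_mono i hbit hA, ⟨i⟩⟩

namespace IsQuotientOfTwo

variable {φ : E} {B : InternalLattice E} (hB : IsQuotientOfTwo φ B)

include hB

lemma isOneOf {I : E} (b : I ⟶ B.obj) : IsOneOf (B.bot I) (B.top I) b := by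
  have hgen : IsOneOf (B.bot B.obj) (B.top B.obj) (𝟙 B.obj) := by
    refine hB.jointly_epi _ _ ?_ ?_ <;>
      rw [comp_tr, ← isOneOf_comp_iff, Category.comp_id, B.comp_bot, B.comp_top]
    · exact isOneOf_left _ _
    · exact isOneOf_right _ _
  simpa only [B.comp_bot, B.comp_top, Category.comp_id] using hgen.comp b

lemma exists_map {C : E} (x y : 𝟙_ E ⟶ C) (hxy : constAt x φ = constAt y φ) :
    ∃ h : B.obj ⟶ C, ∀ I, B.bot I ≫ h = constAt x I ∧ B.top I ≫ h = constAt y I := by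
  -- The graph of `h` consists of the pairs that are `(0, x)` or `(1, y)`.
  obtain ⟨R, ρ, hρ, hR⟩ :=
    exists_mono_isOneOf_iff (lift (B.bot (𝟙_ E)) x) (lift (B.top (𝟙_ E)) y)
  simp only [constAt, comp_lift, B.comp_bot, B.comp_top] at hR
  change ∀ ⦃I : E⦄ _, IsOneOf (lift (B.bot I) (constAt x I)) (lift (B.top I) (constAt y I)) _ ↔ _
    at hR
  have hsingle : ∀ ⦃T I : E⦄ (u : T ⟶ I),
      (u ≫ lift (B.bot I) (constAt x I)) ≫ fst _ _ = (u ≫ lift (B.top I) (constAt y I)) ≫ fst _ _ →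
      (u ≫ lift (B.bot I) (constAt x I)) ≫ snd _ _ =
        (u ≫ lift (B.top I) (constAt y I)) ≫ snd _ _ := fun T I u hu => by
    simp only [comp_lift, lift_fst, lift_snd, B.comp_bot, B.comp_top, comp_constAt] at hu ⊢
    obtain ⟨w⟩ := (hB.bot_eq_top_iff T).1 hu
    rw [← comp_constAt x w, hxy, comp_constAt]
  have : Mono (ρ ≫ fst _ _) := ⟨fun w w' hw => by
    simp only [← Category.assoc] at hw
    rw [← cancel_mono ρ]
    exact CartesianMonoidalCategory.hom_ext _ _ hw <| ((hR _).2 ⟨w, rfl⟩).comp_eq_comp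
      ((hR _).2 ⟨w', rfl⟩) (fun T u => hsingle u) hw⟩
  have hpoint : ∀ {I : E} {b : I ⟶ B.obj} {c : I ⟶ C},
      IsOneOf (lift (B.bot I) (constAt x I)) (lift (B.top I) (constAt y I)) (lift b c) →
        ∃ w : I ⟶ R, w ≫ ρ ≫ fst _ _ = b ∧ w ≫ ρ ≫ snd _ _ = c := fun {I b c} hbc => by
    obtain ⟨w, hw⟩ := (hR _).1 hbc
    exact ⟨w, by rw [← Category.assoc, hw, lift_fst], by rw [← Category.assoc, hw, lift_snd]⟩
  have hbot := fun I => hpoint (isOneOf_left (lift (B.bot I) (constAt x I)) _)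
  have htop := fun I => hpoint (isOneOf_right _ (lift (B.top I) (constAt y I)))
  have := hB.isIso_of_mono (ρ ≫ fst _ _) ((hbot _).imp fun _ => And.left)
    ((htop _).imp fun _ => And.left)
  refine ⟨inv (ρ ≫ fst _ _) ≫ ρ ≫ snd _ _, fun I => ⟨?_, ?_⟩⟩
  · obtain ⟨w, h0, hx⟩ := hbot I
    rw [← h0, Category.assoc, IsIso.hom_inv_id_assoc, hx]
  · obtain ⟨w, h1, hy⟩ := htop I
    rw [← h1, Category.assoc, IsIso.hom_inv_id_assoc, hy]

lemma existsUnique_hom {C : InternalLattice E} (hC : C.bot φ = C.top φ) :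
    ∃! _h : Hom B C, True := by
  obtain ⟨h, hh⟩ := hB.exists_map (C.bot (𝟙_ E)) (C.top (𝟙_ E))
    (by rw [constAt_bot, constAt_top, hC])
  simp only [constAt_bot, constAt_top] at hh
  have hbot := fun I => (hh I).1
  have htop := fun I => (hh I).2
  refine ⟨⟨h, htop, hbot, fun {I} a b => ?_, fun {I} a b => ?_⟩, trivial, fun k _ => ?_⟩
  · refine (hB.isOneOf a).hom_ext (fun T u hu => ?_) fun T u hu => ?_ <;>
      simp only [C.comp_inf, ← Category.assoc] <;>
      simp only [B.comp_inf, hu, B.comp_bot, B.comp_top, bot_inf, top_inf, hbot, htop]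
  · refine (hB.isOneOf a).hom_ext (fun T u hu => ?_) fun T u hu => ?_ <;>
      simp only [C.comp_sup, ← Category.assoc] <;>
      simp only [B.comp_sup, hu, B.comp_bot, B.comp_top, bot_sup, top_sup, hbot, htop]
  · exact Hom.ext <| hB.jointly_epi _ _ ((k.bot_map _).trans (hbot _).symm)
      ((k.top_map _).trans (htop _).symm)

lemma isBoolean : B.IsBoolean := by
  obtain ⟨n, hn⟩ := hB.exists_map (B.top (𝟙_ E)) (B.bot (𝟙_ E))
    (by rw [constAt_bot, constAt_top, (hB.bot_eq_top_iff φ).2 ⟨𝟙 φ⟩])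
  simp only [constAt_bot, constAt_top] at hn
  refine fun {I} a => ⟨a ≫ n, ?_, ?_⟩
  · refine (hB.isOneOf a).hom_ext (fun T u hu => ?_) fun T u hu => ?_
    · rw [B.comp_inf, ← Category.assoc, hu, B.comp_bot, bot_inf]
    · rw [B.comp_inf, ← Category.assoc, hu, B.comp_top, (hn T).2, inf_bot, B.comp_bot]
  · refine (hB.isOneOf a).hom_ext (fun T u hu => ?_) fun T u hu => ?_
    · rw [B.comp_sup, ← Category.assoc, hu, B.comp_bot, (hn T).1, sup_top, B.comp_top]
    · rw [B.comp_sup, ← Category.assoc, hu, B.comp_top, top_sup]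

lemma isFreeOnRelations {X : E} [Mono (toUnit φ)] (h : IsSupport X φ) :
    IsFreeOnRelations X B where
  isBoolean := hB.isBoolean
  rel := le_of_bot_eq_top ((hB.bot_eq_top_iff X).2 h.nonempty_hom) _ _
  existsUnique_hom C _ hC := hB.existsUnique_hom <| (h.bot_eq_top_iff C).1 <|
    top_le_iff_eq.1 hC

lemma isSpec [Mono (toUnit φ)] (η : Hom B (closedOfTruth φ).space.opens) :
    IsSpec B (closedOfTruth φ).space := by
  refine ⟨η, fun W h => ?_⟩
  have hW : W.opens.bot φ = W.opens.top φ := by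
    rw [← h.bot_map, ← h.top_map, (hB.bot_eq_top_iff φ).2 ⟨𝟙 φ⟩]
  obtain ⟨g⟩ := (nonempty_hom_closedOfTruth_iff φ W).2 ((imageOpen_toUnit_eq_bot_iff W φ).2 hW)
  refine ⟨g, hB.jointly_epi _ _ ?_ ?_, fun _ _ => Subsingleton.elim _ _⟩
  · rw [← Category.assoc, η.bot_map, g.inv.bot_map, h.bot_map]
  · rw [← Category.assoc, η.top_map, g.inv.top_map, h.top_map]

end IsQuotientOfTwo

lemma closedOfTruth_bot_eq_top_iff (φ : E) [Mono (toUnit φ)] (I : E) :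
    (closedOfTruth φ).space.opens.bot I = (closedOfTruth φ).space.opens.top I ↔
      Nonempty (I ⟶ φ) := by
  rw [← (closedOfTruth φ).incl.inv.bot_map, ← (closedOfTruth φ).incl.inv.top_map]
  refine (closedSubspace_incl_eq_iff (point E) (openOf (toUnit φ)) _ _).trans ?_
  rw [bot_sup, top_sup, constAt, ← mem_iff_eq_top (toUnit I), mem_openOf]
  exact ⟨fun ⟨w, _⟩ => ⟨w⟩, fun ⟨w⟩ => ⟨w, toUnit_unique _ _⟩⟩

lemma exists_isFreeOnRelations {X φ : E} [Mono (toUnit φ)] (h : IsSupport X φ) :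
    ∃ B : InternalLattice E, IsFreeOnRelations X B ∧ IsQuotientOfTwo φ B ∧
      IsSpec B (closedOfTruth φ).space := by
  obtain ⟨B, hB, ⟨η⟩⟩ := exists_isQuotientOfTwo (closedOfTruth_bot_eq_top_iff φ)
  exact ⟨B, hB.isFreeOnRelations h, hB, hB.isSpec η⟩

end QuotientOfTwo

end PointFree

namespace PointFree

section Regular

open InternalLattice

variable {E : Type u} [Category.{v} E] [CartesianMonoidalCategory E] [HasFiniteLimits E]
  [HasSubobjectClassifier E] [MonoidalClosed E]

lemma exists_relNeg (L : LocalicSpace E) (d : 𝟙_ E ⟶ L.opens.obj) :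
    ∃ n : L.opens.obj ⟶ L.opens.obj, ∀ ⦃I : E⦄ (x y : I ⟶ L.opens.obj),
      L.opens.le x (y ≫ n) ↔ L.opens.le (L.opens.inf x y) (constAt d I) := by
  obtain ⟨n, hn⟩ := L.isFrame.exists_residual (𝟙 L.opens.obj) (𝟙 _) (constAt d _)
  refine ⟨n, fun I x y => (hn y x).trans ⟨fun h => ?_, fun h T p q hpq => ?_⟩⟩
  · simpa only [Category.id_comp, Category.comp_id, comp_constAt] using h (𝟙 I) y (by simp)
  · have hp := h.comp p
    rwa [L.opens.comp_inf, hpq, comp_constAt, ← comp_constAt d q] at hp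

variable (L : LocalicSpace E) (d : 𝟙_ E ⟶ L.opens.obj) {I J : E}

/-- The pseudocomplement of `x` relative to `d`: the largest open `y` with `y ⊓ x ≤ d`. -/
noncomputable def relNeg (x : I ⟶ L.opens.obj) : I ⟶ L.opens.obj :=
  x ≫ (exists_relNeg L d).choose

lemma comp_relNeg (u : J ⟶ I) (x : I ⟶ L.opens.obj) :
    u ≫ relNeg L d x = relNeg L d (u ≫ x) := (Category.assoc _ _ _).symm

section

variable {L d} {x y z : I ⟶ L.opens.obj}

lemma le_relNeg_iff : L.opens.le x (relNeg L d y) ↔ L.opens.le (L.opens.inf x y) (constAt d I) :=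
  (exists_relNeg L d).choose_spec x y

lemma le_relNeg_comm : L.opens.le x (relNeg L d y) ↔ L.opens.le y (relNeg L d x) := by
  rw [le_relNeg_iff, le_relNeg_iff, L.opens.inf_comm]

lemma le_relNeg_relNeg : L.opens.le x (relNeg L d (relNeg L d x)) :=
  le_relNeg_comm.1 (L.opens.le_refl _)

lemma relNeg_le_relNeg (h : L.opens.le x y) : L.opens.le (relNeg L d y) (relNeg L d x) :=
  le_relNeg_comm.1 (h.trans le_relNeg_relNeg)

variable (x) in
lemma relNeg_relNeg_relNeg : relNeg L d (relNeg L d (relNeg L d x)) = relNeg L d x :=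
  (relNeg_le_relNeg le_relNeg_relNeg).antisymm le_relNeg_relNeg

lemma relNeg_top : relNeg L d (L.opens.top I) = constAt d I := by
  refine le.antisymm ?_ (le_relNeg_iff.2 (by rw [L.opens.inf_top]; exact L.opens.le_refl _))
  have h := le_relNeg_iff.1 (L.opens.le_refl (relNeg L d (L.opens.top I)))
  rwa [L.opens.inf_top] at h

lemma relNeg_constAt : relNeg L d (constAt d I) = L.opens.top I := by
  rw [← top_le_iff_eq, le_relNeg_comm, relNeg_top]
  exact L.opens.le_refl _

lemma inf_relNeg_le : L.opens.le (L.opens.inf x (relNeg L d x)) (constAt d I) :=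
  le_relNeg_iff.1 le_relNeg_relNeg

lemma inf_le_relNeg_iff :
    L.opens.le (L.opens.inf x y) (relNeg L d z) ↔
      L.opens.le x (relNeg L d (L.opens.inf y z)) := by
  rw [le_relNeg_iff, le_relNeg_iff, L.opens.inf_assoc]

lemma inf_relNeg_inf_le :
    L.opens.le (L.opens.inf x (relNeg L d (L.opens.inf x y))) (relNeg L d y) := by
  rw [L.opens.inf_comm x, inf_le_relNeg_iff]
  exact L.opens.le_refl _

variable (x y) in
lemma relNeg_inf_relNeg_relNeg :
    relNeg L d (L.opens.inf x (relNeg L d (relNeg L d y))) = relNeg L d (L.opens.inf x y) := by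
  refine eq_of_forall_le_iff fun z => ?_
  rw [← inf_le_relNeg_iff, relNeg_relNeg_relNeg, inf_le_relNeg_iff]

variable (x y) in
lemma relNeg_relNeg_inf : relNeg L d (relNeg L d (L.opens.inf x y)) =
    L.opens.inf (relNeg L d (relNeg L d x)) (relNeg L d (relNeg L d y)) := by
  refine le.antisymm (le_meet_iff.2 ⟨?_, ?_⟩) ?_
  · exact relNeg_le_relNeg (relNeg_le_relNeg (meet_le_left _ _))
  · exact relNeg_le_relNeg (relNeg_le_relNeg (meet_le_right _ _))
  · rw [← relNeg_inf_relNeg_relNeg, L.opens.inf_comm x, ← relNeg_inf_relNeg_relNeg _ x,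
      L.opens.inf_comm]
    exact le_relNeg_relNeg

lemma inf_relNeg_inf_relNeg_relNeg (hx : relNeg L d (relNeg L d x) = x) :
    L.opens.inf x (relNeg L d (L.opens.inf (relNeg L d y) (relNeg L d z))) =
      relNeg L d (L.opens.inf (relNeg L d (L.opens.inf x y)) (relNeg L d (L.opens.inf x z))) := by
  refine le.antisymm ?_ (le_meet_iff.2 ⟨?_, ?_⟩)
  · set w := L.opens.inf x (relNeg L d (L.opens.inf (relNeg L d y) (relNeg L d z)))
    set n := L.opens.inf (relNeg L d (L.opens.inf x y)) (relNeg L d (L.opens.inf x z))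
    have hw := le_meet_iff.1 (L.opens.le_refl w)
    have hwn := le_meet_iff.1 (L.opens.le_refl (L.opens.inf w n))
    have hn := le_meet_iff.1 hwn.2
    have hy := (le_meet_iff.2 ⟨hwn.1.trans hw.1, hn.1⟩).trans inf_relNeg_inf_le
    have hz := (le_meet_iff.2 ⟨hwn.1.trans hw.1, hn.2⟩).trans inf_relNeg_inf_le
    exact le_relNeg_iff.2 <|
      (le_meet_iff.2 ⟨le_meet_iff.2 ⟨hy, hz⟩, hwn.1.trans hw.2⟩).trans inf_relNeg_le
  · conv_rhs => rw [← hx]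
    exact relNeg_le_relNeg (le_meet_iff.2
      ⟨relNeg_le_relNeg (meet_le_left _ _),
        relNeg_le_relNeg (meet_le_left _ _)⟩)
  · have hmeet := fun t => le_meet_iff.1 (L.opens.le_refl (L.opens.inf x t))
    have hn := le_meet_iff.1 (L.opens.le_refl (L.opens.inf (relNeg L d y) (relNeg L d z)))
    exact relNeg_le_relNeg (le_meet_iff.2
      ⟨hn.1.trans (relNeg_le_relNeg (hmeet y).2), hn.2.trans (relNeg_le_relNeg (hmeet z).2)⟩)

end

/-- The object of opens that are regular relative to `d`, those with `(x → d) → d = x`. -/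
noncomputable def regularOpens : E :=
  equalizer (relNeg L d (relNeg L d (𝟙 L.opens.obj))) (𝟙 _)

/-- The inclusion of the regular opens. -/
noncomputable def regularOpensι : regularOpens L d ⟶ L.opens.obj := equalizer.ι _ _

instance : Mono (regularOpensι L d) := inferInstanceAs (Mono (equalizer.ι _ _))

lemma relNeg_relNeg_comp_regularOpensι (a : I ⟶ regularOpens L d) :
    relNeg L d (relNeg L d (a ≫ regularOpensι L d)) = a ≫ regularOpensι L d := by
  have h : regularOpensι L d ≫ relNeg L d (relNeg L d (𝟙 _)) = regularOpensι L d ≫ 𝟙 _ :=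
    equalizer.condition _ _
  rw [comp_relNeg, comp_relNeg, Category.comp_id] at h
  rw [← comp_relNeg, ← comp_relNeg, h]

variable {L d} in
/-- A regular open as a generalized element of the object of regular opens. -/
noncomputable def regularOpensLift (x : I ⟶ L.opens.obj) (hx : relNeg L d (relNeg L d x) = x) :
    I ⟶ regularOpens L d :=
  equalizer.lift x (by rw [comp_relNeg, comp_relNeg, Category.comp_id, hx])

variable {L d} in
lemma regularOpensLift_ι (x : I ⟶ L.opens.obj) (hx : relNeg L d (relNeg L d x) = x) :
    regularOpensLift x hx ≫ regularOpensι L d = x := equalizer.lift_ι _ _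

lemma relNeg_relNeg_top : relNeg L d (relNeg L d (L.opens.top I)) = L.opens.top I := by
  rw [relNeg_top, relNeg_constAt]

lemma relNeg_relNeg_constAt : relNeg L d (relNeg L d (constAt d I)) = constAt d I := by
  rw [relNeg_constAt, relNeg_top]

/-- The internal lattice of the opens that are regular relative to `d`. Its bottom element is `d`
and its meets are those of `L`. -/
noncomputable abbrev regularLattice : InternalLattice E where
  obj := regularOpens L d
  top I := regularOpensLift (L.opens.top I) (relNeg_relNeg_top L d)
  bot I := regularOpensLift (constAt d I) (relNeg_relNeg_constAt L d)
  inf a b := regularOpensLift (L.opens.inf (a ≫ regularOpensι L d) (b ≫ regularOpensι L d)) <| by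
    rw [relNeg_relNeg_inf, relNeg_relNeg_comp_regularOpensι, relNeg_relNeg_comp_regularOpensι]
  sup a b := regularOpensLift (relNeg L d (L.opens.inf (relNeg L d (a ≫ regularOpensι L d))
    (relNeg L d (b ≫ regularOpensι L d)))) (relNeg_relNeg_relNeg _)
  comp_top u := by
    rw [← cancel_mono (regularOpensι L d), Category.assoc, regularOpensLift_ι, regularOpensLift_ι,
      L.opens.comp_top]
  comp_bot u := by
    rw [← cancel_mono (regularOpensι L d), Category.assoc, regularOpensLift_ι, regularOpensLift_ι,
      comp_constAt]
  comp_inf u a b := by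
    rw [← cancel_mono (regularOpensι L d), Category.assoc, regularOpensLift_ι, regularOpensLift_ι,
      L.opens.comp_inf, Category.assoc, Category.assoc]
  comp_sup u a b := by
    simp only [← cancel_mono (regularOpensι L d), Category.assoc, regularOpensLift_ι, comp_relNeg,
      L.opens.comp_inf]
  inf_comm a b := by
    simp only [← cancel_mono (regularOpensι L d), regularOpensLift_ι]
    exact L.opens.inf_comm _ _
  sup_comm a b := by
    simp only [← cancel_mono (regularOpensι L d), regularOpensLift_ι]
    exact congrArg _ (L.opens.inf_comm _ _)
  inf_assoc a b c := by
    rw [← cancel_mono (regularOpensι L d)]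
    simp only [regularOpensLift_ι, L.opens.inf_assoc]
  sup_assoc a b c := by
    rw [← cancel_mono (regularOpensι L d)]
    simp only [regularOpensLift_ι, relNeg_relNeg_inf, relNeg_relNeg_relNeg, L.opens.inf_assoc]
  inf_sup_self a b := by
    simp only [← cancel_mono (regularOpensι L d), regularOpensLift_ι]
    exact le_relNeg_comm.1 (meet_le_left _ _)
  sup_inf_self a b := by
    simp only [← cancel_mono (regularOpensι L d), regularOpensLift_ι]
    have h := relNeg_le_relNeg (d := d)
      (meet_le_left (a ≫ regularOpensι L d) (b ≫ regularOpensι L d))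
    exact (congrArg _ h).trans (relNeg_relNeg_comp_regularOpensι L d a)
  inf_sup_left a b c := by
    simp only [← cancel_mono (regularOpensι L d), regularOpensLift_ι]
    exact inf_relNeg_inf_relNeg_relNeg (relNeg_relNeg_comp_regularOpensι L d a)
  inf_top a := by
    rw [← cancel_mono (regularOpensι L d), regularOpensLift_ι, regularOpensLift_ι, L.opens.inf_top]
  sup_bot a := by
    rw [← cancel_mono (regularOpensι L d), regularOpensLift_ι, regularOpensLift_ι, relNeg_constAt,
      L.opens.inf_top, relNeg_relNeg_comp_regularOpensι]

variable {L d}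

lemma regularLattice_inf_ι (a b : I ⟶ (regularLattice L d).obj) :
    (regularLattice L d).inf a b ≫ regularOpensι L d =
      L.opens.inf (a ≫ regularOpensι L d) (b ≫ regularOpensι L d) := by
  dsimp only
  rw [regularOpensLift_ι]

lemma regularLattice_le_iff (a b : I ⟶ (regularLattice L d).obj) :
    (regularLattice L d).le a b ↔
      L.opens.le (a ≫ regularOpensι L d) (b ≫ regularOpensι L d) := by
  unfold le
  rw [← cancel_mono (regularOpensι L d), regularLattice_inf_ι]

/-- The regularization of an open, its image under the reflection onto the regular opens. -/
noncomputable def regularize (x : I ⟶ L.opens.obj) : I ⟶ (regularLattice L d).obj :=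
  regularOpensLift (relNeg L d (relNeg L d x)) (relNeg_relNeg_relNeg _)

lemma regularize_ι (x : I ⟶ L.opens.obj) :
    regularize x ≫ regularOpensι L d = relNeg L d (relNeg L d x) := regularOpensLift_ι _ _

lemma comp_regularize (u : J ⟶ I) (x : I ⟶ L.opens.obj) :
    u ≫ regularize (d := d) x = regularize (u ≫ x) := by
  have h : (u ≫ regularize (d := d) x) ≫ regularOpensι L d =
      regularize (u ≫ x) ≫ regularOpensι L d := by
    rw [Category.assoc, regularize_ι, regularize_ι, comp_relNeg, comp_relNeg]
  exact (cancel_mono (regularOpensι L d)).1 h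

lemma regularize_le_iff (x : I ⟶ L.opens.obj) (a : I ⟶ (regularLattice L d).obj) :
    (regularLattice L d).le (regularize x) a ↔ L.opens.le x (a ≫ regularOpensι L d) := by
  rw [regularLattice_le_iff, regularize_ι]
  refine ⟨le_relNeg_relNeg.trans, fun h => ?_⟩
  have hreg := relNeg_relNeg_comp_regularOpensι L d a
  rw [← hreg]
  exact relNeg_le_relNeg (relNeg_le_relNeg h)

variable (L d) in
lemma regularLattice_isFrame : (regularLattice L d).IsFrame where
  exists_join f a := by
    obtain ⟨s, hs⟩ := L.isFrame.exists_join f (a ≫ regularOpensι L d)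
    refine ⟨regularize s, fun K u b => ?_⟩
    rw [comp_regularize, regularize_le_iff, hs]
    refine forall_congr' fun T => forall_congr' fun p => forall_congr' fun q =>
      imp_congr_right fun _ => ?_
    rw [regularLattice_le_iff, Category.assoc, Category.assoc]
  inf_join := (regularLattice L d).inf_join_of_imp fun y z =>
    ⟨regularOpensLift (relNeg L d (L.opens.inf (y ≫ regularOpensι L d)
      (relNeg L d (z ≫ regularOpensι L d)))) (relNeg_relNeg_relNeg _), fun p x => by
      rw [regularLattice_le_iff, regularLattice_le_iff, regularLattice_inf_ι, Category.assoc,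
        regularOpensLift_ι, comp_relNeg, L.opens.comp_inf, ← inf_le_relNeg_iff, comp_relNeg,
        ← Category.assoc p z, relNeg_relNeg_comp_regularOpensι, Category.assoc p y, Category.assoc]⟩

variable (L d) in
/-- The space whose opens are the opens of `L` that are regular relative to `d`. -/
noncomputable abbrev regularSpace : LocalicSpace E :=
  ⟨regularLattice L d, regularLattice_isFrame L d⟩

variable (L d I) in
lemma regularize_top : regularize (L.opens.top I) = (regularLattice L d).top I := by
  rw [← cancel_mono (regularOpensι L d), regularize_ι, regularOpensLift_ι, relNeg_relNeg_top]

lemma regularize_inf (x y : I ⟶ L.opens.obj) :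
    regularize (L.opens.inf x y) = (regularLattice L d).inf (regularize x) (regularize y) := by
  rw [← cancel_mono (regularOpensι L d), regularize_ι, regularLattice_inf_ι, regularize_ι,
    regularize_ι, relNeg_relNeg_inf]

lemma regularize_constAt : regularize (constAt d I) = (regularLattice L d).bot I := by
  rw [← cancel_mono (regularOpensι L d), regularize_ι, regularOpensLift_ι, relNeg_relNeg_constAt]

lemma regularize_eq_sup {x y z : I ⟶ L.opens.obj}
    (h : relNeg L d z = L.opens.inf (relNeg L d x) (relNeg L d y)) :
    regularize z = (regularLattice L d).sup (regularize x) (regularize y) := by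
  rw [← cancel_mono (regularOpensι L d), regularize_ι, regularOpensLift_ι, regularize_ι,
    regularize_ι, relNeg_relNeg_relNeg, relNeg_relNeg_relNeg, h]

variable (L d) in
/-- The inclusion of the space of regular opens; its inverse image is the regularization. -/
noncomputable def regularIncl : regularSpace L d ⟶ L :=
  LocalicSpace.Map.ofAdjoint (regularize (𝟙 L.opens.obj))
    (fun I => by rw [comp_regularize, Category.comp_id, regularize_top])
    (fun a b => by simp only [comp_regularize, Category.comp_id, regularize_inf])
    (fun b => ⟨b ≫ regularOpensι L d, fun K u a => by
      rw [comp_regularize, Category.comp_id, regularize_le_iff, Category.assoc]⟩)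

lemma constAt_eq_top_of_isTrivial (h : (regularSpace L d).IsTrivial) :
    constAt d I = L.opens.top I := by
  rw [← regularOpensLift_ι _ (relNeg_relNeg_constAt L d),
    ← regularOpensLift_ι _ (relNeg_relNeg_top L d)]
  exact congrArg (· ≫ regularOpensι L d) (h I)

end Regular

end PointFree

namespace PointFree

section Antitone

open InternalLattice functionLattice

variable {E : Type u} [Category.{v} E] [CartesianMonoidalCategory E] [MonoidalClosed E]

/-- A generalized element of `B ^ A` that is an antitone function, at all later stages. -/
def IsAntitone (A : InternalLattice E) {B : InternalLattice E} {I : E}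
    (x : I ⟶ (functionLattice A.obj B).obj) : Prop :=
  ∀ ⦃J : E⦄ (u : J ⟶ I) ⦃a b : J ⟶ A.obj⦄, A.le a b → B.le (apply b (u ≫ x)) (apply a (u ≫ x))

section Closure

variable {A B : InternalLattice E} {I J : E} {x y : I ⟶ (functionLattice A.obj B).obj}

lemma IsAntitone.comp (hx : IsAntitone A x) (v : J ⟶ I) : IsAntitone A (v ≫ x) :=
  fun K u a b h => by simpa only [Category.assoc] using hx (u ≫ v) h

variable (A B I) in
lemma isAntitone_top : IsAntitone A ((functionLattice A.obj B).top I) := fun J u a b _ => by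
  rw [(functionLattice A.obj B).comp_top, apply_top, apply_top]
  exact B.le_refl _

variable (A B I) in
lemma isAntitone_bot : IsAntitone A ((functionLattice A.obj B).bot I) := fun J u a b _ => by
  rw [(functionLattice A.obj B).comp_bot, apply_bot, apply_bot]
  exact B.le_refl _

lemma IsAntitone.inf (hx : IsAntitone A x) (hy : IsAntitone A y) :
    IsAntitone A ((functionLattice A.obj B).inf x y) := fun J u a b h => by
  rw [(functionLattice A.obj B).comp_inf, apply_inf, apply_inf]
  exact le_meet_iff.2
    ⟨(meet_le_left _ _).trans (hx u h), (meet_le_right _ _).trans (hy u h)⟩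

lemma IsAntitone.sup (hx : IsAntitone A x) (hy : IsAntitone A y) :
    IsAntitone A ((functionLattice A.obj B).sup x y) := fun J u a b h => by
  rw [(functionLattice A.obj B).comp_sup, apply_sup, apply_sup]
  exact join_le_iff.2 ⟨(hx u h).trans (le_join_left _ _), (hy u h).trans (le_join_right _ _)⟩

lemma IsAntitone.of_isJoin (hB : B.IsFrame) {f : J ⟶ I} {s : I ⟶ (functionLattice A.obj B).obj}
    {z : J ⟶ (functionLattice A.obj B).obj} (hs : (functionLattice A.obj B).IsJoin f z s)
    (hz : IsAntitone A z) : IsAntitone A s := fun K u a b h => by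
  rw [apply_comp_le_iff_of_isJoin hB hs]
  intro T p q hpq
  have ha := (apply_comp_le_iff_of_isJoin hB hs a u _).1 (B.le_refl _) p q hpq
  exact (hz q (h.comp p)).trans ha

lemma isAntitone_const (b : I ⟶ B.obj) : IsAntitone A (b ≫ (constHom A.obj B).map) :=
  fun J u a c _ => by
    rw [← Category.assoc, apply_const, apply_const]
    exact B.le_refl _

end Closure

variable [HasFiniteLimits E]

lemma exists_mono_isAntitone_iff (A B : InternalLattice E) :
    ∃ (S : E) (ι : S ⟶ (functionLattice A.obj B).obj) (_ : Mono ι),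
      ∀ ⦃I : E⦄ (x : I ⟶ (functionLattice A.obj B).obj), (∃ w, w ≫ ι = x) ↔ IsAntitone A x := by
  let f : (A.obj ⊗ A.obj) ⊗ (functionLattice A.obj B).obj ⟶ B.obj :=
    apply (fst _ _ ≫ fst _ _) (snd _ _)
  let g : (A.obj ⊗ A.obj) ⊗ (functionLattice A.obj B).obj ⟶ B.obj :=
    apply (fst _ _ ≫ A.inf (fst _ _) (snd _ _)) (snd _ _)
  have hf : ∀ {J : E} (c : J ⟶ A.obj ⊗ A.obj) (y : J ⟶ (functionLattice A.obj B).obj),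
      lift c y ≫ f = apply (c ≫ fst _ _) y := fun c y => by simp [f, functionLattice.comp_apply]
  have hg : ∀ {J : E} (c : J ⟶ A.obj ⊗ A.obj) (y : J ⟶ (functionLattice A.obj B).obj),
      lift c y ≫ g = apply (A.inf (c ≫ fst _ _) (c ≫ snd _ _)) y :=
    fun c y => by simp [g, functionLattice.comp_apply, A.comp_inf]
  have hiff : ∀ {I : E} (x : I ⟶ (functionLattice A.obj B).obj),
      x ≫ ofFun (B.inf f g) = x ≫ ofFun f ↔ IsAntitone A x := fun {I} x => by
    refine ⟨fun h J u a b hab => ?_, fun hx => hom_ext fun J u c => ?_⟩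
    · have hc := congrArg (fun z => apply (lift b a) (u ≫ z)) h
      simp only [← Category.assoc] at hc
      rw [apply_comp_ofFun, apply_comp_ofFun, B.comp_inf, hf, hg, lift_fst, lift_snd, A.inf_comm,
        hab] at hc
      exact hc
    · rw [← Category.assoc, ← Category.assoc, apply_comp_ofFun, apply_comp_ofFun, B.comp_inf, hf,
        hg]
      exact hx u (meet_le_left _ _)
  refine ⟨equalizer (ofFun (B.inf f g)) (ofFun f), equalizer.ι _ _, inferInstance, fun I x =>
    ⟨?_, fun hx => ⟨equalizer.lift x ((hiff x).2 hx), equalizer.lift_ι _ _⟩⟩⟩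
  rintro ⟨w, rfl⟩
  exact ((hiff _).1 (equalizer.condition _ _)).comp w

variable (A B : InternalLattice E)

/-- The object of antitone functions from `A` to `B`. -/
noncomputable def antitoneObj : E := (exists_mono_isAntitone_iff A B).choose

/-- The inclusion of the antitone functions into `B ^ A`. -/
noncomputable def antitoneι : antitoneObj A B ⟶ (functionLattice A.obj B).obj :=
  (exists_mono_isAntitone_iff A B).choose_spec.choose

instance : Mono (antitoneι A B) := (exists_mono_isAntitone_iff A B).choose_spec.choose_spec.choose

variable {A B} {I J : E}

lemma exists_comp_antitoneι_iff (x : I ⟶ (functionLattice A.obj B).obj) :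
    (∃ w, w ≫ antitoneι A B = x) ↔ IsAntitone A x :=
  (exists_mono_isAntitone_iff A B).choose_spec.choose_spec.choose_spec x

lemma isAntitone_comp_antitoneι (w : I ⟶ antitoneObj A B) : IsAntitone A (w ≫ antitoneι A B) :=
  (exists_comp_antitoneι_iff _).1 ⟨w, rfl⟩

/-- An antitone function as a generalized element of the object of antitone functions. -/
noncomputable def antitoneLift (x : I ⟶ (functionLattice A.obj B).obj) (hx : IsAntitone A x) :
    I ⟶ antitoneObj A B := ((exists_comp_antitoneι_iff x).2 hx).choose

lemma antitoneLift_ι (x : I ⟶ (functionLattice A.obj B).obj) (hx : IsAntitone A x) :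
    antitoneLift x hx ≫ antitoneι A B = x := ((exists_comp_antitoneι_iff x).2 hx).choose_spec

variable (A B) in
lemma isSublattice_antitoneι : IsSublattice (functionLattice A.obj B) (antitoneι A B) where
  top I := (exists_comp_antitoneι_iff _).2 (isAntitone_top A B I)
  bot I := (exists_comp_antitoneι_iff _).2 (isAntitone_bot A B I)
  inf a b := (exists_comp_antitoneι_iff _).2
    ((isAntitone_comp_antitoneι a).inf (isAntitone_comp_antitoneι b))
  sup a b := (exists_comp_antitoneι_iff _).2
    ((isAntitone_comp_antitoneι a).sup (isAntitone_comp_antitoneι b))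

variable (A B) in
/-- The internal lattice of antitone functions from `A` to `B`, with the pointwise operations. -/
noncomputable abbrev antitoneLattice : InternalLattice E :=
  sublattice (functionLattice A.obj B) (antitoneι A B) (isSublattice_antitoneι A B)

/-- The space whose opens are the antitone functions from `A` to the opens of `W`. -/
noncomputable abbrev antitoneSpace (A : InternalLattice E) (W : LocalicSpace E) : LocalicSpace E :=
  ⟨antitoneLattice A W.opens, sublattice_isFrame (functionLattice_isFrame A.obj W.isFrame)
    fun _ a _ hs => (exists_comp_antitoneι_iff _).2
      (.of_isJoin W.isFrame hs (isAntitone_comp_antitoneι a))⟩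

/-- The value at `a` of an antitone function `x`. -/
noncomputable def antitoneApply (a : I ⟶ A.obj) (x : I ⟶ antitoneObj A B) : I ⟶ B.obj :=
  apply a (x ≫ antitoneι A B)

lemma comp_antitoneApply (u : J ⟶ I) (a : I ⟶ A.obj) (x : I ⟶ antitoneObj A B) :
    u ≫ antitoneApply a x = antitoneApply (u ≫ a) (u ≫ x) := by
  rw [antitoneApply, functionLattice.comp_apply, antitoneApply, Category.assoc]

lemma antitoneApply_le {a b : I ⟶ A.obj} (h : A.le a b) (x : I ⟶ antitoneObj A B) :
    B.le (antitoneApply b x) (antitoneApply a x) := by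
  simpa only [antitoneApply, Category.id_comp] using isAntitone_comp_antitoneι x (𝟙 I) h

lemma antitoneLattice_le_iff {x y : I ⟶ antitoneObj A B} :
    (antitoneLattice A B).le x y ↔ ∀ ⦃J : E⦄ (u : J ⟶ I) (a : J ⟶ A.obj),
      B.le (antitoneApply a (u ≫ x)) (antitoneApply a (u ≫ y)) := by
  rw [sublattice_le_iff, le_iff_apply]
  simp only [antitoneApply, Category.assoc]

lemma antitoneApply_inf (a : I ⟶ A.obj) (x y : I ⟶ antitoneObj A B) :
    antitoneApply a ((antitoneLattice A B).inf x y) =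
      B.inf (antitoneApply a x) (antitoneApply a y) := by
  rw [antitoneApply, sublattice_inf_ι, apply_inf, antitoneApply, antitoneApply]

lemma antitoneApply_top (a : I ⟶ A.obj) :
    antitoneApply a ((antitoneLattice A B).top I) = B.top I :=
  (congrArg (apply a) ((sublatticeHom _ _ (isSublattice_antitoneι A B)).top_map I)).trans
    (apply_top a)

lemma antitoneLattice_hom_ext {x y : I ⟶ antitoneObj A B}
    (h : ∀ ⦃J : E⦄ (u : J ⟶ I) (a : J ⟶ A.obj),
      antitoneApply a (u ≫ x) = antitoneApply a (u ≫ y)) : x = y :=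
  (antitoneLattice_le_iff (x := x)).2 (fun _ u a => h u a ▸ B.le_refl _) |>.antisymm
    ((antitoneLattice_le_iff (x := y)).2 fun _ u a => h u a ▸ B.le_refl _)

variable (A B) in
/-- The constant functions, as a morphism into the object of antitone functions. -/
noncomputable def antitoneConst : B.obj ⟶ antitoneObj A B :=
  antitoneLift (𝟙 B.obj ≫ (constHom A.obj B).map) (isAntitone_const _)

lemma antitoneApply_const (a : I ⟶ A.obj) (b : I ⟶ B.obj) :
    antitoneApply a (b ≫ antitoneConst A B) = b := by
  rw [antitoneApply, antitoneConst, Category.assoc, antitoneLift_ι, Category.id_comp, apply_const]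

/-- The projection of the space of antitone functions to `W`. Its inverse image gives the constant
functions, and the right adjoint of that is evaluation at the top element. -/
noncomputable def antitoneProj (A : InternalLattice E) (W : LocalicSpace E) :
    antitoneSpace A W ⟶ W :=
  LocalicSpace.Map.ofAdjoint (antitoneConst A W.opens)
    (fun I => antitoneLattice_hom_ext fun J u a => by
      rw [← Category.assoc, antitoneApply_const, comp_top, comp_top, antitoneApply_top])
    (fun b c => antitoneLattice_hom_ext fun J u a => by
      rw [comp_inf, antitoneApply_inf, ← Category.assoc, ← Category.assoc, ← Category.assoc,
        antitoneApply_const, antitoneApply_const, antitoneApply_const, comp_inf])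
    (fun {I} x => ⟨antitoneApply (A.top I) x, fun K u b => by
      rw [antitoneLattice_le_iff, comp_antitoneApply, A.comp_top]
      refine ⟨fun h => ?_, fun h J v a => ?_⟩
      · simpa only [Category.id_comp, antitoneApply_const] using h (𝟙 K) (A.top K)
      · rw [← Category.assoc, antitoneApply_const]
        have hv := h.comp v
        rw [comp_antitoneApply, A.comp_top] at hv
        exact hv.trans (antitoneApply_le (le_top _) _)⟩)

end Antitone

end PointFree

namespace PointFree

section Stone

open InternalLattice functionLattice

variable {E : Type u} [Category.{v} E] [CartesianMonoidalCategory E] [HasFiniteLimits E]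

section LeOpen

variable {A : InternalLattice E} {I J : E}

lemma exists_lift_eq_comp_ι_iff (b a : I ⟶ A.obj) :
    (∃ q, lift b a = q ≫ equalizer.ι (A.inf (fst A.obj A.obj) (snd A.obj A.obj)) (fst _ _)) ↔
      A.le b a := by
  have h : lift b a ≫ A.inf (fst A.obj A.obj) (snd A.obj A.obj) = lift b a ≫ fst _ _ ↔
      A.le b a := by
    rw [A.comp_inf, lift_fst, lift_snd, le]
  refine ⟨?_, fun hle => ⟨equalizer.lift _ (h.2 hle), (equalizer.lift_ι _ _).symm⟩⟩
  rintro ⟨q, hq⟩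
  rw [← h, hq, Category.assoc, equalizer.condition, Category.assoc]

variable (W : LocalicSpace E)

/-- The open of `W` given by the truth value of `b ≤ a`. -/
noncomputable def leOpen (b a : I ⟶ A.obj) : I ⟶ W.opens.obj :=
  lift b a ≫ imageOpen W (equalizer.ι (A.inf (fst A.obj A.obj) (snd A.obj A.obj)) (fst _ _))

lemma comp_leOpen (u : J ⟶ I) (b a : I ⟶ A.obj) :
    u ≫ leOpen W b a = leOpen W (u ≫ b) (u ≫ a) := by
  rw [leOpen, comp_lift_assoc, leOpen]

variable {W}

lemma leOpen_eq_top {b a : I ⟶ A.obj} (h : A.le b a) : leOpen W b a = W.opens.top I := by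
  obtain ⟨q, hq⟩ := (exists_lift_eq_comp_ι_iff b a).2 h
  exact imageOpen_eq_top W q hq

lemma leOpen_inf_le_iff {b a : I ⟶ A.obj} {c e : I ⟶ W.opens.obj} :
    W.opens.le (W.opens.inf (leOpen W b a) c) e ↔
      ∀ ⦃T : E⦄ (p : T ⟶ I), A.le (p ≫ b) (p ≫ a) → W.opens.le (p ≫ c) (p ≫ e) := by
  rw [leOpen, imageOpen_inf_le_iff]
  simp only [comp_lift, ← exists_lift_eq_comp_ι_iff, forall_exists_index]

lemma leOpen_le_iff {b a : I ⟶ A.obj} {e : I ⟶ W.opens.obj} :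
    W.opens.le (leOpen W b a) e ↔
      ∀ ⦃T : E⦄ (p : T ⟶ I), A.le (p ≫ b) (p ≫ a) → p ≫ e = W.opens.top T := by
  rw [leOpen, imageOpen_le_iff]
  simp only [comp_lift, ← exists_lift_eq_comp_ι_iff, forall_exists_index]

lemma leOpen_le_leOpen {b a b' a' : I ⟶ A.obj}
    (h : ∀ ⦃T : E⦄ (p : T ⟶ I), A.le (p ≫ b) (p ≫ a) → A.le (p ≫ b') (p ≫ a')) :
    W.opens.le (leOpen W b a) (leOpen W b' a') :=
  leOpen_le_iff.2 fun T p hp => by rw [comp_leOpen, leOpen_eq_top (h p hp)]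

lemma leOpen_inf_leOpen_le_leOpen {b a b' a' c e : I ⟶ A.obj}
    (h : ∀ ⦃T : E⦄ (p : T ⟶ I), A.le (p ≫ b) (p ≫ a) → A.le (p ≫ b') (p ≫ a') →
      A.le (p ≫ c) (p ≫ e)) :
    W.opens.le (W.opens.inf (leOpen W b a) (leOpen W b' a')) (leOpen W c e) :=
  leOpen_inf_le_iff.2 fun T p hp => by
    rw [comp_leOpen, comp_leOpen]
    refine leOpen_le_leOpen fun K q hq => ?_
    have hpq := h (q ≫ p)
    simp only [Category.assoc] at hpq
    exact hpq (by simpa only [Category.assoc] using hp.comp q) hq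

lemma leOpen_inf (b a a' : I ⟶ A.obj) :
    leOpen W b (A.inf a a') = W.opens.inf (leOpen W b a) (leOpen W b a') := by
  refine le.antisymm (le_meet_iff.2 ⟨leOpen_le_leOpen fun T p hp => ?_,
    leOpen_le_leOpen fun T p hp => ?_⟩) (leOpen_inf_leOpen_le_leOpen fun T p hp hp' => ?_)
  · rw [A.comp_inf] at hp
    exact (le_meet_iff.1 hp).1
  · rw [A.comp_inf] at hp
    exact (le_meet_iff.1 hp).2
  · rw [A.comp_inf]
    exact le_meet_iff.2 ⟨hp, hp'⟩

lemma leOpen_inf_leOpen_le_leOpen_sup (b b' a : I ⟶ A.obj) :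
    W.opens.le (W.opens.inf (leOpen W b a) (leOpen W b' a)) (leOpen W (A.sup b b') a) :=
  leOpen_inf_leOpen_le_leOpen fun T p hp hp' => by
    rw [A.comp_sup]
    exact join_le_iff.2 ⟨hp, hp'⟩

end LeOpen

variable [MonoidalClosed E]

section Down

variable (A : InternalLattice E) (W : LocalicSpace E)

lemma isAntitone_ofFun_leOpen :
    IsAntitone A (ofFun (A := W.opens) (leOpen W (fst A.obj A.obj) (snd A.obj A.obj))) :=
  fun J u a b h => by
    simp only [apply_comp_ofFun, comp_leOpen, lift_fst, lift_snd]
    exact leOpen_le_leOpen fun T p hp => (h.comp p).trans hp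

/-- The principal ideal of `a`, as the antitone function whose value at `b` is the truth value of
`b ≤ a`. -/
noncomputable def down : A.obj ⟶ antitoneObj A W.opens :=
  antitoneLift _ (isAntitone_ofFun_leOpen A W)

variable {A W} {I J : E}

lemma antitoneApply_down (b a : I ⟶ A.obj) :
    antitoneApply b (a ≫ down A W) = leOpen W b a := by
  rw [antitoneApply, Category.assoc, down, antitoneLift_ι, apply_comp_ofFun, comp_leOpen, lift_fst,
    lift_snd]

lemma top_comp_down : A.top I ≫ down A W = (antitoneSpace A W).opens.top I :=
  antitoneLattice_hom_ext fun J u b => by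
    rw [← Category.assoc, antitoneApply_down, A.comp_top, leOpen_eq_top (le_top b),
      (antitoneLattice A W.opens).comp_top, antitoneApply_top]

lemma inf_comp_down (a b : I ⟶ A.obj) :
    A.inf a b ≫ down A W = (antitoneSpace A W).opens.inf (a ≫ down A W) (b ≫ down A W) :=
  antitoneLattice_hom_ext fun J u c => by
    rw [← Category.assoc, antitoneApply_down, A.comp_inf, leOpen_inf,
      (antitoneLattice A W.opens).comp_inf, antitoneApply_inf, ← Category.assoc,
      ← Category.assoc, antitoneApply_down, antitoneApply_down]

variable (A W) in
/-- The least principal ideal. -/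
noncomputable def downBot : 𝟙_ E ⟶ antitoneObj A W.opens := A.bot (𝟙_ E) ≫ down A W

lemma constAt_downBot : constAt (downBot A W) I = A.bot I ≫ down A W := by
  rw [constAt, downBot, ← Category.assoc, A.comp_bot]

variable [HasSubobjectClassifier E]

lemma le_relNeg_down_iff (x : I ⟶ antitoneObj A W.opens) (a : I ⟶ A.obj) :
    (antitoneSpace A W).opens.le x (relNeg (antitoneSpace A W) (downBot A W) (a ≫ down A W)) ↔
      ∀ ⦃J : E⦄ (u : J ⟶ I) (b : J ⟶ A.obj), A.le b (u ≫ a) →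
        W.opens.le (antitoneApply b (u ≫ x)) (leOpen W b (A.bot J)) := by
  have hval : ∀ {J : E} (u : J ⟶ I) (b : J ⟶ A.obj),
      antitoneApply b (u ≫ (antitoneSpace A W).opens.inf (a ≫ down A W) x) =
        W.opens.inf (leOpen W b (u ≫ a)) (antitoneApply b (u ≫ x)) := fun u b => by
    rw [(antitoneLattice A W.opens).comp_inf, antitoneApply_inf, ← Category.assoc,
      antitoneApply_down]
  rw [le_relNeg_iff, (antitoneSpace A W).opens.inf_comm, constAt_downBot, antitoneLattice_le_iff]
  simp only [hval, leOpen_inf_le_iff, ← Category.assoc, antitoneApply_down, A.comp_bot]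
  simp only [comp_antitoneApply, comp_leOpen, A.comp_bot, ← Category.assoc]
  refine ⟨fun h J u b hb => ?_, fun h J u b T p hp => h (p ≫ u) (p ≫ b) hp⟩
  simpa only [Category.id_comp] using h u b (𝟙 J) (by simpa only [Category.id_comp] using hb)

/-- The distributive law of `A` enters here: an element below `a ∨ a'` is the join of its meets
with `a` and `a'`. -/
lemma relNeg_sup_comp_down (a a' : I ⟶ A.obj) :
    relNeg (antitoneSpace A W) (downBot A W) (A.sup a a' ≫ down A W) =
      (antitoneSpace A W).opens.inf (relNeg (antitoneSpace A W) (downBot A W) (a ≫ down A W))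
        (relNeg (antitoneSpace A W) (downBot A W) (a' ≫ down A W)) := by
  refine eq_of_forall_le_iff fun x => ?_
  rw [le_meet_iff, le_relNeg_down_iff, le_relNeg_down_iff, le_relNeg_down_iff]
  refine ⟨fun h => ⟨fun J u b hb => h u b ?_, fun J u b hb => h u b ?_⟩, fun h J u b hb => ?_⟩
  · rw [A.comp_sup]
    exact hb.trans (le_join_left _ _)
  · rw [A.comp_sup]
    exact hb.trans (le_join_right _ _)
  · have hsplit : A.sup (A.inf b (u ≫ a)) (A.inf b (u ≫ a')) = b := by
      rw [← A.inf_sup_left, ← A.comp_sup]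
      exact hb
    have hle : ∀ c : J ⟶ A.obj, W.opens.le (antitoneApply b (u ≫ x))
        (antitoneApply (A.inf b c) (u ≫ x)) := fun c => antitoneApply_le (meet_le_left _ _) _
    have hmeet := (le_meet_iff.2 ⟨(hle _).trans (h.1 u _ (meet_le_right b _)),
      (hle _).trans (h.2 u _ (meet_le_right b _))⟩).trans (leOpen_inf_leOpen_le_leOpen_sup _ _ _)
    rwa [hsplit] at hmeet

end Down

section Spectrum

variable [HasSubobjectClassifier E] (A : InternalLattice E) (W : LocalicSpace E)

/-- A space over `W` that carries a generic prime filter of `A`. It is the space of antitone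
functions from `A` to the opens of `W` that are regular relative to the least principal ideal. -/
noncomputable abbrev filterSpace : LocalicSpace E := regularSpace (antitoneSpace A W) (downBot A W)

/-- The generic prime filter: it takes an element of `A` to its regularized principal ideal. -/
noncomputable def genericFilter : Hom A (filterSpace A W).opens :=
  have hcomp : ∀ {I : E} (a : I ⟶ A.obj),
      a ≫ regularize (d := downBot A W) (L := antitoneSpace A W) (down A W) =
        regularize (a ≫ down A W) := fun a => comp_regularize _ _
  { map := regularize (d := downBot A W) (L := antitoneSpace A W) (down A W)
    top_map := fun I => by rw [hcomp, top_comp_down, regularize_top]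
    bot_map := fun I => by rw [hcomp, ← constAt_downBot, regularize_constAt]
    inf_map := fun a b => by rw [hcomp, hcomp, hcomp, inf_comp_down, regularize_inf]
    sup_map := fun a b => by
      rw [hcomp, hcomp, hcomp]
      exact regularize_eq_sup (relNeg_sup_comp_down a b) }

variable {A W}

lemma imageOpen_eq_top_of_isTrivial (h : (filterSpace A W).IsTrivial) :
    imageOpen W (toUnit (equalizer (A.bot (𝟙_ E)) (A.top (𝟙_ E)))) = W.opens.top (𝟙_ E) := by
  have hd : A.bot (𝟙_ E) ≫ down A W = (antitoneSpace A W).opens.top (𝟙_ E) := by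
    rw [← constAt_downBot, constAt_eq_top_of_isTrivial h]
  have hle : leOpen W (A.top (𝟙_ E)) (A.bot (𝟙_ E)) = W.opens.top (𝟙_ E) := by
    rw [← antitoneApply_down, hd, antitoneApply_top]
  rw [← top_le_iff_eq, ← hle, leOpen_le_iff]
  intro T p hp
  rw [A.comp_top, A.comp_bot, top_le_iff_eq] at hp
  obtain ⟨q⟩ := (bot_eq_top_iff_nonempty A T).1 hp
  exact imageOpen_eq_top W q (toUnit_unique _ _)

theorem isExponential_spec {S : LocalicSpace E} (hS : IsSpec A S) :
    IsExponential S (emptySpace E) (discrete (equalizer (A.bot (𝟙_ E)) (A.top (𝟙_ E)))) := by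
  obtain ⟨η, hη⟩ := hS
  let ψ := equalizer (A.bot (𝟙_ E)) (A.top (𝟙_ E))
  rw [isExponential_emptySpace_iff]
  refine ⟨fun T x s => LocalicSpace.isTrivial_of_bot_eq_top ?_, fun W hW => ?_⟩
  · have hbot : imageOpen T (toUnit ψ) = T.opens.bot (𝟙_ E) := by
      rw [imageOpen_toUnit_eq_bot_iff, ← s.inv.bot_map, ← s.inv.top_map, ← η.bot_map, ← η.top_map,
        (bot_eq_top_iff_nonempty A ψ).2 ⟨𝟙 ψ⟩]
    rw [← hbot, (nonempty_hom_discrete_iff ψ T).1 ⟨x⟩]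
  · obtain ⟨g, -, -⟩ := hη _ (genericFilter A W)
    obtain ⟨k⟩ := (nonempty_hom_discrete_iff ψ W).2 <| imageOpen_eq_top_of_isTrivial <|
      hW _ (regularIncl _ _ ≫ antitoneProj A W) g
    exact ⟨k, trivial, fun _ _ => Subsingleton.elim _ _⟩

end Spectrum

end Stone

end PointFree

theorem mainTheorem6_general {E : Type u} [Category.{v} E] [CartesianMonoidalCategory E]
    [HasFiniteLimits E] [MonoidalClosed E] [HasSubobjectClassifier E] :
    (∀ (φ : E) [Mono (toUnit φ)], Nonempty (discrete φ ≅ (openOfTruth φ).space)) ∧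
    (∀ X : E,
      IsExponential (discrete X) (emptySpace E) (closedOfTruth (support X)).space ∧
      (∃ B : InternalLattice E, IsFreeOnRelations X B ∧ IsQuotientOfTwo (support X) B ∧
        IsSpec B (closedOfTruth (support X)).space) ∧
      IsExponential (closedOfTruth (support X)).space (emptySpace E) (discrete (support X))) ∧
    (∀ (A : InternalLattice E) (S : LocalicSpace E), IsSpec A S →
      IsExponential S (emptySpace E) (discrete (equalizer (A.bot (𝟙_ E)) (A.top (𝟙_ E))))) ∧
    (∀ (φ : E) [Mono (toUnit φ)] (N M : LocalicSpace E),
      IsExponential (discrete φ) (emptySpace E) N → IsExponential N (emptySpace E) M →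
        Nonempty (M ≅ discrete φ)) ∧
    (∀ (L : LocalicSpace E) (U : 𝟙_ E ⟶ L.opens.obj),
      IsLUB {openSubspace L U, closedSubspace L U} (Subspace.whole L) ∧
      IsGLB {openSubspace L U, closedSubspace L U} (Subspace.empty L)) ∧
    (∀ (φ : E) [Mono (toUnit φ)],
      IsExponential (discrete φ) (emptySpace E) (closedOfTruth φ).space ∧
      IsLUB {openOfTruth φ, closedOfTruth φ} (Subspace.whole (point E))) :=
  ⟨fun φ _ => nonempty_discrete_iso_openOfTruth φ,
    fun X => ⟨isExponential_discrete (isSupport_support X),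
      exists_isFreeOnRelations (isSupport_support X), isExponential_closedOfTruth (support X)⟩,
    fun _ _ hS => isExponential_spec hS,
    fun _ _ _ _ => nonempty_iso_discrete_of_isExponential,
    fun L U =>
      ⟨isLUB_openSubspace_closedSubspace L U, isGLB_openSubspace_closedSubspace L U⟩,
    fun φ _ => ⟨isExponential_discrete (isSupport_self φ),
      isLUB_openSubspace_closedSubspace _ _⟩⟩

theorem mainTheorem6 {E : Type u} [Category.{v} E] [CartesianMonoidalCategory E]
    [HasFiniteLimits E] [MonoidalClosed E] [HasSubobjectClassifier E] :
    -- the discrete space on a truth value is the open subspace of `1` that it gives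
    (∀ (φ : E) [Mono (toUnit φ)], Nonempty (discrete φ ≅ (openOfTruth φ).space)) ∧
    -- for discrete `X`: `0 ^ X` is the closed complement of the image of `X` in `1`; it is Stone,
    -- with the Boolean algebra described; and `0 ^ (0 ^ X)` is the image of `X` in `1`
    (∀ X : E,
      IsExponential (discrete X) (emptySpace E) (closedOfTruth (support X)).space ∧
      (∃ B : InternalLattice E, IsFreeOnRelations X B ∧ IsQuotientOfTwo (support X) B ∧
        IsSpec B (closedOfTruth (support X)).space) ∧
      IsExponential (closedOfTruth (support X)).space (emptySpace E) (discrete (support X))) ∧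
    -- for Stone `S = Spec A`: `0 ^ S` is discrete, on the subobject of `1` where `0 = 1` in `A`
    (∀ (A : InternalLattice E) (S : LocalicSpace E), A.IsBoolean → IsSpec A S →
      IsExponential S (emptySpace E) (discrete (equalizer (A.bot (𝟙_ E)) (A.top (𝟙_ E))))) ∧
    -- double negation for truth values
    (∀ (φ : E) [Mono (toUnit φ)] (N M : LocalicSpace E),
      IsExponential (discrete φ) (emptySpace E) N → IsExponential N (emptySpace E) M →
        Nonempty (M ≅ discrete φ)) ∧
    -- every open subspace is complemented by the corresponding closed subspace
    (∀ (L : LocalicSpace E) (U : 𝟙_ E ⟶ L.opens.obj),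
      IsLUB {openSubspace L U, closedSubspace L U} (Subspace.whole L) ∧
      IsGLB {openSubspace L U, closedSubspace L U} (Subspace.empty L)) ∧
    -- excluded middle `φ ∨ 0 ^ φ = 1` for truth values, in the subspaces of `1`
    (∀ (φ : E) [Mono (toUnit φ)],
      IsExponential (discrete φ) (emptySpace E) (closedOfTruth φ).space ∧
      IsLUB {openOfTruth φ, closedOfTruth φ} (Subspace.whole (point E))) :=
  let ⟨hopen, hdiscrete, hspec, hdouble, hcompl, hexcluded⟩ :=
    mainTheorem6_general (E := E)
  ⟨hopen, hdiscrete, fun A S _ => hspec A S, hdouble, hcompl, hexcluded⟩
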